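/- For an integer $k\ge 1$ write $[k]$ for a set of $k$ labels. A \emph{slick $k$-expression} is built from atoms $i(v)$, which create a vertex $v$ with label $i\in[k]$, and binary operations $\oplus_{S,L,R}$ with $S\subseteq[k]\times[k]$ and $L,R:[k]\to[k]$: the labelled graph $G\oplus_{S,L,R}H$ is the disjoint union of $G$ and $H$ in which, for all $(i,j)\in S$, every vertex of $G$ labelled $i$ is joined to every vertex of $H$ labelled $j$, and in which afterwards the labels of $G$ are replaced through $L$ and those of $H$ through $R$. An (ordinary) \emph{$k$-expression} is built from atoms $i(v)$, disjoint unions, edge creations $\eta_{i,j}$ with $i\neq j$ (join every vertex labelled $i$ to every vertex labelled $j$) and relabellings $\rho_{i\to j}$ (change every label $i$ to $j$); the \emph{clique-width} of a nonempty finite graph is the least $k$ such that some $k$-expression produces it after its labels are deleted. \textbf{Statement.} The number of eigenvalues, counted with multiplicity, of the adjacency matrix of a graph on $n$ vertices that lie in a real interval $I$ can be computed in time $O(k^3n)$ for graphs of clique-width $k$ that are given by an expression. Precisely, there are two programs $P$ and $Q$ and an absolute constant $C$ with the following properties for every $k$, every nonempty finite graph $G$ with $n$ vertices and adjacency matrix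 $A$, and every real interval $I$ (open, closed or half-open, bounded or unbounded, possibly empty). \begin{enumerate} \item If $G$ has clique-width at most $k$, then $G$ has a slick $k$-expression. \item Given $k$, any slick $k$-expression of $G$, and the ends of $I$, the program $P$ outputs the number of eigenvalues of $A$ in $I$ (with multiplicity) after at most $C\,k^3n$ elementary operations. \item Given $k$, any $k$-expression of $G$, with $r$ relabellings and $s$ edge creations, and the ends of $I$, the program $Q$ outputs this number after at most $C\,(k^3n+k^2r+ks)$ elementary operations; this is $O(k^3n)$ as soon as $r=O(kn)$ and $s=O(k^2n)$. \end{enumerate} The model of computation: data are binary trees of pointers with real numbers in their leaves; a program is a fixed finite list of mutually recursive procedures, which does not depend on $k$, $G$ or $I$ and contains no constants but rational numbers; an elementary operation is the creation of a pair, the following of a pointer, one of $+,-,\times,/$ on two real numbers (exactly), a test whether a real number is positive or whether a datum is a pair, the composition of two pieces of code, or a procedure call, and each costs one unit of time. Expressions are given as parse trees, in which a label is a number, a map $[k]\to[k]$ the list of its values, and $S$ its zero-one matrix. -/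

import Mathlib

/-! ## Labelled graphs, slick expressions, ordinary expressions, clique-width -/

/-- A graph whose vertices carry labels from a set of `k` labels. -/
structure LabeledGraph (k : ℕ) where
  V : Type
  graph : SimpleGraph V
  label : V → Fin k

namespace LabeledGraph

variable {k : ℕ}

/-- A single vertex with label `i`. -/
def single (i : Fin k) : LabeledGraph k where
  V := Unit
  graph := ⊥
  label := fun _ => i

/-- The disjoint union of two labelled graphs. -/
def disjUnion (G H : LabeledGraph k) : LabeledGraph k where
  V := G.V ⊕ H.V
  graph := SimpleGraph.sum G.graph H.graph
  label := Sum.elim G.label H.label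

/-- Join every vertex labelled `i` to every vertex labelled `j`. -/
def addEdges (i j : Fin k) (G : LabeledGraph k) : LabeledGraph k where
  V := G.V
  graph := G.graph ⊔ SimpleGraph.fromRel (fun u v => G.label u = i ∧ G.label v = j)
  label := G.label

/-- Change every label `i` to `j`. -/
def relabel (i j : Fin k) (G : LabeledGraph k) : LabeledGraph k where
  V := G.V
  graph := G.graph
  label := fun v => if G.label v = i then j else G.label v

/-- The operation `G ⊕_{S,L,R} H`: take the disjoint union, join every vertex of `G` labelled `i`
to every vertex of `H` labelled `j` for all `(i, j) ∈ S`, and afterwards replace the labels of `G`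
through `L` and those of `H` through `R`. -/
def slickJoin (S : Finset (Fin k × Fin k)) (L R : Fin k → Fin k) (G H : LabeledGraph k) :
    LabeledGraph k where
  V := G.V ⊕ H.V
  graph := SimpleGraph.sum G.graph H.graph ⊔
    SimpleGraph.fromRel (fun x y =>
      ∃ u v, x = Sum.inl u ∧ y = Sum.inr v ∧ (G.label u, H.label v) ∈ S)
  label := Sum.elim (fun u => L (G.label u)) (fun v => R (H.label v))

end LabeledGraph

/-- Slick `k`-expressions. Every atom creates a new vertex. -/
inductive SlickExpr (k : ℕ) : Type
  | vertex (i : Fin k) : SlickExpr k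
  | join (S : Finset (Fin k × Fin k)) (L R : Fin k → Fin k) (e₁ e₂ : SlickExpr k) : SlickExpr k

namespace SlickExpr

variable {k : ℕ}

/-- The labelled graph produced by a slick `k`-expression. -/
def eval : SlickExpr k → LabeledGraph k
  | vertex i => LabeledGraph.single i
  | join S L R e₁ e₂ => LabeledGraph.slickJoin S L R e₁.eval e₂.eval

/-- `e` is a slick expression for `G`: forgetting the labels, `e` produces `G` (up to the names of
the vertices). -/
def Generates {V : Type*} (e : SlickExpr k) (G : SimpleGraph V) : Prop :=
  Nonempty (e.eval.graph ≃g G)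

end SlickExpr

/-- Ordinary `k`-expressions (those that define clique-width). -/
inductive CWExpr (k : ℕ) : Type
  | vertex (i : Fin k) : CWExpr k
  | addEdges (i j : Fin k) (hij : i ≠ j) (e : CWExpr k) : CWExpr k
  | relabel (i j : Fin k) (e : CWExpr k) : CWExpr k
  | union (e₁ e₂ : CWExpr k) : CWExpr k

namespace CWExpr

variable {k : ℕ}

/-- The labelled graph produced by a `k`-expression. -/
def eval : CWExpr k → LabeledGraph k
  | vertex i => LabeledGraph.single i
  | addEdges i j _ e => LabeledGraph.addEdges i j e.eval
  | relabel i j e => LabeledGraph.relabel i j e.eval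
  | union e₁ e₂ => LabeledGraph.disjUnion e₁.eval e₂.eval

/-- Forgetting the labels, `e` produces `G` (up to the names of the vertices). -/
def Generates {V : Type*} (e : CWExpr k) (G : SimpleGraph V) : Prop :=
  Nonempty (e.eval.graph ≃g G)

/-- The number of edge-creating operations in a `k`-expression. -/
def numAddEdges : CWExpr k → ℕ
  | vertex _ => 0
  | addEdges _ _ _ e => e.numAddEdges + 1
  | relabel _ _ e => e.numAddEdges
  | union e₁ e₂ => e₁.numAddEdges + e₂.numAddEdges

/-- The number of relabelling operations in a `k`-expression. -/
def numRelabel : CWExpr k → ℕ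
  | vertex _ => 0
  | addEdges _ _ _ e => e.numRelabel
  | relabel _ _ e => e.numRelabel + 1
  | union e₁ e₂ => e₁.numRelabel + e₂.numRelabel

end CWExpr

/-- The clique-width of a (finite, nonempty) graph: the least `k` such that the graph is produced
by a `k`-expression. -/
noncomputable def cliqueWidth {V : Type*} (G : SimpleGraph V) : ℕ :=
  sInf {k : ℕ | ∃ e : CWExpr k, e.Generates G}

/-! ## Real intervals and the number of eigenvalues in them -/

/-- One end of a real interval: absent, included, or excluded. -/
inductive Endpoint : Type
  | unbounded : Endpoint
  | incl (a : ℝ) : Endpoint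
  | excl (a : ℝ) : Endpoint

/-- A real interval of any kind: open, closed or half-open, bounded or not, possibly empty. -/
structure RealInterval where
  lower : Endpoint
  upper : Endpoint

/-- `x` is on the right side of the lower end. -/
def Endpoint.Below : Endpoint → ℝ → Prop
  | unbounded, _ => True
  | incl a, x => a ≤ x
  | excl a, x => a < x

/-- `x` is on the left side of the upper end. -/
def Endpoint.Above : Endpoint → ℝ → Prop
  | unbounded, _ => True
  | incl b, x => x ≤ b
  | excl b, x => x < b

def RealInterval.toSet (I : RealInterval) : Set ℝ :=
  {x | I.lower.Below x ∧ I.upper.Above x}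

open Classical in
/-- The number of eigenvalues, counted with multiplicity, of the adjacency matrix of `G` that lie
in `I`. -/
noncomputable def eigenvalueCount {V : Type*} [Fintype V] [DecidableEq V] (G : SimpleGraph V)
    [DecidableRel G.Adj] (I : Set ℝ) : ℕ :=
  (G.adjMatrix ℝ).charpoly.roots.countP (· ∈ I)

/-! ## The model of computation

Data are binary trees of pointers with real numbers in their leaves. A program is a finite list of
mutually recursive procedures, each of which is a finite piece of code with one argument. Every
elementary operation (creating a pair, following a pointer, an exact arithmetic operation on two
real numbers, a test of the sign of a real number, a procedure call, ...) costs one unit of time.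
A real random access machine with unit costs performs each of them in a bounded number of steps;
there is no rounding operation and there are no constants but rational ones. -/

/-- The data of a computation. -/
inductive Val : Type
  | atom (r : ℝ) : Val
  | nil : Val
  | cons (a b : Val) : Val

/-- The code of a procedure; its argument is called `v` below. -/
inductive Code : Type
  /-- return `v` -/
  | arg : Code
  /-- return a rational constant -/
  | const (q : ℚ) : Code
  | nil : Code
  /-- return the pair of the results of `f` and `g` on `v` -/
  | cons (f g : Code) : Code
  /-- return a component of the pair `v` -/
  | fst : Code
  | snd : Code
  /-- run `f` on `v` and then `g` on the result -/
  | comp (g f : Code) : Code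
  /-- arithmetic with the results of `f` and `g` on `v` -/
  | add (f g : Code) : Code
  | sub (f g : Code) : Code
  | mul (f g : Code) : Code
  | div (f g : Code) : Code
  /-- run `c` on `v`; go on with `f` on `v` if the result is a positive number, and with `g` on `v`
  if it is a number that is not positive -/
  | ifPos (c f g : Code) : Code
  /-- run `c` on `v`; go on with `f` on `v` if the result is a pair, and with `g` on `v` if not -/
  | ifCons (c f g : Code) : Code
  /-- run the `i`-th procedure of the program on `v` -/
  | call (i : ℕ) : Code

/-- `Eval P c v w t`: in the program `P`, the code `c` run on the argument `v` halts with the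
result `w` after exactly `t` elementary operations. -/
inductive Eval (P : List Code) : Code → Val → Val → ℕ → Prop
  | arg (v : Val) : Eval P .arg v v 1
  | const (q : ℚ) (v : Val) : Eval P (.const q) v (.atom (q : ℝ)) 1
  | nil (v : Val) : Eval P .nil v .nil 1
  | cons {f g : Code} {v a b : Val} {s t : ℕ} :
      Eval P f v a s → Eval P g v b t → Eval P (.cons f g) v (.cons a b) (s + t + 1)
  | fst (a b : Val) : Eval P .fst (.cons a b) a 1
  | snd (a b : Val) : Eval P .snd (.cons a b) b 1
  | comp {f g : Code} {v w x : Val} {s t : ℕ} :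
      Eval P f v w s → Eval P g w x t → Eval P (.comp g f) v x (s + t + 1)
  | add {f g : Code} {v : Val} {x y : ℝ} {s t : ℕ} :
      Eval P f v (.atom x) s → Eval P g v (.atom y) t →
      Eval P (.add f g) v (.atom (x + y)) (s + t + 1)
  | sub {f g : Code} {v : Val} {x y : ℝ} {s t : ℕ} :
      Eval P f v (.atom x) s → Eval P g v (.atom y) t →
      Eval P (.sub f g) v (.atom (x - y)) (s + t + 1)
  | mul {f g : Code} {v : Val} {x y : ℝ} {s t : ℕ} :
      Eval P f v (.atom x) s → Eval P g v (.atom y) t →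
      Eval P (.mul f g) v (.atom (x * y)) (s + t + 1)
  | div {f g : Code} {v : Val} {x y : ℝ} {s t : ℕ} :
      Eval P f v (.atom x) s → Eval P g v (.atom y) t → y ≠ 0 →
      Eval P (.div f g) v (.atom (x / y)) (s + t + 1)
  | ifPos_true {c f g : Code} {v w : Val} {x : ℝ} {s t : ℕ} :
      Eval P c v (.atom x) s → 0 < x → Eval P f v w t → Eval P (.ifPos c f g) v w (s + t + 1)
  | ifPos_false {c f g : Code} {v w : Val} {x : ℝ} {s t : ℕ} :
      Eval P c v (.atom x) s → ¬ 0 < x → Eval P g v w t → Eval P (.ifPos c f g) v w (s + t + 1)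
  | ifCons_cons {c f g : Code} {v w a b : Val} {s t : ℕ} :
      Eval P c v (.cons a b) s → Eval P f v w t → Eval P (.ifCons c f g) v w (s + t + 1)
  | ifCons_nil {c f g : Code} {v w : Val} {s t : ℕ} :
      Eval P c v .nil s → Eval P g v w t → Eval P (.ifCons c f g) v w (s + t + 1)
  | ifCons_atom {c f g : Code} {v w : Val} {x : ℝ} {s t : ℕ} :
      Eval P c v (.atom x) s → Eval P g v w t → Eval P (.ifCons c f g) v w (s + t + 1)
  | call {i : ℕ} {c : Code} {v w : Val} {t : ℕ} :
      P[i]? = some c → Eval P c v w t → Eval P (.call i) v w (t + 1)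

/-- The program `P`, started in its procedure number `0` on the input `v`, halts with the output
`w` within `T` elementary operations. -/
def HaltsWithin (P : List Code) (v w : Val) (T : ℕ) : Prop :=
  ∃ t ≤ T, Eval P (.call 0) v w t

/-! ## The format of the input -/

/-- A list of data, as a chain of pairs. -/
def Val.ofList : List Val → Val
  | [] => .nil
  | a :: l => .cons a (Val.ofList l)

/-- Labels are written as the numbers `0, …, k - 1`. -/
noncomputable def encodeLabel {k : ℕ} (i : Fin k) : Val := .atom ((i : ℕ) : ℝ)

/-- A map between labels is written as the list of its values. -/
noncomputable def encodeMap {k : ℕ} (f : Fin k → Fin k) : Val :=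
  Val.ofList (List.ofFn fun i => encodeLabel (f i))

/-- A relation between labels is written as the list of the rows of its zero-one matrix. -/
noncomputable def encodeRel {k : ℕ} (S : Finset (Fin k × Fin k)) : Val :=
  Val.ofList (List.ofFn fun i => Val.ofList (List.ofFn fun j =>
    if (i, j) ∈ S then Val.atom 1 else Val.atom 0))

/-- The parse tree of a slick expression. -/
noncomputable def SlickExpr.encode {k : ℕ} : SlickExpr k → Val
  | .vertex i => Val.ofList [.atom 0, encodeLabel i]
  | .join S L R e₁ e₂ =>
      Val.ofList [.atom 1, encodeRel S, encodeMap L, encodeMap R, e₁.encode, e₂.encode]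

/-- The parse tree of an ordinary expression. -/
noncomputable def CWExpr.encode {k : ℕ} : CWExpr k → Val
  | .vertex i => Val.ofList [.atom 0, encodeLabel i]
  | .addEdges i j _ e => Val.ofList [.atom 1, encodeLabel i, encodeLabel j, e.encode]
  | .relabel i j e => Val.ofList [.atom 2, encodeLabel i, encodeLabel j, e.encode]
  | .union e₁ e₂ => Val.ofList [.atom 3, e₁.encode, e₂.encode]

/-- An absent end is written as `nil`; another one as its position, together with the number `1` if
it is included and `0` if it is excluded. -/
noncomputable def Endpoint.encode : Endpoint → Val
  | unbounded => .nil
  | incl a => Val.ofList [.atom a, .atom 1]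
  | excl a => Val.ofList [.atom a, .atom 0]

noncomputable def RealInterval.encode (I : RealInterval) : Val :=
  Val.ofList [I.lower.encode, I.upper.encode]

/-- The input: the number of labels, the expression, the interval. -/
noncomputable def inputOf (k : ℕ) (expr : Val) (I : RealInterval) : Val :=
  Val.ofList [.atom (k : ℝ), expr, I.encode]

/-!
The count comes down to the inertia of the matrix `A - a I` at the two ends `a` of the interval: by
Sylvester's law of inertia, the numbers of positive, negative and null vectors in any orthogonal
basis for the symmetric bilinear form of `A - a I` are the numbers of eigenvalues above, below and
at `a` (`countP_roots_of_splits`). The two half-lines that belong to the ends of an interval either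
cover the real line or have no point in common, so that the counts for the half-lines determine the
count for the interval (`countP_mem_toSet`).

The inertia is found by dynamic programming over a slick expression. In a subexpression, a vector
`w` on the vertices has a label vector `E w`: the sums of its entries over the vertices of each
label. All edges that are added later depend on the labels only, hence so do the products of `w`
with vectors outside of the subgraph. A vector with `E w = 0` that is orthogonal to the rest and has
been counted by its sign can therefore be forgotten. A state (`IsState`) consists of at most `2k`
vectors that are still needed, stored by their label vectors and their Gram matrix, and of three
numbers that count the vectors split off so far.

* A join adds up the two forms, with cross products given by the zero-one matrix of `S` and by the
  label vectors (`IsFormJoin`, `IsState.exists_join`). It yields up to `4k` vectors.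
* These are reduced to `2k` again (`runs_reduce`): Gaussian elimination on the labels leaves at most
  `k` vectors `P` with independent label vectors and a list `K` of vectors on which the labels
  vanish (`runs_echelon`). An element `h` of `K` is split off if `B h h ≠ 0`, and so is `h + x` or
  `h - x` if `h` is isotropic but `B h x ≠ 0` for some `x` in `K`; if `h` is orthogonal to `K` but
  not to some `p` in `P`, the pair `h, p` is set aside, which happens at most `k` times, and `K` is
  made orthogonal to `p` with the help of `h`; otherwise `h` is a null vector (`diagonalizeSpec`).

Each elimination step is a row operation on `O(k)` vectors with `O(k)` coordinates, so that a
reduction takes `O(k³)` operations, and there are `n - 1` joins. At the root, a reduction with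
respect to no label at all splits off everything.

An ordinary expression is first converted to a slick one. Walking down from the root, the program
carries the relation `F` of pairs of labels that still will be joined and the relabelling `M` that
is still to come (`CWExpr.toSlick`); an edge creation changes two entries of `F`, and a relabelling
replaces one row and one column of `F` by others. With every graph on `n` vertices having an
`n`-expression (`exists_cwExpr`), the clique-width is attained, and the same conversion shows that
graphs of clique-width at most `k` have slick `k`-expressions.

The running times are established with a weakest precondition `Exec` for code that computes by
definitional unfolding; every procedure of the program has a lemma `runs_…` that states its result
and a bound for its running time.
-/

/-! ### Running code -/

/-- `Wp P c v Q`: the code `c` run on `v` halts, and the result and the running time satisfy `Q`. -/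
def Wp (P : List Code) (c : Code) (v : Val) (Q : Val → ℕ → Prop) : Prop :=
  ∃ w t, Eval P c v w t ∧ Q w t

/-- The two components of `v` satisfy `Q`; false if `v` is not a pair. -/
def Val.OnPair (v : Val) (Q : Val → Val → Prop) : Prop :=
  match v with
  | .cons a b => Q a b
  | _ => False

/-- The number in `v` satisfies `Q`; false if `v` is not a number. -/
def Val.OnAtom (v : Val) (Q : ℝ → Prop) : Prop :=
  match v with
  | .atom x => Q x
  | _ => False

/-- The weakest precondition of `Q` for the code `c`, by recursion on `c`. Procedure calls are not
unfolded. Unfolding this definition executes `c` symbolically up to the next call or the next test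
of a sign. -/
noncomputable def Exec (P : List Code) : Code → Val → (Val → ℕ → Prop) → Prop
  | .arg, v, Q => Q v 1
  | .const q, _, Q => Q (.atom q) 1
  | .nil, _, Q => Q .nil 1
  | .cons f g, v, Q => Exec P f v fun a s => Exec P g v fun b t => Q (.cons a b) (s + t + 1)
  | .fst, v, Q => v.OnPair fun a _ => Q a 1
  | .snd, v, Q => v.OnPair fun _ b => Q b 1
  | .comp g f, v, Q => Exec P f v fun a s => Exec P g a fun b t => Q b (s + t + 1)
  | .add f g, v, Q => Exec P f v fun a s => Exec P g v fun b t =>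
      a.OnAtom fun x => b.OnAtom fun y => Q (.atom (x + y)) (s + t + 1)
  | .sub f g, v, Q => Exec P f v fun a s => Exec P g v fun b t =>
      a.OnAtom fun x => b.OnAtom fun y => Q (.atom (x - y)) (s + t + 1)
  | .mul f g, v, Q => Exec P f v fun a s => Exec P g v fun b t =>
      a.OnAtom fun x => b.OnAtom fun y => Q (.atom (x * y)) (s + t + 1)
  | .div f g, v, Q => Exec P f v fun a s => Exec P g v fun b t =>
      a.OnAtom fun x => b.OnAtom fun y => y ≠ 0 ∧ Q (.atom (x / y)) (s + t + 1)
  | .ifPos c f g, v, Q => Exec P c v fun a s => a.OnAtom fun x =>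
      if 0 < x then Exec P f v fun w t => Q w (s + t + 1)
      else Exec P g v fun w t => Q w (s + t + 1)
  | .ifCons c f g, v, Q => Exec P c v fun a s =>
      match a with
      | .cons _ _ => Exec P f v fun w t => Q w (s + t + 1)
      | _ => Exec P g v fun w t => Q w (s + t + 1)
  | .call i, v, Q => Wp P (.call i) v Q

theorem Exec.wp {P : List Code} {c : Code} {v : Val} {Q : Val → ℕ → Prop} (h : Exec P c v Q) :
    Wp P c v Q := by
  induction c generalizing v Q with
  | arg => exact ⟨_, _, .arg v, h⟩
  | const q => exact ⟨_, _, .const q v, h⟩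
  | nil => exact ⟨_, _, .nil v, h⟩
  | cons f g ihf ihg =>
    obtain ⟨_, _, h₁, h⟩ := ihf h
    obtain ⟨_, _, h₂, h⟩ := ihg h
    exact ⟨_, _, .cons h₁ h₂, h⟩
  | fst => cases v with
    | cons a b => exact ⟨_, _, .fst a b, h⟩
    | _ => exact h.elim
  | snd => cases v with
    | cons a b => exact ⟨_, _, .snd a b, h⟩
    | _ => exact h.elim
  | comp g f ihg ihf =>
    obtain ⟨_, _, h₁, h⟩ := ihf h
    obtain ⟨_, _, h₂, h⟩ := ihg h
    exact ⟨_, _, .comp h₁ h₂, h⟩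
  | add f g ihf ihg =>
    obtain ⟨a, _, h₁, h⟩ := ihf h
    obtain ⟨b, _, h₂, h⟩ := ihg h
    cases a <;> cases b <;> first | exact ⟨_, _, .add h₁ h₂, h⟩ | exact h.elim
  | sub f g ihf ihg =>
    obtain ⟨a, _, h₁, h⟩ := ihf h
    obtain ⟨b, _, h₂, h⟩ := ihg h
    cases a <;> cases b <;> first | exact ⟨_, _, .sub h₁ h₂, h⟩ | exact h.elim
  | mul f g ihf ihg =>
    obtain ⟨a, _, h₁, h⟩ := ihf h
    obtain ⟨b, _, h₂, h⟩ := ihg h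
    cases a <;> cases b <;> first | exact ⟨_, _, .mul h₁ h₂, h⟩ | exact h.elim
  | div f g ihf ihg =>
    obtain ⟨a, _, h₁, h⟩ := ihf h
    obtain ⟨b, _, h₂, h⟩ := ihg h
    cases a <;> cases b <;> first | exact ⟨_, _, .div h₁ h₂ h.1, h.2⟩ | exact h.elim
  | ifPos c f g ihc ihf ihg =>
    obtain ⟨a, _, h₁, h⟩ := ihc h
    cases a with
    | atom x =>
      simp only [Val.OnAtom] at h
      split_ifs at h with hx
      · obtain ⟨_, _, h₂, h⟩ := ihf h
        exact ⟨_, _, .ifPos_true h₁ hx h₂, h⟩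
      · obtain ⟨_, _, h₂, h⟩ := ihg h
        exact ⟨_, _, .ifPos_false h₁ hx h₂, h⟩
    | _ => exact h.elim
  | ifCons c f g ihc ihf ihg =>
    obtain ⟨a, _, h₁, h⟩ := ihc h
    cases a with
    | cons a b =>
      obtain ⟨_, _, h₂, h⟩ := ihf h
      exact ⟨_, _, .ifCons_cons h₁ h₂, h⟩
    | nil =>
      obtain ⟨_, _, h₂, h⟩ := ihg h
      exact ⟨_, _, .ifCons_nil h₁ h₂, h⟩
    | atom x =>
      obtain ⟨_, _, h₂, h⟩ := ihg h
      exact ⟨_, _, .ifCons_atom h₁ h₂, h⟩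
  | call i => exact h

theorem Wp.mono {P : List Code} {c : Code} {v : Val} {Q Q' : Val → ℕ → Prop}
    (h : Wp P c v Q) (hQ : ∀ w t, Q w t → Q' w t) : Wp P c v Q' := by
  obtain ⟨_, _, h, h'⟩ := h
  exact ⟨_, _, h, hQ _ _ h'⟩

theorem Exec.mono {P : List Code} {c : Code} {v : Val} {Q Q' : Val → ℕ → Prop}
    (h : Exec P c v Q) (hQ : ∀ w t, Q w t → Q' w t) : Exec P c v Q' := by
  induction c generalizing v Q Q' with
  | arg | const | nil => exact hQ _ _ h
  | fst | snd => cases v <;> first | exact hQ _ _ h | exact h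
  | cons f g ihf ihg => exact ihf h fun _ _ h => ihg h fun _ _ h => hQ _ _ h
  | comp g f ihg ihf => exact ihf h fun _ _ h => ihg h fun _ _ h => hQ _ _ h
  | add f g ihf ihg | sub f g ihf ihg | mul f g ihf ihg =>
    refine ihf h fun a _ h => ihg h fun b _ h => ?_
    cases a <;> cases b <;> first | exact hQ _ _ h | exact h
  | div f g ihf ihg =>
    refine ihf h fun a _ h => ihg h fun b _ h => ?_
    cases a <;> cases b <;> first | exact ⟨h.1, hQ _ _ h.2⟩ | exact h
  | ifPos c f g ihc ihf ihg =>
    refine ihc h fun a _ h => ?_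
    cases a with
    | atom x =>
      simp only [Val.OnAtom] at h ⊢
      split_ifs at h ⊢
      exacts [ihf h fun _ _ h => hQ _ _ h, ihg h fun _ _ h => hQ _ _ h]
    | _ => exact h
  | ifCons c f g ihc ihf ihg =>
    refine ihc h fun a _ h => ?_
    cases a with
    | cons => exact ihf h fun _ _ h => hQ _ _ h
    | _ => exact ihg h fun _ _ h => hQ _ _ h
  | call i => exact Wp.mono h hQ

/-- The code `c` run on `v` halts with the result `w` within `T` elementary operations. -/
def Runs (P : List Code) (c : Code) (v w : Val) (T : ℕ) : Prop :=
  Wp P c v fun w' t => w' = w ∧ t ≤ T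

theorem Runs.wp {P : List Code} {c : Code} {v w : Val} {T : ℕ} {Q : Val → ℕ → Prop}
    (h : Runs P c v w T) (hQ : ∀ t ≤ T, Q w t) : Wp P c v Q := by
  obtain ⟨_, t, h, rfl, ht⟩ := h
  exact ⟨_, t, h, hQ t ht⟩

/-- The same with an argument that is only provably equal. -/
theorem Runs.wp_of_eq {P : List Code} {c : Code} {v v' w : Val} {T : ℕ} {Q : Val → ℕ → Prop}
    (h : Runs P c v w T) (hv : v' = v) (hQ : ∀ t ≤ T, Q w t) : Wp P c v' Q :=
  hv ▸ h.wp hQ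

theorem Runs.mono {P : List Code} {c : Code} {v w : Val} {T T' : ℕ}
    (h : Runs P c v w T) (hT : T ≤ T') : Runs P c v w T' :=
  h.wp fun _ ht => ⟨rfl, ht.trans hT⟩

theorem Runs.haltsWithin {P : List Code} {v w : Val} {T : ℕ} (h : Runs P (.call 0) v w T) :
    HaltsWithin P v w T := by
  obtain ⟨_, t, h, rfl, ht⟩ := h
  exact ⟨t, ht, h⟩

theorem Exec.runs {P : List Code} {i : ℕ} {c : Code} {v w : Val} {T : ℕ} (hi : P[i]? = some c)
    (h : Exec P c v fun w' t => w' = w ∧ t + 1 ≤ T) : Runs P (.call i) v w T := by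
  obtain ⟨_, _, h, hw, ht⟩ := h.wp
  exact ⟨_, _, .call hi h, hw, ht⟩

theorem ite_intro_pos {p A B : Prop} [Decidable p] (hp : p) (h : A) : if p then A else B :=
  (if_pos hp).mpr h

theorem ite_intro_neg {p A B : Prop} [Decidable p] (hp : ¬ p) (h : B) : if p then A else B :=
  (if_neg hp).mpr h

attribute [irreducible] Wp

/-! ### The programs

The argument of every procedure is a list, and code refers to the members of that list by their
positions. A local definition puts its value in front of the list. -/

namespace Code

/-- The member number `i` of the list of variables. -/
def var : ℕ → Code
  | 0 => .fst
  | i + 1 => .comp (var i) .snd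

/-- The list of the results of some pieces of code. -/
def args : List Code → Code
  | [] => .nil
  | c :: cs => .cons c (args cs)

/-- Run the procedure `i` on a list of arguments. -/
def app (i : ℕ) (cs : List Code) : Code := .comp (.call i) (args cs)

/-- Run `body` after putting the result of `c` in front of the list of variables. -/
def letIn (c body : Code) : Code := .comp body (.cons c .arg)

def hd (c : Code) : Code := .comp .fst c

def tl (c : Code) : Code := .comp .snd c

/-- The body of the procedure `self` that applies `f` to all members of the list in its first
argument. The code `f` finds the current member in the place of this list. -/
def mapBody (self : ℕ) (f : Code) : Code :=
  .ifCons (var 0)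
    (.cons (.comp f (.cons (hd (var 0)) .snd)) (.comp (.call self) (.cons (tl (var 0)) .snd)))
    .nil

end Code

/-! The places of the procedures in the two programs; number `0` is the entry point. -/
namespace Proc

abbrev dot : ℕ := 1
abbrev axpy : ℕ := 2
abbrev append : ℕ := 3
abbrev unit : ℕ := 4
abbrev lincomb : ℕ := 5
abbrev value : ℕ := 6
abbrev extract : ℕ := 7
abbrev recAxpy : ℕ := 8
abbrev eliminate : ℕ := 9
abbrev echelon : ℕ := 10
abbrev pivot : ℕ := 11
abbrev diagonalize : ℕ := 12
abbrev shiftPivot : ℕ := 13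
abbrev setPair : ℕ := 14
abbrev gramRow : ℕ := 15
abbrev gram : ℕ := 16
abbrev attach : ℕ := 17
abbrev reduce : ℕ := 18
abbrev labelDots : ℕ := 19
abbrev matVec : ℕ := 20
abbrev mapMatrix : ℕ := 21
abbrev joinLeft : ℕ := 22
abbrev joinRight : ℕ := 23
abbrev join : ℕ := 24
abbrev run : ℕ := 25
abbrev inertia : ℕ := 26
abbrev lowCount : ℕ := 27
abbrev highCount : ℕ := 28
abbrev count : ℕ := 29
abbrev nth : ℕ := 30
abbrev setAt : ℕ := 31
abbrev replicate : ℕ := 32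
abbrev iota : ℕ := 33
abbrev copyColumn : ℕ := 34
abbrev convert : ℕ := 35

end Proc

namespace Code

/-- `dot x y`: the sum of the products of the members of two lists of numbers. -/
def dot : Code :=
  .ifCons (var 0)
    (.ifCons (var 1)
      (.add (.mul (hd (var 0)) (hd (var 1))) (app Proc.dot [tl (var 0), tl (var 1)]))
      (.const 0))
    (.const 0)

/-- `axpy t x y`: the list `x + t y`, where the shorter list is padded by zeros. -/
def axpy : Code :=
  .ifCons (var 2)
    (.ifCons (var 1)
      (.cons (.add (hd (var 1)) (.mul (var 0) (hd (var 2))))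
        (app Proc.axpy [var 0, tl (var 1), tl (var 2)]))
      (.cons (.mul (var 0) (hd (var 2))) (app Proc.axpy [var 0, var 1, tl (var 2)])))
    (var 1)

/-- `append x y`: the concatenation of two lists. -/
def append : Code :=
  .ifCons (var 0) (.cons (hd (var 0)) (app Proc.append [tl (var 0), var 1])) (var 1)

/-- `unit i`: a list of `i` zeros followed by a one. -/
def unit : Code :=
  .ifPos (var 0) (.cons (.const 0) (app Proc.unit [.sub (var 0) (.const 1)]))
    (.cons (.const 1) .nil)

/-- `lincomb e rows`: the linear combination of the lists in `rows` with the coefficients `e`. -/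
def lincomb : Code :=
  .ifCons (var 0)
    (.ifCons (var 1)
      (app Proc.axpy [hd (var 0), app Proc.lincomb [tl (var 0), tl (var 1)], hd (var 1)]) .nil)
    .nil

/-- `value x φ`: the value of the functional `φ` on the record `x`. -/
def value : Code :=
  .add (app Proc.dot [hd (var 0), hd (var 1)])
    (app Proc.dot [hd (tl (var 0)), tl (var 1)])

/-- `extract X φ`: the first record in `X` on which `φ` does not vanish, followed by the others;
`nil` if there is none. -/
def extract : Code :=
  .ifCons (var 0)
    (letIn (app Proc.value [hd (var 0), var 1])
      (.ifPos (.mul (var 0) (var 0)) (var 1)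
        (letIn (app Proc.extract [tl (var 1), var 2])
          (.ifCons (var 0) (.cons (hd (var 0)) (.cons (hd (var 2)) (tl (var 0)))) .nil))))
    .nil

/-- `recAxpy t x y`: the record `x + t y`. -/
def recAxpy : Code :=
  .cons (app Proc.axpy [var 0, hd (var 1), hd (var 2)])
    (.cons (app Proc.axpy [var 0, hd (tl (var 1)), hd (tl (var 2))])
      (app Proc.axpy [var 0, tl (tl (var 1)), tl (tl (var 2))]))

/-- `eliminate X φ p d`: subtract from all `x` in `X` the multiple of `p` that makes `φ` vanish,
where `d` is the value of `φ` on `p`. -/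
def eliminate : Code :=
  mapBody Proc.eliminate
    (app Proc.recAxpy
      [.div (.sub (.const 0) (app Proc.value [var 0, var 1])) (var 3), var 0, var 2])

/-- `echelon k δ X P`: for each of the next `k` labels, the first of which has the unit vector `δ`,
move one record on which it does not vanish from `X` to `P` and eliminate the label from `X`. -/
def echelon : Code :=
  .ifPos (var 0)
    (letIn (.cons (var 1) .nil)
      (letIn (app Proc.extract [var 3, var 0])
        (.ifCons (var 0)
          (app Proc.echelon [.sub (var 2) (.const 1), .cons (.const 0) (var 3),
            app Proc.eliminate
              [tl (var 0), var 1, hd (var 0), app Proc.value [hd (var 0), var 1]],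
            .cons (hd (var 0)) (var 5)])
          (app Proc.echelon [.sub (var 2) (.const 1), .cons (.const 0) (var 3),
            var 4, var 5]))))
    (.cons (var 2) (var 3))

/-- `pivot h K P O p q z`: split off the anisotropic vector `h`, and go on with `diagonalize`. -/
def pivot : Code :=
  letIn (.cons .nil (tl (tl (var 0))))
    (letIn (app Proc.value [var 1, var 0])
      (app Proc.diagonalize
        [app Proc.eliminate [var 3, var 1, var 2, var 0],
          app Proc.eliminate [var 4, var 1, var 2, var 0], var 5,
          .ifPos (var 0) (.add (var 6) (.const 1)) (var 6),
          .ifPos (var 0) (var 7) (.add (var 7) (.const 1)), var 8]))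

/-- `diagonalize K P O p q z`: treat the vectors in `K`, which lie in the kernel of all labels, one
after the other. Each is split off as a positive, negative or null vector, or moved to the output
`O` together with a vector in `P`. -/
def diagonalize : Code :=
  .ifCons (var 0)
    (letIn (.cons .nil (tl (tl (hd (var 0)))))
      (letIn (app Proc.value [hd (var 1), var 0])
        (.ifPos (.mul (var 0) (var 0))
          (app Proc.pivot [hd (var 2), tl (var 2), var 3, var 4, var 5, var 6, var 7])
          (letIn (app Proc.extract [tl (var 2), var 1])
            (.ifCons (var 0)
              (app Proc.shiftPivot
                [hd (var 3), hd (var 0), tl (var 3), var 4, var 5, var 6, var 7, var 8])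
              (letIn (app Proc.extract [var 4, var 2])
                (.ifCons (var 0)
                  (app Proc.setPair
                    [hd (var 4), hd (var 0), tl (var 4), tl (var 0), var 6, var 7, var 8, var 9])
                  (app Proc.diagonalize
                    [tl (var 4), var 5, var 6, var 7, var 8, .add (var 9) (.const 1)]))))))))
    (.cons (app Proc.append [var 2, var 1]) (.cons (var 3) (.cons (var 4) (var 5))))

/-- `shiftPivot h x K P O p q z`: use `h + x` or `h - x` as a pivot, whichever is anisotropic. -/
def shiftPivot : Code :=
  letIn (app Proc.recAxpy [.const 1, var 0, var 1])
    (letIn (app Proc.value [var 0, .cons .nil (tl (tl (var 0)))])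
      (.ifPos (.mul (var 0) (var 0))
        (app Proc.pivot [var 1, var 4, var 5, var 6, var 7, var 8, var 9])
        (app Proc.pivot
          [app Proc.recAxpy [.const (-1), var 2, var 3], var 4, var 5, var 6, var 7, var 8,
            var 9])))

/-- `setPair h p K P O p q z`: move `h` and `p` to the output and make `K` orthogonal to `p`. -/
def setPair : Code :=
  letIn (.cons .nil (tl (tl (var 1))))
    (app Proc.diagonalize
      [app Proc.eliminate [var 3, var 0, var 1, app Proc.value [var 1, var 0]], var 4,
        .cons (var 1) (.cons (var 2) (var 5)), var 6, var 7, var 8])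

/-- `gramRow Y g`: the values of the functional `g` on the records in `Y`. -/
def gramRow : Code :=
  mapBody Proc.gramRow (app Proc.dot [hd (tl (var 0)), var 1])

/-- `gram Y Y`: the labels and the rows of the Gram matrix of the records in `Y`. -/
def gram : Code :=
  mapBody Proc.gram (.cons (hd (var 0)) (app Proc.gramRow [var 1, tl (tl (var 0))]))

/-- `attach X δ`: insert the coordinates into the members of `X`; the first has the coordinates
`δ`. -/
def attach : Code :=
  .ifCons (var 0)
    (.cons (.cons (hd (hd (var 0))) (.cons (var 1) (tl (hd (var 0)))))
      (app Proc.attach [tl (var 0), .cons (.const 0) (var 1)]))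
    .nil

/-- `reduce k X p q z`: reduce a state with respect to the first `k` labels. -/
def reduce : Code :=
  letIn (app Proc.echelon [var 0, .cons (.const 1) .nil,
      app Proc.attach [var 1, .cons (.const 1) .nil], .nil])
    (letIn (app Proc.diagonalize [hd (var 0), tl (var 0), .nil, var 3, var 4, var 5])
      (.cons (app Proc.gram [hd (var 0), hd (var 0)]) (tl (var 0))))

/-- `labelDots X v`: the products of `v` with the label vectors of the members of `X`. -/
def labelDots : Code :=
  mapBody Proc.labelDots (app Proc.dot [hd (var 0), var 1])

/-- `matVec M v`: the products of `v` with the members of `M`. -/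
def matVec : Code :=
  mapBody Proc.matVec (app Proc.dot [var 0, var 1])

/-- `mapMatrix L`: the unit vectors of the members of a list of labels. -/
def mapMatrix : Code :=
  mapBody Proc.mapMatrix (app Proc.unit [var 0])

/-- `joinLeft X₁ X₂ S L`: the vectors of a join that come from the left side. -/
def joinLeft : Code :=
  mapBody Proc.joinLeft
    (.cons (app Proc.lincomb [hd (var 0), var 3])
      (app Proc.append
        [tl (var 0), app Proc.labelDots [var 1, app Proc.lincomb [hd (var 0), var 2]]]))

/-- `joinRight X₂ X₁ S R`: the vectors of a join that come from the right side. -/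
def joinRight : Code :=
  mapBody Proc.joinRight
    (.cons (app Proc.lincomb [hd (var 0), var 3])
      (app Proc.append
        [app Proc.labelDots [var 1, app Proc.matVec [var 2, hd (var 0)]], tl (var 0)]))

/-- `join s₁ s₂ S L R k`: the reduced state of a join. -/
def join : Code :=
  app Proc.reduce [var 5,
    app Proc.append
      [app Proc.joinLeft [hd (var 0), hd (var 1), var 2, app Proc.mapMatrix [var 3]],
        app Proc.joinRight [hd (var 1), hd (var 0), var 2, app Proc.mapMatrix [var 4]]],
    .add (hd (tl (var 0))) (hd (tl (var 1))),
    .add (hd (tl (tl (var 0)))) (hd (tl (tl (var 1)))),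
    .add (tl (tl (tl (var 0)))) (tl (tl (tl (var 1))))]

/-- `run e k a`: the state of a slick expression `e` for the shift `a`. -/
def run : Code :=
  .ifPos (hd (var 0))
    (letIn (tl (var 0))
      (app Proc.join
        [app Proc.run [.comp (var 3) (var 0), var 2, var 3],
          app Proc.run [.comp (var 4) (var 0), var 2, var 3],
          .comp (var 0) (var 0), .comp (var 1) (var 0), .comp (var 2) (var 0), var 2]))
    (.cons
      (.cons (.cons (app Proc.unit [hd (tl (var 0))]) (.cons (.sub (.const 0) (var 2)) .nil)) .nil)
      (.cons (.const 0) (.cons (.const 0) (.const 0))))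

/-- `inertia e k a`: the numbers of eigenvalues above, below and at `a`. -/
def inertia : Code :=
  letIn (app Proc.run [var 0, var 1, var 2])
    (tl (app Proc.reduce [.const 0, hd (var 0), hd (tl (var 0)), hd (tl (tl (var 0))),
      tl (tl (tl (var 0)))]))

/-- `lowCount end e k`: the number of eigenvalues on the right side of a lower end. -/
def lowCount : Code :=
  .ifCons (var 0)
    (letIn (app Proc.inertia [var 1, var 2, hd (var 0)])
      (.ifPos (hd (tl (var 1))) (.add (hd (var 0)) (tl (tl (var 0)))) (hd (var 0))))
    (letIn (app Proc.inertia [var 1, var 2, .const 0])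
      (.add (hd (var 0)) (.add (hd (tl (var 0))) (tl (tl (var 0))))))

/-- `highCount end e k`: the number of eigenvalues on the left side of an upper end. -/
def highCount : Code :=
  .ifCons (var 0)
    (letIn (app Proc.inertia [var 1, var 2, hd (var 0)])
      (.ifPos (hd (tl (var 1))) (.add (hd (tl (var 0))) (tl (tl (var 0)))) (hd (tl (var 0)))))
    (letIn (app Proc.inertia [var 1, var 2, .const 0])
      (.add (hd (var 0)) (.add (hd (tl (var 0))) (tl (tl (var 0))))))

/-- `count k e I`: the number of eigenvalues in an interval, from a slick expression. The call of
`lowCount` with an absent end returns the number of all eigenvalues. -/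
def count : Code :=
  letIn (.sub
      (.add (app Proc.lowCount [hd (var 2), var 1, var 0])
        (app Proc.highCount [hd (tl (var 2)), var 1, var 0]))
      (app Proc.lowCount [.nil, var 1, var 0]))
    (.ifPos (var 0) (var 0) (.const 0))

/-- `nth l i`: the member number `i` of a list. -/
def nth : Code :=
  .ifPos (var 1) (app Proc.nth [tl (var 0), .sub (var 1) (.const 1)]) (hd (var 0))

/-- `setAt l i a`: replace the member number `i` of a list by `a`. -/
def setAt : Code :=
  .ifPos (var 1)
    (.cons (hd (var 0)) (app Proc.setAt [tl (var 0), .sub (var 1) (.const 1), var 2]))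
    (.cons (var 2) (tl (var 0)))

/-- `replicate i a`: a list with `i` members `a`. -/
def replicate : Code :=
  .ifPos (var 0) (.cons (var 1) (app Proc.replicate [.sub (var 0) (.const 1), var 1])) .nil

/-- `iota i l`: the numbers `0, …, i - 1` in front of the list `l`. -/
def iota : Code :=
  .ifPos (var 0)
    (app Proc.iota [.sub (var 0) (.const 1), .cons (.sub (var 0) (.const 1)) (var 1)]) (var 1)

/-- `copyColumn M i j`: replace the column `i` of a matrix by its column `j`. -/
def copyColumn : Code :=
  mapBody Proc.copyColumn (app Proc.setAt [var 0, var 1, app Proc.nth [var 0, var 2]])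

/-- `convert e F M id`: the slick expression for `e`, where the edges in `F` and the relabelling `M`
are still to come; `id` is the list of all labels. -/
def convert : Code :=
  .ifPos (hd (var 0))
    (.ifPos (.sub (hd (var 0)) (.const 1))
      (.ifPos (.sub (hd (var 0)) (.const 2))
        (args [.const 1, var 1, var 2, var 2,
          app Proc.convert [hd (tl (var 0)), var 1, var 3, var 3],
          app Proc.convert [hd (tl (tl (var 0))), var 1, var 3, var 3]])
        (letIn (hd (tl (var 0))) (letIn (hd (tl (tl (var 1))))
          (app Proc.convert [hd (tl (tl (tl (var 2)))),
            app Proc.copyColumn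
              [app Proc.setAt [var 3, var 1, app Proc.nth [var 3, var 0]], var 1, var 0],
            app Proc.setAt [var 4, var 1, app Proc.nth [var 4, var 0]], var 5]))))
      (letIn (hd (tl (var 0))) (letIn (hd (tl (tl (var 1))))
        (letIn (app Proc.setAt
            [var 3, var 1, app Proc.setAt [app Proc.nth [var 3, var 1], var 0, .const 1]])
          (app Proc.convert [hd (tl (tl (tl (var 3)))),
            app Proc.setAt
              [var 0, var 1, app Proc.setAt [app Proc.nth [var 0, var 1], var 2, .const 1]],
            var 5, var 6])))))
    (args [.const 0, app Proc.nth [var 2, hd (tl (var 0))]])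

end Code

/-- The procedures other than the entry point. -/
def procedures : List Code :=
  [.dot, .axpy, .append, .unit, .lincomb, .value, .extract, .recAxpy, .eliminate, .echelon, .pivot,
    .diagonalize, .shiftPivot, .setPair, .gramRow, .gram, .attach, .reduce, .labelDots, .matVec,
    .mapMatrix, .joinLeft, .joinRight, .join, .run, .inertia, .lowCount, .highCount, .count, .nth,
    .setAt, .replicate, .iota, .copyColumn, .convert]

/-- The program that starts from a slick expression. -/
def slickProgram : List Code := .call Proc.count :: procedures

/-- The program that starts from an ordinary expression. -/
def cwProgram : List Code :=
  .app Proc.count [.var 0,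
    .app Proc.convert [.var 1, .app Proc.replicate [.var 0, .app Proc.replicate [.var 0, .const 0]],
      .app Proc.iota [.var 0, .nil], .app Proc.iota [.var 0, .nil]],
    .var 2] :: procedures

/-! ### Lists of numbers -/

/-- The encoding of a list of real numbers. -/
def encL (l : List ℝ) : Val := Val.ofList (l.map Val.atom)

@[simp] theorem encL_nil : encL [] = .nil := rfl

@[simp] theorem encL_cons (a : ℝ) (l : List ℝ) : encL (a :: l) = .cons (.atom a) (encL l) := rfl

/-- The scalar product of two lists; the shorter one is padded by zeros. -/
def ldot : List ℝ → List ℝ → ℝ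
  | a :: x, b :: y => a * b + ldot x y
  | _, _ => 0

/-- The list `x + t y`, where the shorter list is padded by zeros. -/
def laxpy (t : ℝ) : List ℝ → List ℝ → List ℝ
  | x, [] => x
  | [], b :: y => (t * b) :: laxpy t [] y
  | a :: x, b :: y => (a + t * b) :: laxpy t x y

/-- The linear combination of the lists in `rows` with the coefficients `e`. -/
def llin : List ℝ → List (List ℝ) → List ℝ
  | a :: e, r :: rows => laxpy a (llin e rows) r
  | _, _ => []

/-- The unit vector number `i`. -/
def lunit (i : ℕ) : List ℝ := List.replicate i 0 ++ [1]

/-- The linear combination of the vectors in `b` with the coefficients `c`. -/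
def lsum {W : Type*} [AddCommGroup W] [Module ℝ W] : List ℝ → List W → W
  | a :: c, w :: b => a • w + lsum c b
  | _, _ => 0

@[simp] theorem ldot_nil_left (y : List ℝ) : ldot [] y = 0 := by simp [ldot]

@[simp] theorem ldot_nil_right (x : List ℝ) : ldot x [] = 0 := by cases x <;> simp [ldot]

@[simp] theorem ldot_cons (a b : ℝ) (x y : List ℝ) :
    ldot (a :: x) (b :: y) = a * b + ldot x y := rfl

@[simp] theorem laxpy_nil_right (t : ℝ) (x : List ℝ) : laxpy t x [] = x := by
  cases x <;> simp [laxpy]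

theorem getD_laxpy (t : ℝ) (x y : List ℝ) (l : ℕ) :
    (laxpy t x y).getD l 0 = x.getD l 0 + t * y.getD l 0 := by
  induction y generalizing x l with
  | nil => simp
  | cons b y ih =>
    cases x with
    | nil => cases l with
      | zero => simp [laxpy]
      | succ l => simpa [laxpy] using ih [] l
    | cons a x => cases l with
      | zero => simp [laxpy]
      | succ l => simpa [laxpy] using ih x l

theorem length_laxpy (t : ℝ) (x y : List ℝ) :
    (laxpy t x y).length = max x.length y.length := by
  induction y generalizing x with
  | nil => simp
  | cons b y ih => cases x <;> simp [laxpy, ih]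

theorem ldot_laxpy (t : ℝ) (x y z : List ℝ) :
    ldot z (laxpy t x y) = ldot z x + t * ldot z y := by
  induction y generalizing x z with
  | nil => simp
  | cons b y ih =>
    cases z with
    | nil => simp
    | cons c z =>
      cases x with
      | nil => simp [laxpy, ih]; ring
      | cons a x => simp [laxpy, ih]; ring

theorem ldot_comm (x y : List ℝ) : ldot x y = ldot y x := by
  induction x generalizing y with
  | nil => simp
  | cons a x ih => cases y with
    | nil => simp
    | cons b y => simp [ih y, mul_comm]

@[simp] theorem lunit_zero : lunit 0 = [1] := rfl

theorem lunit_succ (i : ℕ) : lunit (i + 1) = 0 :: lunit i := rfl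

@[simp] theorem length_lunit (i : ℕ) : (lunit i).length = i + 1 := by simp [lunit]

theorem getD_lunit (i l : ℕ) : (lunit i).getD l 0 = if l = i then 1 else 0 := by
  induction i generalizing l with
  | zero => cases l <;> simp
  | succ i ih => cases l with
    | zero => simp [lunit_succ]
    | succ l => simpa [lunit_succ] using ih l

theorem ldot_lunit (x : List ℝ) (i : ℕ) : ldot x (lunit i) = x.getD i 0 := by
  induction i generalizing x with
  | zero => cases x <;> simp
  | succ i ih => cases x with
    | nil => simp
    | cons a x => simpa [lunit_succ] using ih x

section lsum

variable {W : Type*} [AddCommGroup W] [Module ℝ W]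

@[simp] theorem lsum_nil_left (b : List W) : lsum [] b = 0 := by simp [lsum]

@[simp] theorem lsum_nil_right (c : List ℝ) : lsum c ([] : List W) = 0 := by
  cases c <;> simp [lsum]

@[simp] theorem lsum_cons (a : ℝ) (c : List ℝ) (w : W) (b : List W) :
    lsum (a :: c) (w :: b) = a • w + lsum c b := rfl

theorem lsum_laxpy (t : ℝ) (x y : List ℝ) (b : List W) :
    lsum (laxpy t x y) b = lsum x b + t • lsum y b := by
  induction y generalizing x b with
  | nil => simp
  | cons a y ih =>
    cases b with
    | nil => simp
    | cons w b =>
      cases x with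
      | nil => simp [laxpy, ih, mul_smul]
      | cons c x => simp [laxpy, ih, mul_smul, add_smul]; abel

theorem lsum_lunit (pre : List W) (w : W) (b : List W) :
    lsum (lunit pre.length) (pre ++ w :: b) = w := by
  induction pre with
  | nil => simp
  | cons u pre ih => simpa [lunit_succ] using ih

theorem ldot_map (c : List ℝ) (b : List W) (f : W →ₗ[ℝ] ℝ) :
    ldot c (b.map f) = f (lsum c b) := by
  induction c generalizing b with
  | nil => simp
  | cons a c ih => cases b with
    | nil => simp
    | cons w b => simp [ih]

end lsum

theorem length_llin_le (e : List ℝ) (rows : List (List ℝ)) (N : ℕ)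
    (h : ∀ r ∈ rows, r.length ≤ N) : (llin e rows).length ≤ N := by
  induction e generalizing rows with
  | nil => simp [llin]
  | cons a e ih => cases rows with
    | nil => simp [llin]
    | cons r rows =>
      simp only [List.mem_cons, forall_eq_or_imp] at h
      simp [llin, length_laxpy, h.1, ih rows h.2]

theorem ldot_llin_ofFn {k : ℕ} (z e : List ℝ) (r : Fin k → List ℝ) :
    ldot z (llin e (List.ofFn r)) = ∑ a : Fin k, e.getD a 0 * ldot z (r a) := by
  induction k generalizing e with
  | zero => cases e <;> simp [llin]
  | succ k ih =>
    cases e with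
    | nil => simp [llin]
    | cons a e =>
      rw [List.ofFn_succ, llin, ldot_laxpy, ih, Fin.sum_univ_succ]
      simp [add_comm]

theorem getD_llin_ofFn {k : ℕ} (e : List ℝ) (r : Fin k → List ℝ) (l : ℕ) :
    (llin e (List.ofFn r)).getD l 0 = ∑ a : Fin k, e.getD a 0 * (r a).getD l 0 := by
  simp only [← ldot_lunit, ldot_comm _ (lunit l), ldot_llin_ofFn]

theorem ldot_ofFn {k : ℕ} (e : List ℝ) (s : Fin k → ℝ) :
    ldot e (List.ofFn s) = ∑ a : Fin k, e.getD a 0 * s a := by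
  induction k generalizing e with
  | zero => simp
  | succ k ih =>
    cases e with
    | nil => simp
    | cons a e => rw [List.ofFn_succ, ldot_cons, ih, Fin.sum_univ_succ]; simp

/-! ### Procedures on lists -/

section procedures

variable (m : Code)

theorem runs_dot (x y : List ℝ) :
    Runs (m :: procedures) (.call Proc.dot) (.ofList [encL x, encL y]) (.atom (ldot x y))
      (50 * x.length + 50) := by
  induction x generalizing y with
  | nil => exact Exec.runs (c := .dot) rfl ⟨by simp, by omega⟩
  | cons a x ih =>
    refine Exec.runs (c := .dot) rfl ?_
    cases y with
    | nil => exact ⟨by simp, by omega⟩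
    | cons b y =>
      refine (ih y).wp fun t ht => ?_
      exact ⟨rfl, by simp only [List.length_cons]; omega⟩

theorem runs_axpy (t : ℝ) (x y : List ℝ) :
    Runs (m :: procedures) (.call Proc.axpy) (.ofList [.atom t, encL x, encL y])
      (encL (laxpy t x y)) (70 * y.length + 70) := by
  induction y generalizing x with
  | nil => exact Exec.runs (c := .axpy) rfl ⟨by simp, by omega⟩
  | cons b y ih =>
    refine Exec.runs (c := .axpy) rfl ?_
    cases x with
    | nil =>
      refine (ih []).wp fun t ht => ?_
      exact ⟨rfl, by simp only [List.length_cons]; omega⟩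
    | cons a x =>
      refine (ih x).wp fun t ht => ?_
      exact ⟨rfl, by simp only [List.length_cons]; omega⟩

theorem runs_append (x y : List Val) :
    Runs (m :: procedures) (.call Proc.append) (.ofList [.ofList x, .ofList y])
      (.ofList (x ++ y)) (40 * x.length + 40) := by
  induction x with
  | nil => exact Exec.runs (c := .append) rfl ⟨rfl, by omega⟩
  | cons a x ih =>
    refine Exec.runs (c := .append) rfl ?_
    refine ih.wp fun t ht => ?_
    exact ⟨rfl, by simp only [List.length_cons]; omega⟩

theorem sub_const_one (i : ℕ) : ((i + 1 : ℕ) : ℝ) - ((1 : ℚ) : ℝ) = i := by simp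

theorem succ_cast_pos (i : ℕ) : 0 < ((i + 1 : ℕ) : ℝ) := by positivity

theorem zero_cast_not_pos : ¬ 0 < ((0 : ℕ) : ℝ) := by simp

theorem runs_unit (i : ℕ) :
    Runs (m :: procedures) (.call Proc.unit) (.ofList [.atom i]) (encL (lunit i))
      (30 * i + 30) := by
  induction i with
  | zero =>
    refine Exec.runs (c := .unit) rfl (ite_intro_neg zero_cast_not_pos ?_)
    exact ⟨by simp, by omega⟩
  | succ i ih =>
    refine Exec.runs (c := .unit) rfl (ite_intro_pos (succ_cast_pos i) ?_)
    refine ih.wp_of_eq (by rw [sub_const_one]; rfl) fun t ht => ?_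
    exact ⟨by simp [lunit_succ], by omega⟩

theorem runs_lincomb (e : List ℝ) (rows : List (List ℝ)) (N : ℕ)
    (h : ∀ r ∈ rows, r.length ≤ N) :
    Runs (m :: procedures) (.call Proc.lincomb) (.ofList [encL e, .ofList (rows.map encL)])
      (encL (llin e rows)) ((70 * N + 130) * e.length + 30) := by
  induction e generalizing rows with
  | nil => exact Exec.runs (c := .lincomb) rfl ⟨by simp [llin], by omega⟩
  | cons a e ih =>
    refine Exec.runs (c := .lincomb) rfl ?_
    cases rows with
    | nil => exact ⟨by simp [llin], by rw [List.length_cons, mul_add]; omega⟩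
    | cons r rows =>
      simp only [List.mem_cons, forall_eq_or_imp] at h
      refine (ih rows h.2).wp fun t ht => ?_
      refine (runs_axpy m a _ r).wp fun s hs => ?_
      have := h.1
      exact ⟨rfl, by rw [List.length_cons, mul_add]; omega⟩

theorem runs_map {α : Type*} {self : ℕ} {f : Code}
    (hself : (m :: procedures)[self]? = some (.mapBody self f)) (g F : α → Val) (l : List α)
    (r : Val) (T : ℕ)
    (h : ∀ a ∈ l, Exec (m :: procedures) f (.cons (g a) r) fun w t => w = F a ∧ t ≤ T) :
    Runs (m :: procedures) (.call self) (.cons (.ofList (l.map g)) r) (.ofList (l.map F))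
      ((T + 30) * l.length + 20) := by
  induction l with
  | nil => exact Exec.runs hself ⟨rfl, by omega⟩
  | cons a l ih =>
    simp only [List.mem_cons, forall_eq_or_imp] at h
    refine Exec.runs hself ?_
    show Exec _ f (.cons (g a) r) _
    refine h.1.mono ?_
    rintro _ t ⟨rfl, ht⟩
    refine (ih h.2).wp fun s hs => ?_
    exact ⟨rfl, by rw [List.length_cons, mul_add]; omega⟩

end procedures

/-! ### Records and functionals -/

section records

variable {W : Type*} [AddCommGroup W] [Module ℝ W]

/-- A vector `w` as the programs store it: by its labels `E w`, by coordinates with respect to the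
list `b`, and by its products with the members of `b` under the form `B`. The last are determined
by `w`, so that they are not a field of the structure. Labels and coordinates may be padded by
zeros; the lists have at most `N` members. -/
structure Record (B : LinearMap.BilinForm ℝ W) (E : W →ₗ[ℝ] ℕ → ℝ) (b : List W) (N : ℕ) where
  w : W
  e : List ℝ
  c : List ℝ
  getD_e : ∀ l, e.getD l 0 = E w l
  lsum_c : lsum c b = w
  length_e : e.length ≤ N
  length_c : c.length ≤ N

/-- A linear functional as the programs store it: by a list that acts on labels and one that acts
on coordinates. -/
structure Functional (B : LinearMap.BilinForm ℝ W) (E : W →ₗ[ℝ] ℕ → ℝ) (b : List W) where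
  f : W →ₗ[ℝ] ℝ
  φe : List ℝ
  φc : List ℝ
  spec : ∀ (w : W) (e c : List ℝ), (∀ l, e.getD l 0 = E w l) → lsum c b = w →
    ldot e φe + ldot c φc = f w

variable {B : LinearMap.BilinForm ℝ W} {E : W →ₗ[ℝ] ℕ → ℝ} {b : List W} {N : ℕ}

namespace Record

/-- The encoding of a record. -/
def enc (x : Record B E b N) : Val :=
  .cons (encL x.e) (.cons (encL x.c) (encL (b.map (B x.w))))

/-- The encoding of a list of records. -/
def encs (X : List (Record B E b N)) : Val := .ofList (X.map enc)

@[simp] theorem encs_nil : encs ([] : List (Record B E b N)) = .nil := rfl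

@[simp] theorem encs_cons (x : Record B E b N) (X : List (Record B E b N)) :
    encs (x :: X) = .cons x.enc (encs X) := rfl

/-- The record of `x + t y`. -/
def axpy (t : ℝ) (x y : Record B E b N) : Record B E b N where
  w := x.w + t • y.w
  e := laxpy t x.e y.e
  c := laxpy t x.c y.c
  getD_e l := by rw [getD_laxpy, x.getD_e, y.getD_e]; simp
  lsum_c := by rw [lsum_laxpy, x.lsum_c, y.lsum_c]
  length_e := by rw [length_laxpy]; exact max_le x.length_e y.length_e
  length_c := by rw [length_laxpy]; exact max_le x.length_c y.length_c

end Record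

namespace Functional

/-- The encoding of a functional. -/
def enc (φ : Functional B E b) : Val := .cons (encL φ.φe) (encL φ.φc)

/-- The functional that reads off the label `l`. -/
def label (B : LinearMap.BilinForm ℝ W) (E : W →ₗ[ℝ] ℕ → ℝ) (b : List W) (l : ℕ) :
    Functional B E b where
  f := LinearMap.proj l ∘ₗ E
  φe := lunit l
  φc := []
  spec w e c he _ := by simp [ldot_lunit, ← he]

/-- The functional `B x`. -/
def gram (x : Record B E b N) : Functional B E b where
  f := B x.w
  φe := []
  φc := b.map (B x.w)
  spec w e c _ hc := by simp [ldot_map, hc]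

end Functional

/-- Subtract from every record in `X` the multiple of `p` that makes `φ` vanish. -/
noncomputable def eliminated (φ : Functional B E b) (p : Record B E b N)
    (X : List (Record B E b N)) : List (Record B E b N) :=
  X.map fun x => Record.axpy ((0 - φ.f x.w) / φ.f p.w) x p

theorem laxpy_map (t : ℝ) (u v : W) (l : List W) :
    laxpy t (l.map (B u)) (l.map (B v)) = l.map (B (u + t • v)) := by
  induction l with
  | nil => simp
  | cons w l ih => simp only [List.map_cons, laxpy, ih]; simp

/-! ### Spans of lists -/

/-- The span of the members of a list. -/
def lspan (l : List W) : Submodule ℝ W := Submodule.span ℝ {w | w ∈ l}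

@[simp] theorem lspan_nil : lspan ([] : List W) = ⊥ := by simp [lspan]

theorem lspan_cons (w : W) (l : List W) :
    lspan (w :: l) = Submodule.span ℝ {w} ⊔ lspan l := by
  rw [lspan, lspan, ← Submodule.span_union]
  congr 1
  ext; simp

theorem lspan_append (l l' : List W) : lspan (l ++ l') = lspan l ⊔ lspan l' := by
  rw [lspan, lspan, lspan, ← Submodule.span_union]
  congr 1
  ext; simp

theorem lspan_perm {l l' : List W} (h : l.Perm l') : lspan l = lspan l' := by
  rw [lspan, lspan]
  congr 1
  ext; simp [h.mem_iff]

theorem mem_lspan {w : W} {l : List W} (h : w ∈ l) : w ∈ lspan l :=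
  Submodule.subset_span h

theorem lspan_le {l : List W} {U : Submodule ℝ W} : lspan l ≤ U ↔ ∀ w ∈ l, w ∈ U :=
  Submodule.span_le

/-- Adding multiples of `p` to the other vectors does not change the span. -/
theorem span_sup_lspan_eliminated (φ : Functional B E b) (p : Record B E b N)
    (X : List (Record B E b N)) :
    Submodule.span ℝ {p.w} ⊔ lspan ((eliminated φ p X).map Record.w) =
      Submodule.span ℝ {p.w} ⊔ lspan (X.map Record.w) := by
  have hp (U : Submodule ℝ W) : p.w ∈ Submodule.span ℝ {p.w} ⊔ U :=
    Submodule.mem_sup_left (Submodule.mem_span_singleton_self _)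
  apply le_antisymm
  · refine sup_le le_sup_left (lspan_le.2 fun w hw => ?_)
    simp only [eliminated, List.map_map, List.mem_map, Function.comp_apply, Record.axpy] at hw
    obtain ⟨x, hx, rfl⟩ := hw
    exact add_mem (Submodule.mem_sup_right (mem_lspan (List.mem_map_of_mem hx)))
      (Submodule.smul_mem _ _ (hp _))
  · refine sup_le le_sup_left (lspan_le.2 fun w hw => ?_)
    obtain ⟨x, hx, rfl⟩ := List.mem_map.1 hw
    have h : (Record.axpy ((0 - φ.f x.w) / φ.f p.w) x p).w ∈
        lspan ((eliminated φ p X).map Record.w) :=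
      mem_lspan (List.mem_map_of_mem (List.mem_map_of_mem hx))
    have := sub_mem (Submodule.mem_sup_right h)
      (Submodule.smul_mem _ ((0 - φ.f x.w) / φ.f p.w)
        (hp (lspan ((eliminated φ p X).map Record.w))))
    simpa [Record.axpy] using this

theorem mem_eliminated {φ : Functional B E b} {p y : Record B E b N} {X : List (Record B E b N)}
    (hy : y ∈ eliminated φ p X) :
    ∃ x ∈ X, y.w = x.w + ((0 - φ.f x.w) / φ.f p.w) • p.w := by
  obtain ⟨x, hx, rfl⟩ := List.mem_map.1 hy
  exact ⟨x, hx, rfl⟩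

theorem apply_eliminated {φ : Functional B E b} {p y : Record B E b N}
    {X : List (Record B E b N)} (hp : φ.f p.w ≠ 0) (hy : y ∈ eliminated φ p X) :
    φ.f y.w = 0 := by
  obtain ⟨x, -, h⟩ := mem_eliminated hy
  rw [h]
  simp only [map_add, map_smul, smul_eq_mul]
  field_simp
  ring

@[simp] theorem length_eliminated (φ : Functional B E b) (p : Record B E b N)
    (X : List (Record B E b N)) : (eliminated φ p X).length = X.length := by
  simp [eliminated]

/-! ### Procedures on records -/

variable (m : Code)

theorem runs_value (hN : 1 ≤ N) (x : Record B E b N) (φ : Functional B E b) :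
    Runs (m :: procedures) (.call Proc.value) (.ofList [x.enc, φ.enc]) (.atom (φ.f x.w))
      (300 * N) := by
  refine Exec.runs (c := .value) rfl ?_
  refine (runs_dot m x.e φ.φe).wp fun t ht => ?_
  refine (runs_dot m x.c φ.φc).wp fun s hs => ?_
  have := x.length_e
  have := x.length_c
  exact ⟨by rw [φ.spec x.w x.e x.c x.getD_e x.lsum_c], by omega⟩

theorem runs_recAxpy (hN : 1 ≤ N) (hb : b.length ≤ N) (t : ℝ) (x y : Record B E b N) :
    Runs (m :: procedures) (.call Proc.recAxpy) (.ofList [.atom t, x.enc, y.enc])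
      (Record.axpy t x y).enc (600 * N) := by
  refine Exec.runs (c := .recAxpy) rfl ?_
  refine (runs_axpy m t x.e y.e).wp fun t ht => ?_
  refine (runs_axpy m _ x.c y.c).wp fun t ht => ?_
  refine (runs_axpy m _ (b.map (B x.w)) (b.map (B y.w))).wp fun t ht => ?_
  simp only [List.length_map] at *
  have := y.length_e
  have := y.length_c
  refine ⟨by rw [laxpy_map]; rfl, by omega⟩

theorem runs_extract (hN : 1 ≤ N) (X : List (Record B E b N)) (φ : Functional B E b) :
    (Runs (m :: procedures) (.call Proc.extract) (.ofList [Record.encs X, φ.enc]) .nil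
      (500 * N * X.length + 20) ∧ ∀ x ∈ X, φ.f x.w = 0) ∨
    ∃ p X', Runs (m :: procedures) (.call Proc.extract) (.ofList [Record.encs X, φ.enc])
      (.cons p.enc (Record.encs X')) (500 * N * X.length + 20) ∧
      X.Perm (p :: X') ∧ φ.f p.w ≠ 0 := by
  induction X with
  | nil => exact .inl ⟨Exec.runs (c := .extract) rfl ⟨rfl, by omega⟩, by simp⟩
  | cons x X ih =>
    have hv := runs_value m hN x φ
    by_cases hx : φ.f x.w = 0
    · have hx' : ¬ 0 < φ.f x.w * φ.f x.w := by simp [hx]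
      rcases ih with ⟨h, h0⟩ | ⟨p, X', h, hp, h0⟩
      · refine .inl ⟨Exec.runs (c := .extract) rfl ?_, by simpa [hx] using h0⟩
        refine hv.wp fun t ht => ite_intro_neg hx' ?_
        refine h.wp fun s hs => ?_
        exact ⟨rfl, by rw [List.length_cons, mul_add]; omega⟩
      · refine .inr ⟨p, x :: X', Exec.runs (c := .extract) rfl ?_,
          (hp.cons x).trans (.swap _ _ _), h0⟩
        refine hv.wp fun t ht => ite_intro_neg hx' ?_
        refine h.wp fun s hs => ?_
        exact ⟨rfl, by rw [List.length_cons, mul_add]; omega⟩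
    · refine .inr ⟨x, X, Exec.runs (c := .extract) rfl ?_, .refl _, hx⟩
      refine hv.wp fun t ht => ite_intro_pos (mul_self_pos.2 hx) ?_
      exact ⟨rfl, by rw [List.length_cons, mul_add]; omega⟩

theorem runs_eliminate (hN : 1 ≤ N) (hb : b.length ≤ N) (X : List (Record B E b N))
    (hX : X.length ≤ N) (φ : Functional B E b) (p : Record B E b N) (hp : φ.f p.w ≠ 0) :
    Runs (m :: procedures) (.call Proc.eliminate)
      (.ofList [Record.encs X, φ.enc, p.enc, .atom (φ.f p.w)]) (Record.encs (eliminated φ p X))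
      (1100 * (N * N)) := by
  have := runs_map m (self := Proc.eliminate) rfl Record.enc
    (fun x => (Record.axpy ((0 - φ.f x.w) / φ.f p.w) x p).enc) X
    (.ofList [φ.enc, p.enc, .atom (φ.f p.w)]) (1000 * N) (fun x _ => ?_)
  · rw [Record.encs, Record.encs, eliminated, List.map_map]
    refine Runs.mono this ?_
    nlinarith
  · refine (runs_value m hN x φ).wp fun t ht => ⟨hp, ?_⟩
    refine (runs_recAxpy m hN hb ((0 - φ.f x.w) / φ.f p.w) x p).wp_of_eq (by simp [Val.ofList])
      fun t ht => ?_
    exact ⟨rfl, by omega⟩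

end records

/-! ### Elimination of the labels -/

section reduction

variable {W : Type*} [AddCommGroup W] [Module ℝ W] {B : LinearMap.BilinForm ℝ W}
  {E : W →ₗ[ℝ] ℕ → ℝ} {b : List W} {N : ℕ} (m : Code)

/-- The result consists of vectors on which the labels vanish and of at most one vector for each
label. -/
theorem runs_echelon (hN : 1 ≤ N) (hb : b.length ≤ N) (k l : ℕ) (X P : List (Record B E b N))
    (hX : X.length ≤ N) (hl : ∀ x ∈ X, ∀ j < l, E x.w j = 0) :
    ∃ K P' : List (Record B E b N),
      Runs (m :: procedures) (.call Proc.echelon)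
        (.ofList [.atom k, encL (lunit l), Record.encs X, Record.encs P])
        (.cons (Record.encs K) (Record.encs P')) (2500 * (N * N) * k + 40) ∧
      lspan (K.map Record.w) ⊔ lspan (P'.map Record.w) =
        lspan (X.map Record.w) ⊔ lspan (P.map Record.w) ∧
      K.length + P'.length = X.length + P.length ∧ P'.length ≤ P.length + k ∧
      ∀ x ∈ K, ∀ j < l + k, E x.w j = 0 := by
  induction k generalizing l X P with
  | zero =>
    refine ⟨X, P, Exec.runs (c := .echelon) rfl ?_, rfl, rfl, le_rfl, hl⟩
    exact ite_intro_neg zero_cast_not_pos ⟨rfl, by omega⟩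
  | succ k ih =>
    have hNN : N ≤ N * N := Nat.le_mul_self N
    have hNX : N * X.length ≤ N * N := Nat.mul_le_mul_left _ hX
    rcases runs_extract m hN X (.label B E b l) with ⟨h, h0⟩ | ⟨p, X', h, hp, h0⟩
    · obtain ⟨K, P', hrun, hspan, hlen, hP', hK⟩ := ih (l + 1) X P hX fun x hx j hj => by
        rcases Nat.lt_succ_iff_lt_or_eq.1 hj with hj | rfl
        · exact hl x hx j hj
        · exact h0 x hx
      refine ⟨K, P', ?_, hspan, hlen, by omega, fun x hx j hj => hK x hx j (by omega)⟩
      refine Exec.runs (c := .echelon) rfl (ite_intro_pos (succ_cast_pos k) ?_)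
      refine h.wp fun t ht => ?_
      refine hrun.wp_of_eq (by rw [sub_const_one, lunit_succ]; simp [Val.ofList]) fun s hs => ?_
      rw [mul_assoc] at ht
      exact ⟨rfl, by rw [mul_add]; omega⟩
    · set X'' := eliminated (.label B E b l) p X' with hX''
      have hX' : X'.length < X.length := by simp [hp.length_eq]
      obtain ⟨K, P', hrun, hspan, hlen, hP', hK⟩ := ih (l + 1) X'' (p :: P)
        (by simp only [X'', length_eliminated]; omega) fun x hx j hj => by
        rcases Nat.lt_succ_iff_lt_or_eq.1 hj with hj | rfl
        · obtain ⟨y, hy, h⟩ := mem_eliminated hx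
          simp [h, hl y (hp.mem_iff.2 (List.mem_cons_of_mem _ hy)) j hj,
            hl p (hp.mem_iff.2 List.mem_cons_self) j hj]
        · exact apply_eliminated h0 hx
      refine ⟨K, P', ?_, ?_, ?_, by simp only [List.length_cons] at hP'; omega,
        fun x hx j hj => hK x hx j (by omega)⟩
      · refine Exec.runs (c := .echelon) rfl (ite_intro_pos (succ_cast_pos k) ?_)
        refine h.wp fun t ht => ?_
        refine (runs_value m hN p (.label B E b l)).wp fun t' ht' => ?_
        refine (runs_eliminate m hN hb X' (by omega) (.label B E b l) p h0).wp fun t'' ht'' => ?_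
        refine hrun.wp_of_eq
          (by rw [sub_const_one, lunit_succ]; simp [Val.ofList, X'']) fun s hs => ?_
        rw [mul_assoc] at ht
        exact ⟨rfl, by rw [mul_add]; omega⟩
      · rw [hspan, lspan_perm (hp.map Record.w), List.map_cons, List.map_cons, lspan_cons,
          lspan_cons, sup_left_comm, ← sup_assoc, span_sup_lspan_eliminated, sup_assoc]
      · simp only [X'', length_eliminated, List.length_cons] at hlen
        simp only [hp.length_eq, List.length_cons]
        omega

/-! ### Diagonalization -/

/-- `Splits B E k ws us p q z`: the vectors in `us` are orthogonal to each other and to `ws`, the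
first `k` labels vanish on them, and `p`, `q`, `z` of them are positive, negative, and null. -/
structure Splits (B : LinearMap.BilinForm ℝ W) (E : W →ₗ[ℝ] ℕ → ℝ) (k : ℕ) (ws us : List W)
    (p q z : ℕ) : Prop where
  label : ∀ u ∈ us, ∀ l < k, E u l = 0
  orth : ∀ u ∈ us, ∀ w ∈ ws, B u w = 0
  pairwise : us.Pairwise fun u v => B u v = 0
  pos : (us.map fun u => SignType.sign (B u u)).count 1 = p
  neg : (us.map fun u => SignType.sign (B u u)).count (-1) = q
  zero : (us.map fun u => SignType.sign (B u u)).count 0 = z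

/-- The procedure `i` run on `v` finishes the diagonalization of the vectors in `K`, `P`, `O`: it
keeps the vectors in `Y`, and splits off the vectors in `us`, which do not occur in the data but
are added to the three counters. Each vector in `P` can bring one vector from `K` into `Y`, whence
the factor `2`. -/
def Diagonalizes (B : LinearMap.BilinForm ℝ W) (E : W →ₗ[ℝ] ℕ → ℝ) (b : List W) (N k i : ℕ)
    (v : Val) (K P O : List (Record B E b N)) (p q z T : ℕ) : Prop :=
  ∃ (Y : List (Record B E b N)) (us : List W) (p' q' z' : ℕ),
    Runs (m :: procedures) (.call i) v
      (.cons (Record.encs Y) (.cons (.atom ↑(p + p')) (.cons (.atom ↑(q + q')) (.atom ↑(z + z')))))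
      T ∧
    lspan (Y.map Record.w) ⊔ lspan us =
      lspan (K.map Record.w) ⊔ lspan (P.map Record.w) ⊔ lspan (O.map Record.w) ∧
    Y.length + us.length = K.length + P.length + O.length ∧
    Y.length ≤ 2 * P.length + O.length ∧ Splits B E k (Y.map Record.w) us p' q' z'

/-- The specification of the procedure `diagonalize` for `n` vectors in `K`. As an invariant, the
labels vanish on `K`, and `K` is orthogonal to the output `O`, so that a vector of `K` only has to
be compared with `K` and `P`. -/
def DiagonalizeSpec (B : LinearMap.BilinForm ℝ W) (E : W →ₗ[ℝ] ℕ → ℝ) (b : List W) (N k n : ℕ) :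
    Prop :=
  ∀ (K P O : List (Record B E b N)) (p q z : ℕ), K.length = n → K.length ≤ N → P.length ≤ N →
    (∀ x ∈ K, ∀ l < k, E x.w l = 0) → (∀ x ∈ K, ∀ o ∈ O, B x.w o.w = 0) →
    Diagonalizes m B E b N k Proc.diagonalize
      (.ofList [Record.encs K, Record.encs P, Record.encs O, .atom p, .atom q, .atom z]) K P O p q z
      (10000 * (N * N) * n + 40 * (O.length + 2 * P.length) + 100)

/-- A vector orthogonal to the rest can be put in front of the vectors that are split off. -/
theorem Splits.cons {k : ℕ} {h : W} {ws us : List W} {p q z : ℕ} (hs : Splits B E k ws us p q z)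
    (hE : ∀ l < k, E h l = 0) (ho : lspan ws ⊔ lspan us ≤ LinearMap.ker (B h)) :
    Splits B E k ws (h :: us) (p + if 0 < B h h then 1 else 0) (q + if B h h < 0 then 1 else 0)
      (z + if B h h = 0 then 1 else 0) where
  label u hu := by
    rcases List.mem_cons.1 hu with rfl | hu
    exacts [hE, hs.label u hu]
  orth u hu w hw := by
    rcases List.mem_cons.1 hu with rfl | hu
    exacts [ho (Submodule.mem_sup_left (mem_lspan hw)), hs.orth u hu w hw]
  pairwise := List.pairwise_cons.2
    ⟨fun u hu => ho (Submodule.mem_sup_right (mem_lspan hu)), hs.pairwise⟩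
  pos := by simp [List.count_cons, hs.pos, sign_eq_one_iff]
  neg := by simp [List.count_cons, hs.neg, sign_eq_neg_one_iff]
  zero := by simp [List.count_cons, hs.zero, sign_eq_zero_iff]

/-- An anisotropic vector `h` is split off: after its multiples have been subtracted from `K` and
`P`, it is orthogonal to everything else. -/
theorem diagonalizes_pivot (hN : 1 ≤ N) (hb : b.length ≤ N) {k n : ℕ}
    (ih : DiagonalizeSpec m B E b N k n) (h : Record B E b N) (K P O : List (Record B E b N))
    (p q z : ℕ) (hn : K.length = n) (hK : K.length ≤ N) (hP : P.length ≤ N)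
    (hE : ∀ x ∈ h :: K, ∀ l < k, E x.w l = 0) (hO : ∀ x ∈ h :: K, ∀ o ∈ O, B x.w o.w = 0)
    (hh : B h.w h.w ≠ 0) :
    Diagonalizes m B E b N k Proc.pivot
      (.ofList [h.enc, Record.encs K, Record.encs P, Record.encs O, .atom p, .atom q, .atom z])
      (h :: K) P O p q z
      (10000 * (N * N) * n + 40 * (O.length + 2 * P.length) + 100 + 3500 * (N * N)) := by
  obtain ⟨Y, us, p', q', z', hrun, hspan, hlen, hY, hs⟩ := ih (eliminated (.gram h) h K)
    (eliminated (.gram h) h P) O (p + if 0 < B h.w h.w then 1 else 0)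
    (q + if B h.w h.w < 0 then 1 else 0) z (by simpa using hn) (by simpa using hK)
    (by simpa using hP)
    (fun x hx l hl => by
      obtain ⟨y, hy, h'⟩ := mem_eliminated hx
      simp [h', hE y (List.mem_cons_of_mem _ hy) l hl, hE h List.mem_cons_self l hl])
    (fun x hx o ho => by
      obtain ⟨y, hy, h'⟩ := mem_eliminated hx
      simp [h', hO y (List.mem_cons_of_mem _ hy) o ho, hO h List.mem_cons_self o ho])
  simp only [length_eliminated] at hlen hY hrun
  refine ⟨Y, h.w :: us, _, _, _, ?_, ?_, ?_, hY,
    hs.cons (hE h List.mem_cons_self) ?_⟩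
  · have hNN : N ≤ N * N := Nat.le_mul_self N
    refine Exec.runs (c := .pivot) rfl ?_
    refine (runs_value m hN h (.gram h)).wp fun t₁ h₁ => ?_
    refine (runs_eliminate m hN hb K hK (.gram h) h hh).wp fun t₂ h₂ => ?_
    refine (runs_eliminate m hN hb P hP (.gram h) h hh).wp fun t₃ h₃ => ?_
    rcases lt_or_gt_of_ne hh with h0 | h0
    · refine ite_intro_neg (not_lt_of_gt h0) (ite_intro_neg (not_lt_of_gt h0) ?_)
      refine hrun.wp_of_eq (by simp [Val.ofList, h0, not_lt_of_gt h0]) fun t₄ h₄ => ?_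
      exact ⟨by simp [hh]; constructor <;> ring, by omega⟩
    · refine ite_intro_pos h0 (ite_intro_pos h0 ?_)
      refine hrun.wp_of_eq (by simp [Val.ofList, h0, not_lt_of_gt h0]) fun t₄ h₄ => ?_
      exact ⟨by simp [hh]; constructor <;> ring, by omega⟩
  · rw [List.map_cons, lspan_cons, lspan_cons, sup_left_comm, hspan, ← sup_assoc, ← sup_assoc,
      span_sup_lspan_eliminated, sup_right_comm (Submodule.span ℝ {h.w}),
      span_sup_lspan_eliminated, sup_right_comm (Submodule.span ℝ {h.w})]
  · simp only [List.length_cons]; omega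
  · rw [hspan]
    refine sup_le (sup_le ?_ ?_) ?_ <;> refine lspan_le.2 fun w hw => ?_ <;>
      obtain ⟨x, hx, rfl⟩ := List.mem_map.1 hw
    · exact apply_eliminated (φ := .gram h) hh hx
    · exact apply_eliminated (φ := .gram h) hh hx
    · exact hO h List.mem_cons_self x hx

/-- The specification depends only on the span of the vectors and on their numbers. -/
theorem Diagonalizes.congr {k i : ℕ} {v : Val} {K K' P P' O O' : List (Record B E b N)}
    {p q z T : ℕ} (h : Diagonalizes m B E b N k i v K P O p q z T)
    (hspan : lspan (K.map Record.w) ⊔ lspan (P.map Record.w) ⊔ lspan (O.map Record.w) =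
      lspan (K'.map Record.w) ⊔ lspan (P'.map Record.w) ⊔ lspan (O'.map Record.w))
    (hlen : K.length + P.length + O.length = K'.length + P'.length + O'.length)
    (hlen' : 2 * P.length + O.length ≤ 2 * P'.length + O'.length)
    {i' : ℕ} {v' : Val} {T' : ℕ}
    (hrun : ∀ w, Runs (m :: procedures) (.call i) v w T →
      Runs (m :: procedures) (.call i') v' w T') :
    Diagonalizes m B E b N k i' v' K' P' O' p q z T' := by
  obtain ⟨Y, us, p', q', z', h₁, h₂, h₃, h₄, h₅⟩ := h
  exact ⟨Y, us, p', q', z', hrun _ h₁, h₂.trans hspan, h₃.trans hlen, h₄.trans hlen', h₅⟩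

/-- If `h` is isotropic and `B h x ≠ 0`, then `B (h ± x) (h ± x) = B x x ± 2 B h x`, so that `h + x`
or `h - x` is anisotropic. -/
theorem diagonalizes_shiftPivot (hN : 1 ≤ N) (hb : b.length ≤ N) (hB : ∀ u v, B u v = B v u)
    {k n : ℕ} (ih : DiagonalizeSpec m B E b N k n) (h x : Record B E b N)
    (K P O : List (Record B E b N))
    (p q z : ℕ) (hn : K.length = n) (hK : K.length ≤ N) (hP : P.length ≤ N)
    (hE : ∀ x ∈ h :: K, ∀ l < k, E x.w l = 0) (hO : ∀ x ∈ h :: K, ∀ o ∈ O, B x.w o.w = 0)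
    (hx : x ∈ K) (hh : B h.w h.w = 0) (hhx : B h.w x.w ≠ 0) :
    Diagonalizes m B E b N k Proc.shiftPivot
      (.ofList [h.enc, x.enc, Record.encs K, Record.encs P, Record.encs O, .atom p, .atom q,
        .atom z])
      (h :: K) P O p q z
      (10000 * (N * N) * n + 40 * (O.length + 2 * P.length) + 100 + 6000 * (N * N)) := by
  have hNN : N ≤ N * N := Nat.le_mul_self N
  have key (t : ℝ) (ht : B (Record.axpy t h x).w (Record.axpy t h x).w ≠ 0)
      (hrun : ∀ w T, Runs (m :: procedures) (.call Proc.pivot)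
        (.ofList [(Record.axpy t h x).enc, Record.encs K, Record.encs P, Record.encs O, .atom p,
          .atom q, .atom z]) w T → Runs (m :: procedures) (.call Proc.shiftPivot)
        (.ofList [h.enc, x.enc, Record.encs K, Record.encs P, Record.encs O, .atom p, .atom q,
          .atom z]) w (T + 2500 * (N * N))) :
      Diagonalizes m B E b N k Proc.shiftPivot
        (.ofList [h.enc, x.enc, Record.encs K, Record.encs P, Record.encs O, .atom p, .atom q,
          .atom z])
        (h :: K) P O p q z
        (10000 * (N * N) * n + 40 * (O.length + 2 * P.length) + 100 + 6000 * (N * N)) := by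
    refine (diagonalizes_pivot m hN hb ih (Record.axpy t h x) K P O p q z hn hK hP ?_ ?_ ht).congr
      m ?_ (by simp) le_rfl (fun w hw => (hrun w _ hw).mono (by omega))
    · intro y hy l hl
      rcases List.mem_cons.1 hy with rfl | hy
      · simp [Record.axpy, hE h List.mem_cons_self l hl, hE x (List.mem_cons_of_mem _ hx) l hl]
      · exact hE y (List.mem_cons_of_mem _ hy) l hl
    · intro y hy o ho
      rcases List.mem_cons.1 hy with rfl | hy
      · simp [Record.axpy, hO h List.mem_cons_self o ho, hO x (List.mem_cons_of_mem _ hx) o ho]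
      · exact hO y (List.mem_cons_of_mem _ hy) o ho
    · congr 2
      have hxK : x.w ∈ lspan (K.map Record.w) := mem_lspan (List.mem_map_of_mem hx)
      rw [List.map_cons, List.map_cons, lspan_cons, lspan_cons]
      apply le_antisymm <;> refine sup_le ?_ le_sup_right <;>
        rw [Submodule.span_le, Set.singleton_subset_iff, SetLike.mem_coe]
      · exact add_mem (Submodule.mem_sup_left (Submodule.mem_span_singleton_self _))
          (Submodule.mem_sup_right (Submodule.smul_mem _ _ hxK))
      · have := sub_mem (Submodule.mem_sup_left (T := lspan (K.map Record.w))
          (Submodule.mem_span_singleton_self (R := ℝ) (Record.axpy t h x).w))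
          (Submodule.mem_sup_right (Submodule.smul_mem _ t hxK))
        simpa [Record.axpy] using this
  have hv := runs_value m hN (Record.axpy 1 h x) (.gram (Record.axpy 1 h x))
  have hx₁ := runs_recAxpy m hN hb 1 h x
  have hx₂ := runs_recAxpy m hN hb (-1) h x
  by_cases h1 : B (Record.axpy 1 h x).w (Record.axpy 1 h x).w = 0
  · refine key (-1) ?_ fun w T hw => ?_
    · simp only [Record.axpy, map_add, map_smul, LinearMap.add_apply, LinearMap.smul_apply,
        smul_eq_mul, hh, hB x.w h.w] at h1 ⊢
      intro h2
      apply hhx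
      linarith
    · refine Exec.runs (c := .shiftPivot) rfl ?_
      refine hx₁.wp_of_eq (by simp [Val.ofList]) fun t₁ h₁ => ?_
      refine hv.wp fun t₂ h₂ => ?_
      refine ite_intro_neg (by simp [Functional.gram, h1]) ?_
      refine hx₂.wp_of_eq (by simp [Val.ofList]) fun t₃ h₃ => ?_
      refine hw.wp fun t₄ h₄ => ?_
      exact ⟨rfl, by omega⟩
  · refine key 1 h1 fun w T hw => ?_
    refine Exec.runs (c := .shiftPivot) rfl ?_
    refine hx₁.wp_of_eq (by simp [Val.ofList]) fun t₁ h₁ => ?_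
    refine hv.wp fun t₂ h₂ => ?_
    refine ite_intro_pos (mul_self_pos.2 h1) ?_
    refine hw.wp fun t₄ h₄ => ?_
    exact ⟨rfl, by omega⟩

/-- If `h` is orthogonal to `K` and to itself, then the other vectors in `K` can be made orthogonal
to `x` by subtracting multiples of `h`, and they stay orthogonal to `h`. -/
theorem diagonalizes_setPair (hN : 1 ≤ N) (hb : b.length ≤ N) (hB : ∀ u v, B u v = B v u)
    {k n : ℕ} (ih : DiagonalizeSpec m B E b N k n) (h x : Record B E b N)
    (K P O : List (Record B E b N))
    (p q z : ℕ) (hn : K.length = n) (hK : K.length ≤ N) (hP : P.length ≤ N)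
    (hE : ∀ x ∈ h :: K, ∀ l < k, E x.w l = 0) (hO : ∀ x ∈ h :: K, ∀ o ∈ O, B x.w o.w = 0)
    (hh : B h.w h.w = 0) (hhK : ∀ y ∈ K, B h.w y.w = 0) (hhx : B h.w x.w ≠ 0) :
    Diagonalizes m B E b N k Proc.setPair
      (.ofList [h.enc, x.enc, Record.encs K, Record.encs P, Record.encs O, .atom p, .atom q,
        .atom z])
      (h :: K) (x :: P) O p q z
      (10000 * (N * N) * n + 40 * (O.length + 2 * (P.length + 1)) + 100 + 3500 * (N * N)) := by
  have hxh : (Functional.gram x).f h.w ≠ 0 := by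
    rw [Functional.gram, hB]; exact hhx
  refine (ih (eliminated (.gram x) h K) P (h :: x :: O) p q z (by simpa using hn)
    (by simpa using hK) hP ?_ ?_).congr m ?_ ?_ ?_ fun w hw => ?_
  · intro y hy l hl
    obtain ⟨y', hy', h'⟩ := mem_eliminated hy
    simp [h', hE y' (List.mem_cons_of_mem _ hy') l hl, hE h List.mem_cons_self l hl]
  · intro y hy o ho
    rcases List.mem_cons.1 ho with rfl | ho
    · obtain ⟨y', hy', h'⟩ := mem_eliminated hy
      simp [h', hB y'.w, hhK y' hy', hh]
    rcases List.mem_cons.1 ho with rfl | ho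
    · rw [hB]
      exact apply_eliminated hxh hy
    · obtain ⟨y', hy', h'⟩ := mem_eliminated hy
      simp [h', hO y' (List.mem_cons_of_mem _ hy') o ho, hO h List.mem_cons_self o ho]
  · have := span_sup_lspan_eliminated (.gram x) h K
    simp only [List.map_cons, lspan_cons] at this ⊢
    calc _ = (Submodule.span ℝ {h.w} ⊔ lspan ((eliminated (.gram x) h K).map Record.w)) ⊔
          (Submodule.span ℝ {x.w} ⊔ lspan (P.map Record.w)) ⊔ lspan (O.map Record.w) := by ac_rfl
      _ = _ := by rw [this]
  · simp; omega
  · simp; omega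
  · have hNN : N ≤ N * N := Nat.le_mul_self N
    refine Exec.runs (c := .setPair) rfl ?_
    refine (runs_value m hN h (.gram x)).wp fun t₁ h₁ => ?_
    refine (runs_eliminate m hN hb K hK (.gram x) h hxh).wp fun t₂ h₂ => ?_
    refine hw.wp fun t₃ h₃ => ?_
    simp only [List.length_cons] at h₃
    exact ⟨rfl, by omega⟩

/-- The first vector `h` of `K` is a pivot if it is anisotropic. Otherwise the cases are that it is
not orthogonal to `K`, that it is orthogonal to `K` but not to `P`, and that it is orthogonal to
everything and hence a null vector. -/
theorem diagonalizeSpec (hN : 1 ≤ N) (hb : b.length ≤ N) (hB : ∀ u v, B u v = B v u)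
    (k n : ℕ) : DiagonalizeSpec m B E b N k n := by
  have hNN : N ≤ N * N := Nat.le_mul_self N
  induction n with
  | zero =>
    intro K P O p q z hn _ _ _ _
    obtain rfl := List.length_eq_zero_iff.1 hn
    refine ⟨O ++ P, [], 0, 0, 0, ?_, ?_, ?_, ?_, ?_⟩
    · refine Exec.runs (c := .diagonalize) rfl ?_
      refine (runs_append m (O.map Record.enc) (P.map Record.enc)).wp fun t ht => ?_
      rw [List.length_map] at ht
      exact ⟨by simp [Record.encs], by omega⟩
    · simp [lspan_append, sup_comm]
    · simp; omega
    · simp; omega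
    · constructor <;> simp
  | succ n ih =>
    intro K P O p q z hn hK hP hE hO
    obtain ⟨h, K, rfl⟩ := List.exists_cons_of_length_eq_add_one hn
    simp only [List.length_cons, Nat.add_right_cancel_iff] at hn hK
    have hv := runs_value m hN h (.gram h)
    have hKN : N * K.length ≤ N * N := Nat.mul_le_mul_left _ (by omega)
    have hPN : N * P.length ≤ N * N := Nat.mul_le_mul_left _ hP
    by_cases hh : B h.w h.w = 0
    · rcases runs_extract m hN K (.gram h) with ⟨hx, hx0⟩ | ⟨x, K', hx, hxK, hx0⟩
      · rcases runs_extract m hN P (.gram h) with ⟨hy, hy0⟩ | ⟨y, P', hy, hyP, hy0⟩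
        · obtain ⟨Y, us, p', q', z', hrun, hspan, hlen, hY, hs⟩ := ih K P O p q (z + 1) hn
            (by omega) hP (fun x hx => hE x (List.mem_cons_of_mem _ hx))
            (fun x hx => hO x (List.mem_cons_of_mem _ hx))
          refine ⟨Y, h.w :: us, _, _, _, ?_, ?_, ?_, hY, hs.cons (hE h List.mem_cons_self) ?_⟩
          · refine Exec.runs (c := .diagonalize) rfl ?_
            refine hv.wp fun t₁ h₁ => ?_
            refine ite_intro_neg (by simp [Functional.gram, hh]) ?_
            refine hx.wp fun t₂ h₂ => ?_
            refine hy.wp fun t₃ h₃ => ?_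
            refine hrun.wp_of_eq (by simp [Val.ofList, Record.encs]) fun t₄ h₄ => ?_
            rw [mul_assoc] at h₂ h₃
            exact ⟨by simp [hh]; ring, by rw [mul_add]; omega⟩
          · rw [List.map_cons, lspan_cons, lspan_cons, sup_left_comm, hspan]
            ac_rfl
          · simp only [List.length_cons]; omega
          · rw [hspan]
            refine sup_le (sup_le ?_ ?_) ?_ <;> refine lspan_le.2 fun w hw => ?_ <;>
              obtain ⟨x, hx, rfl⟩ := List.mem_map.1 hw
            · exact hx0 x hx
            · exact hy0 x hx
            · exact hO h List.mem_cons_self x hx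
        · have hlen : P.length = P'.length + 1 := by simp [hyP.length_eq]
          refine (diagonalizes_setPair m hN hb hB ih h y K P' O p q z hn (by omega) (by omega)
            hE hO hh hx0 hy0).congr m ?_ ?_ ?_ fun w hw => ?_
          · rw [lspan_perm (hyP.map Record.w)]
          · simp [hlen]
          · simp [hlen]
          · refine Exec.runs (c := .diagonalize) rfl ?_
            refine hv.wp fun t₁ h₁ => ?_
            refine ite_intro_neg (by simp [Functional.gram, hh]) ?_
            refine hx.wp fun t₂ h₂ => ?_
            refine hy.wp fun t₃ h₃ => ?_
            refine hw.wp fun t₄ h₄ => ?_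
            rw [mul_assoc] at h₂ h₃
            exact ⟨rfl, by rw [mul_add]; omega⟩
      · refine (diagonalizes_shiftPivot m hN hb hB ih h x K P O p q z hn (by omega) hP
          hE hO (hxK.mem_iff.2 List.mem_cons_self) hh hx0).congr m rfl rfl le_rfl fun w hw => ?_
        refine Exec.runs (c := .diagonalize) rfl ?_
        refine hv.wp fun t₁ h₁ => ?_
        refine ite_intro_neg (by simp [Functional.gram, hh]) ?_
        refine hx.wp fun t₂ h₂ => ?_
        refine hw.wp fun t₄ h₄ => ?_
        rw [mul_assoc] at h₂
        exact ⟨rfl, by rw [mul_add]; omega⟩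
    · refine (diagonalizes_pivot m hN hb ih h K P O p q z hn (by omega) hP
        hE hO hh).congr m rfl rfl le_rfl fun w hw => ?_
      refine Exec.runs (c := .diagonalize) rfl ?_
      refine hv.wp fun t₁ h₁ => ?_
      refine ite_intro_pos (mul_self_pos.2 hh) ?_
      refine hw.wp fun t₄ h₄ => ?_
      exact ⟨rfl, by rw [mul_add]; omega⟩

end reduction

/-! ### Reduction of a state -/

section state

/-- A vector `w` as it is stored in a state: by its labels `E w`. Its products with all members of
the state are determined by `w`, so that they are not a field of the structure. -/
structure Member {W : Type*} [AddCommGroup W] [Module ℝ W] (E : W →ₗ[ℝ] ℕ → ℝ) (N : ℕ) where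
  w : W
  e : List ℝ
  getD_e : ∀ l, e.getD l 0 = E w l
  length_e : e.length ≤ N

variable {W : Type*} [AddCommGroup W] [Module ℝ W] {B : LinearMap.BilinForm ℝ W}
  {E : W →ₗ[ℝ] ℕ → ℝ} {N : ℕ} (m : Code)

/-- The encoding of the members of a state: labels and rows of the Gram matrix. -/
def Member.encs (B : LinearMap.BilinForm ℝ W) (X : List (Member E N)) : Val :=
  .ofList (X.map fun x => .cons (encL x.e) (encL (X.map fun y => B x.w y.w)))

/-- The members of a state are taken as the list with respect to which records have coordinates;
they need not be linearly independent. -/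
theorem runs_attach (X : List (Member E N)) (hX : X.length ≤ N) :
    ∃ R : List (Record B E (X.map Member.w) N), R.map Record.w = X.map Member.w ∧
      Runs (m :: procedures) (.call Proc.attach) (.ofList [Member.encs B X, encL [1]])
        (Record.encs R) (60 * X.length + 20) := by
  have key (l pre : List (Member E N)) (h : X = pre ++ l) :
      ∃ R : List (Record B E (X.map Member.w) N), R.map Record.w = l.map Member.w ∧
        Runs (m :: procedures) (.call Proc.attach)
          (.ofList [.ofList (l.map fun x => .cons (encL x.e) (encL (X.map fun y => B x.w y.w))),
            encL (lunit pre.length)])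
          (Record.encs R) (60 * l.length + 20) := by
    induction l generalizing pre with
    | nil => exact ⟨[], rfl, Exec.runs (c := .attach) rfl ⟨rfl, by omega⟩⟩
    | cons x l ih =>
      obtain ⟨R, hR, hrun⟩ := ih (pre ++ [x]) (by simp [h])
      refine ⟨⟨x.w, x.e, lunit pre.length, x.getD_e, ?_, x.length_e, ?_⟩ :: R, by simp [hR],
        Exec.runs (c := .attach) rfl ?_⟩
      · have := lsum_lunit (pre.map Member.w) x.w (l.map Member.w)
        rw [List.length_map] at this
        rw [h, List.map_append, List.map_cons, this]
      · have := congrArg List.length h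
        simp only [List.length_append, List.length_cons] at this
        rw [length_lunit]
        omega
      · refine hrun.wp_of_eq (by simp [Val.ofList, lunit_succ]) fun t ht => ?_
        exact ⟨by simp [Record.enc, Function.comp_def], by rw [List.length_cons]; omega⟩
  exact key X [] rfl

theorem runs_gram {b : List W} (hN : 1 ≤ N)
    (Y : List (Record B E b N)) (hY : Y.length ≤ N) :
    Runs (m :: procedures) (.call Proc.gram) (.ofList [Record.encs Y, Record.encs Y])
      (Member.encs B (Y.map fun y => (⟨y.w, y.e, y.getD_e, y.length_e⟩ : Member E N)))
      (1000 * (N * N * N)) := by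
  have hNN : N ≤ N * N := Nat.le_mul_self N
  have hNNN : N * N ≤ N * N * N := Nat.le_mul_of_pos_right _ hN
  have row (y : Record B E b N) : Runs (m :: procedures) (.call Proc.gramRow)
      (.ofList [Record.encs Y, encL (b.map (B y.w))]) (encL (Y.map fun z => B y.w z.w))
      (200 * (N * N)) := by
    have := runs_map m (self := Proc.gramRow) rfl Record.enc (fun z => .atom (B y.w z.w)) Y
      (.ofList [encL (b.map (B y.w))]) (50 * N + 80) fun z _ => ?_
    · have h : encL (Y.map fun z => B y.w z.w) = .ofList (Y.map fun z => .atom (B y.w z.w)) := by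
        rw [encL, List.map_map]; rfl
      rw [h]
      refine Runs.mono this ?_
      have := Nat.mul_le_mul_left (50 * N + 80 + 30) hY
      have : (50 * N + 80 + 30) * N = 50 * (N * N) + 110 * N := by ring
      omega
    · refine (runs_dot m z.c (b.map (B y.w))).wp fun t ht => ?_
      have := z.length_c
      exact ⟨by rw [ldot_map, z.lsum_c], by omega⟩
  have := runs_map m (self := Proc.gram) rfl Record.enc
    (fun y => .cons (encL y.e) (encL (Y.map fun z => B y.w z.w))) Y (.ofList [Record.encs Y])
    (300 * (N * N)) fun y _ => ?_
  · have h : Member.encs B (Y.map fun y => (⟨y.w, y.e, y.getD_e, y.length_e⟩ : Member E N)) =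
        .ofList (Y.map fun y => .cons (encL y.e) (encL (Y.map fun z => B y.w z.w))) := by
      simp [Member.encs, Function.comp_def]
    rw [h]
    refine Runs.mono this ?_
    have := Nat.mul_le_mul_left (300 * (N * N) + 30) hY
    have : (300 * (N * N) + 30) * N = 300 * (N * N * N) + 30 * N := by ring
    omega
  · refine (row y).wp fun t ht => ?_
    exact ⟨rfl, by omega⟩

/-- A reduction with respect to `k` labels leaves at most `2 k` vectors. -/
theorem runs_reduce (hN : 1 ≤ N) (hB : ∀ u v, B u v = B v u) (X : List (Member E N))
    (hX : X.length ≤ N) (k : ℕ) (hk : 2 * k ≤ N) (p q z : ℕ) :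
    ∃ (Y : List (Member E N)) (us : List W) (p' q' z' : ℕ),
      Runs (m :: procedures) (.call Proc.reduce)
        (.ofList [.atom k, Member.encs B X, .atom p, .atom q, .atom z])
        (.cons (Member.encs B Y)
          (.cons (.atom ↑(p + p')) (.cons (.atom ↑(q + q')) (.atom ↑(z + z')))))
        (20000 * (N * N * N)) ∧
      lspan (Y.map Member.w) ⊔ lspan us = lspan (X.map Member.w) ∧
      Y.length + us.length = X.length ∧ Y.length ≤ 2 * k ∧
      Splits B E k (Y.map Member.w) us p' q' z' := by
  have hNN : N ≤ N * N := Nat.le_mul_self N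
  have hNNN : N * N ≤ N * N * N := Nat.le_mul_of_pos_right _ hN
  have hb : (X.map Member.w).length ≤ N := by simpa using hX
  obtain ⟨R, hR, hattach⟩ := runs_attach (B := B) m X hX
  have hRl : R.length = X.length := by simpa using congrArg List.length hR
  obtain ⟨K, P, hechelon, hspan, hlen, hP, hK⟩ :=
    runs_echelon m hN hb k 0 R [] (by omega) (by simp)
  simp only [List.length_nil, add_zero, zero_add] at hlen hP hK
  obtain ⟨Y, us, p', q', z', hdiag, hspan', hlen', hY, hs⟩ :=
    diagonalizeSpec m hN hb hB k K.length K P [] p q z rfl (by omega) (by omega) hK (by simp)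
  simp only [List.length_nil, add_zero, zero_add] at hlen' hY hdiag
  have hgram := runs_gram m hN Y (by omega)
  refine ⟨Y.map fun y => ⟨y.w, y.e, y.getD_e, y.length_e⟩, us, p', q', z',
    Exec.runs (c := .reduce) rfl ?_, ?_, ?_, ?_, ?_⟩
  · refine hattach.wp_of_eq (by simp [Val.ofList]) fun t₁ h₁ => ?_
    refine hechelon.wp_of_eq (by simp [Val.ofList]) fun t₂ h₂ => ?_
    refine hdiag.wp fun t₃ h₃ => ?_
    refine hgram.wp fun t₄ h₄ => ?_
    have hk' : 2500 * (N * N) * k ≤ 2500 * (N * N * N) := by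
      rw [mul_assoc]
      exact Nat.mul_le_mul_left _ (Nat.mul_le_mul_left _ (by omega))
    have hK' : 10000 * (N * N) * K.length ≤ 10000 * (N * N * N) := by
      rw [mul_assoc]
      exact Nat.mul_le_mul_left _ (Nat.mul_le_mul_left _ (by omega))
    exact ⟨rfl, by omega⟩
  · simpa [Function.comp_def, hspan, hR] using hspan'
  · simp; omega
  · simpa using hY.trans (by omega)
  · simpa [Function.comp_def] using hs

/-- The datum `v` describes the form `B` on the space `W` with the labels `E`, up to vectors that
are split off: at most `M` vectors are stored, and the others are only counted. -/
def IsState (B : LinearMap.BilinForm ℝ W) (E : W →ₗ[ℝ] ℕ → ℝ) (N k M : ℕ) (v : Val) : Prop :=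
  ∃ (X : List (Member E N)) (us : List W) (p q z : ℕ),
    v = .cons (Member.encs B X) (.cons (.atom p) (.cons (.atom q) (.atom z))) ∧
    lspan (X.map Member.w) ⊔ lspan us = ⊤ ∧ X.length + us.length = Module.finrank ℝ W ∧
    X.length ≤ M ∧ Splits B E k (X.map Member.w) us p q z

/-- Vectors that are split off in two stages are orthogonal to each other, because those of the
second stage are in the span of what was left after the first. -/
theorem Splits.append {k k' : ℕ} {ws ws' us us' : List W} {p q z p' q' z' : ℕ}
    (hs : Splits B E k ws us p q z) (hs' : Splits B E k' ws' us' p' q' z') (hk : k' ≤ k)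
    (hspan : lspan ws' ⊔ lspan us' = lspan ws) :
    Splits B E k' ws' (us ++ us') (p + p') (q + q') (z + z') := by
  have ho (u : W) (hu : u ∈ us) : lspan ws' ⊔ lspan us' ≤ LinearMap.ker (B u) := by
    rw [hspan, lspan_le]
    exact fun w hw => hs.orth u hu w hw
  constructor
  · intro u hu l hl
    rcases List.mem_append.1 hu with hu | hu
    exacts [hs.label u hu l (by omega), hs'.label u hu l hl]
  · intro u hu w hw
    rcases List.mem_append.1 hu with hu | hu
    exacts [ho u hu (Submodule.mem_sup_left (mem_lspan hw)), hs'.orth u hu w hw]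
  · refine List.pairwise_append.2 ⟨hs.pairwise, hs'.pairwise, fun u hu v hv => ?_⟩
    exact ho u hu (Submodule.mem_sup_right (mem_lspan hv))
  · simp [hs.pos, hs'.pos]
  · simp [hs.neg, hs'.neg]
  · simp [hs.zero, hs'.zero]

theorem IsState.exists_reduce {k k' M : ℕ} {x p q z : Val} (hN : 1 ≤ N)
    (hB : ∀ u v, B u v = B v u)
    (h : IsState B E N k M (.cons x (.cons p (.cons q z)))) (hM : M ≤ N) (hk : k' ≤ k)
    (hkN : 2 * k' ≤ N) :
    ∃ v, Runs (m :: procedures) (.call Proc.reduce) (.ofList [.atom k', x, p, q, z]) v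
      (20000 * (N * N * N)) ∧ IsState B E N k' (2 * k') v := by
  obtain ⟨X, us, p, q, z, hv, hspan, hlen, hX, hs⟩ := h
  simp only [Val.cons.injEq] at hv
  obtain ⟨rfl, rfl, rfl, rfl⟩ := hv
  obtain ⟨Y, us', p', q', z', hrun, hspan', hlen', hY, hs'⟩ :=
    runs_reduce m hN hB X (by omega) k' hkN p q z
  refine ⟨_, hrun, Y, us ++ us', _, _, _, rfl, ?_, ?_, hY, hs.append hs' hk hspan'⟩
  · rw [lspan_append, sup_comm (lspan us), ← sup_assoc, hspan', hspan]
  · rw [List.length_append]; omega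

end state

/-! ### Joins of states -/

section join

variable {W₁ W₂ W : Type*} [AddCommGroup W₁] [Module ℝ W₁] [AddCommGroup W₂] [Module ℝ W₂]
  [AddCommGroup W] [Module ℝ W] {k N : ℕ}
  {B₁ : LinearMap.BilinForm ℝ W₁} {E₁ : W₁ →ₗ[ℝ] ℕ → ℝ}
  {B₂ : LinearMap.BilinForm ℝ W₂} {E₂ : W₂ →ₗ[ℝ] ℕ → ℝ}
  {B : LinearMap.BilinForm ℝ W} {E : W →ₗ[ℝ] ℕ → ℝ}
  {i₁ : W₁ →ₗ[ℝ] W} {i₂ : W₂ →ₗ[ℝ] W}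
  {S : Finset (Fin k × Fin k)} {L R : Fin k → Fin k} (m : Code)

/-- The effect of the operation `⊕_{S,L,R}` on forms: `W` is the direct sum of `W₁` and `W₂`, the
form `B` extends `B₁` and `B₂`, the products between the summands depend on the labels only and are
given by `S`, and the labels are replaced through `L` and `R`. -/
structure IsFormJoin (B₁ : LinearMap.BilinForm ℝ W₁) (E₁ : W₁ →ₗ[ℝ] ℕ → ℝ)
    (B₂ : LinearMap.BilinForm ℝ W₂) (E₂ : W₂ →ₗ[ℝ] ℕ → ℝ)
    (B : LinearMap.BilinForm ℝ W) (E : W →ₗ[ℝ] ℕ → ℝ) (i₁ : W₁ →ₗ[ℝ] W) (i₂ : W₂ →ₗ[ℝ] W)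
    (S : Finset (Fin k × Fin k)) (L R : Fin k → Fin k) : Prop where
  symm : ∀ u v, B u v = B v u
  left : ∀ x y, B (i₁ x) (i₁ y) = B₁ x y
  right : ∀ x y, B (i₂ x) (i₂ y) = B₂ x y
  cross : ∀ x y, B (i₁ x) (i₂ y) =
    ∑ a : Fin k, ∑ b : Fin k, E₁ x a * E₂ y b * if (a, b) ∈ S then 1 else 0
  label_left : ∀ x l, E (i₁ x) l = ∑ a : Fin k, E₁ x a * if l = L a then 1 else 0
  label_right : ∀ x l, E (i₂ x) l = ∑ a : Fin k, E₂ x a * if l = R a then 1 else 0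
  range : LinearMap.range i₁ ⊔ LinearMap.range i₂ = ⊤
  finrank : Module.finrank ℝ W₁ + Module.finrank ℝ W₂ = Module.finrank ℝ W

/-- The rows of the zero-one matrix of a relation. -/
def relRow (S : Finset (Fin k × Fin k)) (a : Fin k) : List ℝ :=
  List.ofFn fun b => if (a, b) ∈ S then 1 else 0

theorem encodeRel_eq (S : Finset (Fin k × Fin k)) :
    encodeRel S = .ofList ((List.ofFn (relRow S)).map encL) := by
  rw [encodeRel, List.map_ofFn]
  congr 2
  funext a
  rw [Function.comp_apply, relRow, encL, List.map_ofFn]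
  congr 2
  funext b
  simp only [Function.comp_apply]
  split_ifs <;> rfl

theorem runs_mapMatrix (L : Fin k → Fin k) :
    Runs (m :: procedures) (.call Proc.mapMatrix) (.ofList [encodeMap L])
      (.ofList ((List.ofFn fun a => lunit (L a)).map encL)) ((30 * k + 80) * k + 20) := by
  have := runs_map m (self := Proc.mapMatrix) rfl (fun a : Fin k => encodeLabel (L a))
    (fun a => encL (lunit (L a))) (List.ofFn id) .nil (30 * k + 50) fun a _ => ?_
  · simpa [encodeMap, List.map_ofFn, Function.comp_def, Val.ofList] using this
  · refine (runs_unit m (L a)).wp fun t ht => ?_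
    have := (L a).2
    exact ⟨rfl, by omega⟩

theorem runs_labelDots (hN : 1 ≤ N) (X : List (Member E N)) (hX : X.length ≤ N) (v : List ℝ) :
    Runs (m :: procedures) (.call Proc.labelDots) (.ofList [Member.encs B X, encL v])
      (encL (X.map fun x => ldot x.e v)) (200 * (N * N)) := by
  have hNN : N ≤ N * N := Nat.le_mul_self N
  have := runs_map m (self := Proc.labelDots) rfl
    (fun x : Member E N => .cons (encL x.e) (encL (X.map fun y => B x.w y.w)))
    (fun x => .atom (ldot x.e v)) X (.ofList [encL v]) (50 * N + 80) fun x _ => ?_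
  · have h : encL (X.map fun x => ldot x.e v) = .ofList (X.map fun x => .atom (ldot x.e v)) := by
      rw [encL, List.map_map]; rfl
    rw [h]
    refine Runs.mono this ?_
    have := Nat.mul_le_mul_left (50 * N + 80 + 30) hX
    have : (50 * N + 80 + 30) * N = 50 * (N * N) + 110 * N := by ring
    omega
  · refine (runs_dot m x.e v).wp fun t ht => ?_
    have := x.length_e
    exact ⟨rfl, by omega⟩

theorem runs_matVec (hN : 1 ≤ N) (M : List (List ℝ)) (hM : M.length ≤ N)
    (hrow : ∀ r ∈ M, r.length ≤ N) (v : List ℝ) :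
    Runs (m :: procedures) (.call Proc.matVec) (.ofList [.ofList (M.map encL), encL v])
      (encL (M.map fun r => ldot r v)) (200 * (N * N)) := by
  have hNN : N ≤ N * N := Nat.le_mul_self N
  have := runs_map m (self := Proc.matVec) rfl encL
    (fun r => .atom (ldot r v)) M (.ofList [encL v]) (50 * N + 80) fun r hr => ?_
  · have h : encL (M.map fun r => ldot r v) = .ofList (M.map fun r => .atom (ldot r v)) := by
      rw [encL, List.map_map]; rfl
    rw [h]
    refine Runs.mono this ?_
    have := Nat.mul_le_mul_left (50 * N + 80 + 30) hM
    have : (50 * N + 80 + 30) * N = 50 * (N * N) + 110 * N := by ring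
    omega
  · refine (runs_dot m r v).wp fun t ht => ?_
    have := hrow r hr
    exact ⟨rfl, by omega⟩

theorem runs_append_encL (x y : List ℝ) :
    Runs (m :: procedures) (.call Proc.append) (.ofList [encL x, encL y]) (encL (x ++ y))
      (40 * x.length + 40) := by
  simpa [encL] using runs_append m (x.map Val.atom) (y.map Val.atom)

theorem length_relRow (S : Finset (Fin k × Fin k)) (a : Fin k) : (relRow S a).length = k := by
  simp [relRow]

variable (h : IsFormJoin B₁ E₁ B₂ E₂ B E i₁ i₂ S L R)

/-- The member of a join that comes from a member of the left side. -/
def Member.joinLeft (h : IsFormJoin B₁ E₁ B₂ E₂ B E i₁ i₂ S L R) (hk : k ≤ N)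
    (x : Member E₁ N) : Member E N where
  w := i₁ x.w
  e := llin x.e (List.ofFn fun a => lunit (L a))
  getD_e l := by simp only [getD_llin_ofFn, getD_lunit, h.label_left, x.getD_e]
  length_e := length_llin_le _ _ _ fun r hr => by
    obtain ⟨a, rfl⟩ := (List.mem_ofFn' _ _).1 hr
    rw [length_lunit]
    have := (L a).2
    omega

/-- The member of a join that comes from a member of the right side. -/
def Member.joinRight (h : IsFormJoin B₁ E₁ B₂ E₂ B E i₁ i₂ S L R) (hk : k ≤ N)
    (x : Member E₂ N) : Member E N where
  w := i₂ x.w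
  e := llin x.e (List.ofFn fun a => lunit (R a))
  getD_e l := by simp only [getD_llin_ofFn, getD_lunit, h.label_right, x.getD_e]
  length_e := length_llin_le _ _ _ fun r hr => by
    obtain ⟨a, rfl⟩ := (List.mem_ofFn' _ _).1 hr
    rw [length_lunit]
    have := (R a).2
    omega

/-- The products across a join are computed from the label vectors of the two sides and the
matrix of `S`. -/
theorem ldot_cross (h : IsFormJoin B₁ E₁ B₂ E₂ B E i₁ i₂ S L R) (x : Member E₁ N)
    (y : Member E₂ N) : ldot y.e (llin x.e (List.ofFn (relRow S))) = B (i₁ x.w) (i₂ y.w) := by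
  simp only [ldot_llin_ofFn, relRow, ldot_ofFn, h.cross, x.getD_e, y.getD_e, Finset.mul_sum,
    mul_assoc]

theorem ldot_cross' (h : IsFormJoin B₁ E₁ B₂ E₂ B E i₁ i₂ S L R) (x : Member E₁ N)
    (y : Member E₂ N) :
    ldot x.e ((List.ofFn (relRow S)).map fun r => ldot r y.e) = B (i₂ y.w) (i₁ x.w) := by
  rw [h.symm]
  simp only [List.map_ofFn, ldot_ofFn, Function.comp_apply, ldot_comm _ y.e, relRow, h.cross,
    x.getD_e, y.getD_e, Finset.mul_sum, mul_assoc]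

theorem runs_joinLeft (hN : 1 ≤ N) (hk : k ≤ N) (X₁ : List (Member E₁ N))
    (X₂ : List (Member E₂ N)) (h₁ : X₁.length ≤ N) (h₂ : X₂.length ≤ N) :
    Runs (m :: procedures) (.call Proc.joinLeft)
      (.ofList [Member.encs B₁ X₁, Member.encs B₂ X₂, encodeRel S,
        .ofList ((List.ofFn fun a => lunit (L a)).map encL)])
      (.ofList (X₁.map fun x => .cons (encL (x.joinLeft h hk).e)
        (encL ((X₁.map fun y => B (i₁ x.w) (i₁ y.w)) ++ X₂.map fun y => B (i₁ x.w) (i₂ y.w)))))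
      (2000 * (N * N * N)) := by
  have hNN : N ≤ N * N := Nat.le_mul_self N
  have hNNN : N * N ≤ N * N * N := Nat.le_mul_of_pos_right _ hN
  have := runs_map m (self := Proc.joinLeft) rfl
    (fun x : Member E₁ N => .cons (encL x.e) (encL (X₁.map fun y => B₁ x.w y.w)))
    (fun x => .cons (encL (x.joinLeft h hk).e)
        (encL ((X₁.map fun y => B (i₁ x.w) (i₁ y.w)) ++ X₂.map fun y => B (i₁ x.w) (i₂ y.w))))
    X₁ (.ofList [Member.encs B₂ X₂, encodeRel S,
        .ofList ((List.ofFn fun a => lunit (L a)).map encL)]) (1200 * (N * N)) fun x _ => ?_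
  · refine Runs.mono this ?_
    have := Nat.mul_le_mul_left (1200 * (N * N) + 30) h₁
    have : (1200 * (N * N) + 30) * N = 1200 * (N * N * N) + 30 * N := by ring
    omega
  · have he : (70 * N + 130) * x.e.length ≤ 200 * (N * N) := by
      have := Nat.mul_le_mul_left (70 * N + 130) x.length_e
      have : (70 * N + 130) * N = 70 * (N * N) + 130 * N := by ring
      omega
    refine (runs_lincomb m x.e (List.ofFn fun a => lunit (L a)) N fun r hr => ?_).wp
      fun t₁ h₁ => ?_
    · obtain ⟨a, rfl⟩ := (List.mem_ofFn' _ _).1 hr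
      rw [length_lunit]
      have := (L a).2
      omega
    refine (runs_lincomb m x.e (List.ofFn (relRow S)) N fun r hr => ?_).wp_of_eq
      (by rw [encodeRel_eq]; rfl) fun t₂ h₂ => ?_
    · obtain ⟨a, rfl⟩ := (List.mem_ofFn' _ _).1 hr
      rwa [length_relRow]
    refine (runs_labelDots m hN X₂ ‹_› _).wp fun t₃ h₃ => ?_
    refine (runs_append_encL m _ _).wp fun t₄ h₄ => ?_
    rw [List.length_map] at h₄
    refine ⟨?_, by omega⟩
    simp only [ldot_cross h, h.left, Member.joinLeft]

theorem runs_joinRight (hN : 1 ≤ N) (hk : k ≤ N) (X₁ : List (Member E₁ N))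
    (X₂ : List (Member E₂ N)) (h₁ : X₁.length ≤ N) (h₂ : X₂.length ≤ N) :
    Runs (m :: procedures) (.call Proc.joinRight)
      (.ofList [Member.encs B₂ X₂, Member.encs B₁ X₁, encodeRel S,
        .ofList ((List.ofFn fun a => lunit (R a)).map encL)])
      (.ofList (X₂.map fun x => .cons (encL (x.joinRight h hk).e)
        (encL ((X₁.map fun y => B (i₂ x.w) (i₁ y.w)) ++ X₂.map fun y => B (i₂ x.w) (i₂ y.w)))))
      (2000 * (N * N * N)) := by
  have hNN : N ≤ N * N := Nat.le_mul_self N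
  have hNNN : N * N ≤ N * N * N := Nat.le_mul_of_pos_right _ hN
  have := runs_map m (self := Proc.joinRight) rfl
    (fun x : Member E₂ N => .cons (encL x.e) (encL (X₂.map fun y => B₂ x.w y.w)))
    (fun x => .cons (encL (x.joinRight h hk).e)
        (encL ((X₁.map fun y => B (i₂ x.w) (i₁ y.w)) ++ X₂.map fun y => B (i₂ x.w) (i₂ y.w))))
    X₂ (.ofList [Member.encs B₁ X₁, encodeRel S,
        .ofList ((List.ofFn fun a => lunit (R a)).map encL)]) (1200 * (N * N)) fun x _ => ?_
  · refine Runs.mono this ?_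
    have := Nat.mul_le_mul_left (1200 * (N * N) + 30) h₂
    have : (1200 * (N * N) + 30) * N = 1200 * (N * N * N) + 30 * N := by ring
    omega
  · have he : (70 * N + 130) * x.e.length ≤ 200 * (N * N) := by
      have := Nat.mul_le_mul_left (70 * N + 130) x.length_e
      have : (70 * N + 130) * N = 70 * (N * N) + 130 * N := by ring
      omega
    refine (runs_lincomb m x.e (List.ofFn fun a => lunit (R a)) N fun r hr => ?_).wp
      fun t₁ h₁ => ?_
    · obtain ⟨a, rfl⟩ := (List.mem_ofFn' _ _).1 hr
      rw [length_lunit]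
      have := (R a).2
      omega
    refine (runs_matVec m hN (List.ofFn (relRow S)) (by simpa using hk) (fun r hr => ?_)
      x.e).wp_of_eq (by rw [encodeRel_eq]; rfl) fun t₂ h₂ => ?_
    · obtain ⟨a, rfl⟩ := (List.mem_ofFn' _ _).1 hr
      rwa [length_relRow]
    refine (runs_labelDots m hN X₁ ‹_› _).wp fun t₃ h₃ => ?_
    refine (runs_append_encL m _ _).wp fun t₄ h₄ => ?_
    rw [List.length_map] at h₄
    refine ⟨?_, by omega⟩
    simp only [ldot_cross' h, h.right, Member.joinRight]

theorem lspan_map (i : W₁ →ₗ[ℝ] W) (l : List W₁) : lspan (l.map i) = (lspan l).map i := by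
  rw [lspan, lspan, Submodule.map_span]
  congr 1
  ext; simp

/-- What is split off from one side stays orthogonal to the other side, since its labels vanish. -/
theorem Splits.join {ws₁ us₁ : List W₁} {ws₂ us₂ : List W₂} {p₁ q₁ z₁ p₂ q₂ z₂ : ℕ}
    (h : IsFormJoin B₁ E₁ B₂ E₂ B E i₁ i₂ S L R)
    (h₁ : Splits B₁ E₁ k ws₁ us₁ p₁ q₁ z₁) (h₂ : Splits B₂ E₂ k ws₂ us₂ p₂ q₂ z₂) :
    Splits B E k (ws₁.map i₁ ++ ws₂.map i₂) (us₁.map i₁ ++ us₂.map i₂) (p₁ + p₂) (q₁ + q₂)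
      (z₁ + z₂) := by
  have c₁ (u : W₁) (hu : u ∈ us₁) (v : W₂) : B (i₁ u) (i₂ v) = 0 := by
    rw [h.cross]
    exact Finset.sum_eq_zero fun a _ => Finset.sum_eq_zero fun b _ => by
      rw [h₁.label u hu a a.2, zero_mul, zero_mul]
  have c₂ (u : W₂) (hu : u ∈ us₂) (v : W₁) : B (i₂ u) (i₁ v) = 0 := by
    rw [h.symm, h.cross]
    exact Finset.sum_eq_zero fun a _ => Finset.sum_eq_zero fun b _ => by
      rw [h₂.label u hu b b.2, mul_zero, zero_mul]
  constructor
  · simp only [List.mem_append, List.mem_map]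
    rintro _ (⟨u, hu, rfl⟩ | ⟨u, hu, rfl⟩) l hl
    · rw [h.label_left]
      exact Finset.sum_eq_zero fun a _ => by rw [h₁.label u hu a a.2, zero_mul]
    · rw [h.label_right]
      exact Finset.sum_eq_zero fun a _ => by rw [h₂.label u hu a a.2, zero_mul]
  · simp only [List.mem_append, List.mem_map]
    rintro _ (⟨u, hu, rfl⟩ | ⟨u, hu, rfl⟩) _ (⟨w, hw, rfl⟩ | ⟨w, hw, rfl⟩)
    · rw [h.left, h₁.orth u hu w hw]
    · exact c₁ u hu w
    · exact c₂ u hu w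
    · rw [h.right, h₂.orth u hu w hw]
  · refine List.pairwise_append.2 ⟨?_, ?_, ?_⟩
    · rw [List.pairwise_map]
      exact h₁.pairwise.imp fun h' => by rw [h.left, h']
    · rw [List.pairwise_map]
      exact h₂.pairwise.imp fun h' => by rw [h.right, h']
    · simp only [List.mem_map]
      rintro _ ⟨u, hu, rfl⟩ _ ⟨v, -, rfl⟩
      exact c₁ u hu v
  · simp [Function.comp_def, h.left, h.right, h₁.pos, h₂.pos]
  · simp [Function.comp_def, h.left, h.right, h₁.neg, h₂.neg]
  · simp [Function.comp_def, h.left, h.right, h₁.zero, h₂.zero]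

/-- The two states together have at most `4 k` vectors, the bound `N` under which a reduction
works. -/
theorem IsState.exists_join (hk : 1 ≤ k) (hN : N = 4 * k) {v₁ v₂ : Val}
    (h : IsFormJoin B₁ E₁ B₂ E₂ B E i₁ i₂ S L R)
    (h₁ : IsState B₁ E₁ N k (2 * k) v₁) (h₂ : IsState B₂ E₂ N k (2 * k) v₂) :
    ∃ v, Runs (m :: procedures) (.call Proc.join)
      (.ofList [v₁, v₂, encodeRel S, encodeMap L, encodeMap R, .atom k]) v
      (40000 * (N * N * N)) ∧ IsState B E N k (2 * k) v := by
  obtain ⟨X₁, us₁, p₁, q₁, z₁, rfl, hspan₁, hlen₁, hX₁, hs₁⟩ := h₁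
  obtain ⟨X₂, us₂, p₂, q₂, z₂, rfl, hspan₂, hlen₂, hX₂, hs₂⟩ := h₂
  have hkN : k ≤ N := by omega
  have hN1 : 1 ≤ N := by omega
  have hstate : IsState B E N k N (.cons
      (.ofList ((X₁.map fun x => .cons (encL (x.joinLeft h hkN).e)
        (encL ((X₁.map fun y => B (i₁ x.w) (i₁ y.w)) ++ X₂.map fun y => B (i₁ x.w) (i₂ y.w)))) ++
        X₂.map fun x => .cons (encL (x.joinRight h hkN).e)
        (encL ((X₁.map fun y => B (i₂ x.w) (i₁ y.w)) ++ X₂.map fun y => B (i₂ x.w) (i₂ y.w)))))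
      (.cons (.atom ↑(p₁ + p₂)) (.cons (.atom ↑(q₁ + q₂)) (.atom ↑(z₁ + z₂))))) := by
    refine ⟨X₁.map (Member.joinLeft h hkN) ++ X₂.map (Member.joinRight h hkN),
      us₁.map i₁ ++ us₂.map i₂, p₁ + p₂, q₁ + q₂, z₁ + z₂, ?_, ?_, ?_, ?_, ?_⟩
    · simp [Member.encs, Function.comp_def, Member.joinLeft, Member.joinRight]
    · have hw₁ : (X₁.map (Member.joinLeft h hkN)).map Member.w = (X₁.map Member.w).map i₁ := by
        simp [Function.comp_def, Member.joinLeft]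
      have hw₂ : (X₂.map (Member.joinRight h hkN)).map Member.w = (X₂.map Member.w).map i₂ := by
        simp [Function.comp_def, Member.joinRight]
      rw [List.map_append, hw₁, hw₂, lspan_append, lspan_append, lspan_map, lspan_map, lspan_map,
        lspan_map, sup_sup_sup_comm, ← Submodule.map_sup, ← Submodule.map_sup, hspan₁, hspan₂,
        Submodule.map_top, Submodule.map_top, h.range]
    · rw [← h.finrank, ← hlen₁, ← hlen₂]
      simp only [List.length_append, List.length_map]
      omega
    · simp only [List.length_append, List.length_map]
      omega
    · have := hs₁.join h hs₂
      simpa [Function.comp_def, Member.joinLeft, Member.joinRight] using this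
  obtain ⟨v, hrun, hv⟩ := hstate.exists_reduce m hN1 h.symm le_rfl le_rfl (by omega)
  refine ⟨v, Exec.runs (c := .join) rfl ?_, hv⟩
  have hNN : N ≤ N * N := Nat.le_mul_self N
  have hNNN : N * N ≤ N * N * N := Nat.le_mul_of_pos_right _ hN1
  have hkk : (30 * k + 80) * k ≤ 110 * (N * N) := by
    have : k * k ≤ N * N := Nat.mul_le_mul hkN hkN
    have : (30 * k + 80) * k = 30 * (k * k) + 80 * k := by ring
    omega
  refine (runs_mapMatrix m L).wp fun t₁ ht₁ => ?_
  refine (runs_joinLeft m h hN1 hkN X₁ X₂ (by omega) (by omega)).wp fun t₂ ht₂ => ?_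
  refine (runs_mapMatrix m R).wp fun t₃ ht₃ => ?_
  refine (runs_joinRight m h hN1 hkN X₁ X₂ (by omega) (by omega)).wp fun t₄ ht₄ => ?_
  refine (runs_append m _ _).wp fun t₅ ht₅ => ?_
  rw [List.length_map] at ht₅
  refine hrun.wp_of_eq (by simp [Val.ofList]) fun t₆ ht₆ => ?_
  exact ⟨rfl, by omega⟩

end join

/-! ### Sylvester's law of inertia -/

section sylvester

variable {W : Type*} [AddCommGroup W] [Module ℝ W] {B : LinearMap.BilinForm ℝ W}

/-- A form is positive definite on the span of orthogonal positive vectors. -/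
theorem apply_self_pos_of_mem_lspan (hB : ∀ u v, B u v = B v u) {l : List W}
    (ho : l.Pairwise fun u v => B u v = 0) (hl : ∀ u ∈ l, 0 < B u u) {x : W}
    (hx : x ∈ lspan l) (hx0 : x ≠ 0) : 0 < B x x := by
  induction l generalizing x with
  | nil => simp at hx; exact (hx0 hx).elim
  | cons u l ih =>
    rw [lspan_cons, Submodule.mem_sup] at hx
    obtain ⟨_, hc, y, hy, rfl⟩ := hx
    obtain ⟨c, rfl⟩ := Submodule.mem_span_singleton.1 hc
    rw [List.pairwise_cons] at ho
    have huy : B u y = 0 := (lspan_le (U := LinearMap.ker (B u))).2 ho.1 hy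
    have hu := hl u List.mem_cons_self
    have : B (c • u + y) (c • u + y) = c * c * B u u + B y y := by
      simp [huy, hB y u]; ring
    rw [this]
    by_cases hy0 : y = 0
    · subst hy0
      have hc0 : c ≠ 0 := by rintro rfl; simp at hx0
      simpa using mul_pos (mul_self_pos.2 hc0) hu
    · have := ih ho.2 (fun v hv => hl v (List.mem_cons_of_mem _ hv)) hy hy0
      nlinarith [mul_self_nonneg c, mul_nonneg (mul_self_nonneg c) hu.le]

theorem apply_self_nonpos_of_mem_lspan (hB : ∀ u v, B u v = B v u) {l : List W}
    (ho : l.Pairwise fun u v => B u v = 0) (hl : ∀ u ∈ l, B u u ≤ 0) {x : W}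
    (hx : x ∈ lspan l) : B x x ≤ 0 := by
  induction l generalizing x with
  | nil => simp at hx; simp [hx]
  | cons u l ih =>
    rw [lspan_cons, Submodule.mem_sup] at hx
    obtain ⟨_, hc, y, hy, rfl⟩ := hx
    obtain ⟨c, rfl⟩ := Submodule.mem_span_singleton.1 hc
    rw [List.pairwise_cons] at ho
    have huy : B u y = 0 := (lspan_le (U := LinearMap.ker (B u))).2 ho.1 hy
    have hu := hl u List.mem_cons_self
    have : B (c • u + y) (c • u + y) = c * c * B u u + B y y := by
      simp [huy, hB y u]; ring
    rw [this]
    have := ih ho.2 (fun v hv => hl v (List.mem_cons_of_mem _ hv)) hy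
    nlinarith [mul_self_nonneg c, mul_nonneg (mul_self_nonneg c) (neg_nonneg.2 hu)]

theorem finrank_lspan_le (l : List W) : Module.finrank ℝ (lspan l) ≤ l.length := by
  classical
  have h : lspan l = Submodule.span ℝ (l.toFinset : Set W) := by
    rw [lspan]; congr 1; ext; simp
  rw [h]
  exact (finrank_span_finset_le_card _).trans l.toFinset_card_le

theorem length_filter_le_finrank [FiniteDimensional ℝ W] {l : List W} (hl : lspan l = ⊤)
    (hlen : l.length = Module.finrank ℝ W) (p : W → Bool) :
    (l.filter p).length ≤ Module.finrank ℝ (lspan (l.filter p)) := by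
  have hsup : lspan (l.filter p) ⊔ lspan (l.filter fun x => !p x) = ⊤ := by
    rw [← lspan_append, ← hl]
    exact lspan_perm (List.filter_append_perm p l)
  have h₁ := Submodule.finrank_add_le_finrank_add_finrank (lspan (l.filter p))
    (lspan (l.filter fun x => !p x))
  rw [hsup, finrank_top, ← hlen] at h₁
  have h₂ := finrank_lspan_le (l.filter fun x => !p x)
  have h₃ := (List.filter_append_perm p l).length_eq
  rw [List.length_append] at h₃
  omega

open Classical in
/-- Two orthogonal bases have the same number of positive vectors: the span of the positive vectors
of the one and the span of the other vectors of the other have only `0` in common. -/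
theorem countP_pos_le [FiniteDimensional ℝ W] (hB : ∀ u v, B u v = B v u) {us vs : List W}
    (hu : lspan us = ⊤) (hv : lspan vs = ⊤) (hul : us.length = Module.finrank ℝ W)
    (hvl : vs.length = Module.finrank ℝ W) (huo : us.Pairwise fun u v => B u v = 0)
    (hvo : vs.Pairwise fun u v => B u v = 0) :
    us.countP (fun u => 0 < B u u) ≤ vs.countP (fun u => 0 < B u u) := by
  have h₁ := length_filter_le_finrank hu hul fun u => 0 < B u u
  have h₂ := length_filter_le_finrank hv hvl fun u => !decide (0 < B u u)
  have hdisj : lspan (us.filter fun u => 0 < B u u) ⊓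
      lspan (vs.filter fun u => !decide (0 < B u u)) = ⊥ := by
    rw [eq_bot_iff]
    intro x hx
    by_contra hx0
    have hp := apply_self_pos_of_mem_lspan hB (huo.filter _) (fun u hu => by simpa using
      (List.mem_filter.1 hu).2) hx.1 hx0
    have hn := apply_self_nonpos_of_mem_lspan hB (hvo.filter _) (fun u hu => by simpa using
      (List.mem_filter.1 hu).2) hx.2
    exact absurd hp (not_lt.2 hn)
  have h₃ := Submodule.finrank_sup_add_finrank_inf_eq (lspan (us.filter fun u => 0 < B u u))
    (lspan (vs.filter fun u => !decide (0 < B u u)))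
  rw [hdisj, finrank_bot] at h₃
  have h₄ := Submodule.finrank_le (lspan (us.filter fun u => 0 < B u u) ⊔
    lspan (vs.filter fun u => !decide (0 < B u u)))
  have h₅ := (List.filter_append_perm (fun u => decide (0 < B u u)) vs).length_eq
  rw [List.length_append] at h₅
  rw [List.countP_eq_length_filter, List.countP_eq_length_filter]
  omega

end sylvester

/-! ### The form of a labelled graph -/

section form

variable {V : Type*} [Fintype V]

open Classical in
/-- The bilinear form of the matrix `A - a I`, where `A` is the adjacency matrix of `G`. -/
noncomputable def adjForm (G : SimpleGraph V) (a : ℝ) : LinearMap.BilinForm ℝ (V → ℝ) :=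
  Matrix.toBilin' (G.adjMatrix ℝ - a • 1)

open Classical in
theorem adjForm_apply (G : SimpleGraph V) (a : ℝ) (x y : V → ℝ) :
    adjForm G a x y =
      ∑ u, ∑ v, x u * ((if G.Adj u v then 1 else 0) - if u = v then a else 0) * y v := by
  rw [adjForm, Matrix.toBilin'_apply]
  simp only [Matrix.sub_apply, SimpleGraph.adjMatrix_apply, Matrix.smul_apply, Matrix.one_apply,
    smul_eq_mul, mul_ite, mul_one, mul_zero]

theorem adjForm_symm (G : SimpleGraph V) (a : ℝ) (x y : V → ℝ) :
    adjForm G a x y = adjForm G a y x := by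
  classical
  rw [adjForm_apply, adjForm_apply G a y x, Finset.sum_comm]
  refine Finset.sum_congr rfl fun u _ => Finset.sum_congr rfl fun v _ => ?_
  rw [if_congr (G.adj_comm v u) rfl rfl, if_congr (eq_comm (a := v) (b := u)) rfl rfl]
  ring

theorem countP_sign_eq_pos {W : Type*} (f : W → ℝ) (l : List W) [DecidablePred fun w => 0 < f w] :
    (l.map fun w => SignType.sign (f w)).count 1 = l.countP fun w => 0 < f w := by
  rw [List.count, List.countP_map]
  exact List.countP_congr fun w _ => by simp [sign_eq_one_iff]

theorem countP_sign_eq_neg {W : Type*} (f : W → ℝ) (l : List W) [DecidablePred fun w => f w < 0] :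
    (l.map fun w => SignType.sign (f w)).count (-1) = l.countP fun w => f w < 0 := by
  rw [List.count, List.countP_map]
  exact List.countP_congr fun w _ => by simp [sign_eq_neg_one_iff]

theorem count_sign_add (l : List SignType) :
    l.count 1 + l.count (-1) + l.count 0 = l.length := by
  induction l with
  | nil => rfl
  | cons s l ih => cases s <;> simp <;> omega

open Classical in
/-- If all vectors are split off, they form an orthogonal basis and can be compared with a basis of
eigenvectors, so that they show how many eigenvalues are above, below and at `a`. -/
theorem countP_roots_of_splits (G : SimpleGraph V) (a : ℝ) {E : (V → ℝ) →ₗ[ℝ] ℕ → ℝ} {k : ℕ}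
    {us : List (V → ℝ)} {p q z : ℕ} (h : Splits (adjForm G a) E k [] us p q z)
    (hspan : lspan us = ⊤) (hlen : us.length = Module.finrank ℝ (V → ℝ)) :
    (G.adjMatrix ℝ).charpoly.roots.countP (a < ·) = p ∧
      (G.adjMatrix ℝ).charpoly.roots.countP (· < a) = q ∧
      (G.adjMatrix ℝ).charpoly.roots.countP (· = a) = z := by
  have hA : (G.adjMatrix ℝ).IsHermitian := by
    rw [Matrix.IsHermitian, Matrix.conjTranspose_eq_transpose_of_trivial]
    exact G.isSymm_adjMatrix
  set b : V → V → ℝ := fun i => ⇑(hA.eigenvectorBasis i) with hb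
  set vs : List (V → ℝ) := Finset.univ.toList.map b with hvs
  have hbb (i j : V) : adjForm G a (b i) (b j) = if i = j then hA.eigenvalues j - a else 0 := by
    have hdot : b i ⬝ᵥ b j = if i = j then 1 else 0 := by
      rw [← orthonormal_iff_ite.1 hA.eigenvectorBasis.orthonormal i j,
        EuclideanSpace.inner_eq_star_dotProduct, dotProduct_comm]
      simp [hb]
    rw [adjForm, Matrix.toBilin'_apply', Matrix.sub_mulVec, hA.mulVec_eigenvectorBasis,
      Matrix.smul_mulVec, Matrix.one_mulVec, ← sub_smul, dotProduct_smul]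
    rw [hdot]
    simp
  have hvl : vs.length = Module.finrank ℝ (V → ℝ) := by simp [hvs]
  have hvspan : lspan vs = ⊤ := by
    have hset : {w | w ∈ vs} = (WithLp.linearEquiv 2 ℝ (V → ℝ)) '' Set.range
        hA.eigenvectorBasis.toBasis := by
      ext w
      simp [hvs, hb]
    rw [lspan, hset, Submodule.span_image_linearEquiv, hA.eigenvectorBasis.toBasis.span_eq,
      Submodule.map_top, LinearMap.range_eq_top]
    exact (WithLp.linearEquiv 2 ℝ (V → ℝ)).surjective
  have hvo : vs.Pairwise fun u v => adjForm G a u v = 0 := by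
    rw [hvs, List.pairwise_map]
    exact (Finset.nodup_toList _).imp fun hij => by rw [hbb, if_neg hij]
  have hroots (r : ℝ → Prop) : (G.adjMatrix ℝ).charpoly.roots.countP r =
      (Finset.univ.toList (α := V)).countP fun i => r (hA.eigenvalues i) := by
    rw [hA.roots_charpoly_eq_eigenvalues, Multiset.countP_map, ← Finset.coe_toList,
      Multiset.filter_coe, Multiset.coe_card, List.countP_eq_length_filter]
    rfl
  have hpos : us.countP (fun u => 0 < adjForm G a u u) = vs.countP fun u => 0 < adjForm G a u u :=
    le_antisymm
      (countP_pos_le (adjForm_symm G a) hspan hvspan hlen hvl h.pairwise hvo)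
      (countP_pos_le (adjForm_symm G a) hvspan hspan hvl hlen hvo h.pairwise)
  -- The negative vectors are the positive vectors of the opposite form.
  have hneg :
      us.countP (fun u => adjForm G a u u < 0) = vs.countP fun u => adjForm G a u u < 0 := by
    have h₁ := countP_pos_le (B := -adjForm G a) (fun u v => by simp [adjForm_symm G a u v])
      hspan hvspan hlen hvl (h.pairwise.imp fun h => by simp [h]) (hvo.imp fun h => by simp [h])
    have h₂ := countP_pos_le (B := -adjForm G a) (fun u v => by simp [adjForm_symm G a u v])
      hvspan hspan hvl hlen (hvo.imp fun h => by simp [h]) (h.pairwise.imp fun h => by simp [h])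
    simpa using le_antisymm h₁ h₂
  have hsum := count_sign_add (us.map fun u => SignType.sign (adjForm G a u u))
  rw [h.pos, h.neg, h.zero, List.length_map, hlen, ← hvl] at hsum
  have hsum' := count_sign_add (vs.map fun u => SignType.sign (adjForm G a u u))
  have hz : (vs.map fun u => SignType.sign (adjForm G a u u)).count 0 =
      (Finset.univ.toList (α := V)).countP fun i => hA.eigenvalues i = a := by
    rw [List.count, List.countP_map, hvs, List.countP_map]
    exact List.countP_congr fun i _ => by simp [hbb, sub_eq_zero]
  have hp := h.pos
  have hq := h.neg
  rw [countP_sign_eq_pos, hpos] at hp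
  rw [countP_sign_eq_neg, hneg] at hq
  rw [countP_sign_eq_pos, countP_sign_eq_neg, hp, hq, List.length_map, hz] at hsum'
  refine ⟨?_, ?_, ?_⟩
  · rw [hroots, ← hp, hvs, List.countP_map]
    exact List.countP_congr fun i _ => by simp [hbb]
  · rw [hroots, ← hq, hvs, List.countP_map]
    exact List.countP_congr fun i _ => by simp [hbb]
  · rw [hroots]
    omega

end form

/-! ### Labelled graphs as forms -/

namespace LabeledGraph

variable {k : ℕ} {S : Finset (Fin k × Fin k)} {L R : Fin k → Fin k} {G H : LabeledGraph k}

instance fintypeSingle (i : Fin k) : Fintype (single i).V := inferInstanceAs (Fintype Unit)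

instance fintypeSlickJoin [Fintype G.V] [Fintype H.V] : Fintype (slickJoin S L R G H).V :=
  inferInstanceAs (Fintype (G.V ⊕ H.V))

/-- The linear map that takes a vector on the vertices to the sums of its entries over all vertices
with the same label. -/
noncomputable def labelSum (G : LabeledGraph k) [Fintype G.V] : (G.V → ℝ) →ₗ[ℝ] ℕ → ℝ :=
  LinearMap.pi fun l => ∑ v, if (G.label v : ℕ) = l then LinearMap.proj v else 0

theorem labelSum_apply [Fintype G.V] (x : G.V → ℝ) (l : ℕ) :
    G.labelSum x l = ∑ v, if (G.label v : ℕ) = l then x v else 0 := by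
  simp only [labelSum, LinearMap.pi_apply, LinearMap.sum_apply]
  refine Finset.sum_congr rfl fun v _ => ?_
  split_ifs <;> simp

theorem sum_labelSum_mul [Fintype G.V] (x : G.V → ℝ) (f : Fin k → ℝ) :
    ∑ a : Fin k, G.labelSum x a * f a = ∑ v, x v * f (G.label v) := by
  simp only [labelSum_apply, Finset.sum_mul]
  rw [Finset.sum_comm]
  simp [Fin.val_inj]

theorem slickJoin_adj_inl_inl (u v : G.V) :
    (slickJoin S L R G H).graph.Adj (Sum.inl u) (Sum.inl v) ↔ G.graph.Adj u v := by
  simp [slickJoin]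

theorem slickJoin_adj_inr_inr (u v : H.V) :
    (slickJoin S L R G H).graph.Adj (Sum.inr u) (Sum.inr v) ↔ H.graph.Adj u v := by
  simp [slickJoin]

theorem slickJoin_adj_inl_inr (u : G.V) (v : H.V) :
    (slickJoin S L R G H).graph.Adj (Sum.inl u) (Sum.inr v) ↔ (G.label u, H.label v) ∈ S := by
  simp [slickJoin]

theorem slickJoin_inl_inj (u v : G.V) :
    @Eq (slickJoin S L R G H).V (Sum.inl u) (Sum.inl v) ↔ u = v :=
  Sum.inl_injective.eq_iff

theorem slickJoin_inr_inj (u v : H.V) :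
    @Eq (slickJoin S L R G H).V (Sum.inr u) (Sum.inr v) ↔ u = v :=
  Sum.inr_injective.eq_iff

theorem slickJoin_label_inl (u : G.V) :
    (slickJoin S L R G H).label (Sum.inl u) = L (G.label u) := rfl

theorem slickJoin_label_inr (v : H.V) :
    (slickJoin S L R G H).label (Sum.inr v) = R (H.label v) := rfl

/-- The extension by zero of a vector on the left side of a join. -/
def extendLeft (G H : LabeledGraph k) (S : Finset (Fin k × Fin k)) (L R : Fin k → Fin k) :
    (G.V → ℝ) →ₗ[ℝ] (slickJoin S L R G H).V → ℝ where
  toFun x := Sum.elim x 0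
  map_add' _ _ := funext <| Sum.rec (fun _ => rfl) fun _ => (add_zero (0 : ℝ)).symm
  map_smul' c _ := funext <| Sum.rec (fun _ => rfl) fun _ => (mul_zero c).symm

/-- The extension by zero of a vector on the right side of a join. -/
def extendRight (G H : LabeledGraph k) (S : Finset (Fin k × Fin k)) (L R : Fin k → Fin k) :
    (H.V → ℝ) →ₗ[ℝ] (slickJoin S L R G H).V → ℝ where
  toFun x := Sum.elim 0 x
  map_add' _ _ := funext <| Sum.rec (fun _ => (add_zero (0 : ℝ)).symm) fun _ => rfl
  map_smul' c _ := funext <| Sum.rec (fun _ => (mul_zero c).symm) fun _ => rfl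

theorem extendLeft_inl (x : G.V → ℝ) (u : G.V) : extendLeft G H S L R x (Sum.inl u) = x u := rfl

theorem extendLeft_inr (x : G.V → ℝ) (v : H.V) : extendLeft G H S L R x (Sum.inr v) = 0 := rfl

theorem extendRight_inl (x : H.V → ℝ) (u : G.V) : extendRight G H S L R x (Sum.inl u) = 0 := rfl

theorem extendRight_inr (x : H.V → ℝ) (v : H.V) : extendRight G H S L R x (Sum.inr v) = x v := rfl

theorem sum_slickJoin [Fintype G.V] [Fintype H.V] (f : (slickJoin S L R G H).V → ℝ) :
    ∑ v, f v = ∑ u, f (Sum.inl u) + ∑ v, f (Sum.inr v) :=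
  Fintype.sum_sum_type f

theorem isFormJoin [Fintype G.V] [Fintype H.V] (a : ℝ) :
    IsFormJoin (adjForm G.graph a) G.labelSum (adjForm H.graph a) H.labelSum
      (adjForm (slickJoin S L R G H).graph a) (slickJoin S L R G H).labelSum
      (extendLeft G H S L R) (extendRight G H S L R) S L R where
  symm := adjForm_symm _ a
  left x y := by
    classical
    rw [adjForm_apply, adjForm_apply, sum_slickJoin]
    simp only [sum_slickJoin]
    simp [extendLeft_inl, extendLeft_inr, slickJoin_adj_inl_inl, slickJoin_inl_inj]
  right x y := by
    classical
    rw [adjForm_apply, adjForm_apply, sum_slickJoin]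
    simp only [sum_slickJoin]
    simp [extendRight_inl, extendRight_inr, slickJoin_adj_inr_inr, slickJoin_inr_inj]
  cross x y := by
    classical
    simp only [mul_assoc, ← Finset.mul_sum]
    simp only [sum_labelSum_mul]
    rw [adjForm_apply, sum_slickJoin]
    simp only [sum_slickJoin]
    simp [extendLeft_inl, extendLeft_inr, extendRight_inl, extendRight_inr, slickJoin_adj_inl_inr,
      Finset.mul_sum]
  label_left x l := by
    rw [sum_labelSum_mul, labelSum_apply, sum_slickJoin]
    simp [extendLeft_inl, extendLeft_inr, slickJoin_label_inl, slickJoin_label_inr,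
      eq_comm]
  label_right x l := by
    rw [sum_labelSum_mul, labelSum_apply, sum_slickJoin]
    simp [extendRight_inl, extendRight_inr, slickJoin_label_inl, slickJoin_label_inr,
      eq_comm]
  range := by
    rw [eq_top_iff]
    intro x _
    refine Submodule.mem_sup.2 ⟨_, ⟨fun u => x (Sum.inl u), rfl⟩, _,
      ⟨fun v => x (Sum.inr v), rfl⟩, ?_⟩
    refine funext <| Sum.rec (fun u => ?_) fun v => ?_
    · exact add_zero _
    · exact zero_add _
  finrank := by
    simp only [Module.finrank_fintype_fun_eq_card]
    exact Fintype.card_sum.symm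

end LabeledGraph

/-! ### The state of a slick expression -/

section slick

variable {k : ℕ} (m : Code)

instance SlickExpr.fintypeEval : (e : SlickExpr k) → Fintype e.eval.V
  | .vertex i => LabeledGraph.fintypeSingle i
  | .join _ _ _ e₁ e₂ =>
    letI := fintypeEval e₁
    letI := fintypeEval e₂
    LabeledGraph.fintypeSlickJoin

theorem SlickExpr.one_le : SlickExpr k → 1 ≤ k
  | .vertex i => i.pos
  | .join _ _ _ e₁ _ => e₁.one_le

/-- On a single vertex, the form is `-a`. -/
theorem isState_vertex (i : Fin k) (a : ℝ) :
    IsState (adjForm (LabeledGraph.single i).graph a) (LabeledGraph.single i).labelSum (4 * k) k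
      (2 * k)
      (.cons (.cons (.cons (encL (lunit i)) (.cons (.atom (((0 : ℚ) : ℝ) - a)) .nil)) .nil)
        (.cons (.atom ((0 : ℚ) : ℝ)) (.cons (.atom ((0 : ℚ) : ℝ)) (.atom ((0 : ℚ) : ℝ))))) := by
  have hk := i.2
  refine ⟨[⟨fun _ => 1, lunit i, fun l => ?_, ?_⟩], [], 0, 0, 0, ?_, ?_, ?_, ?_, ?_⟩
  · rw [getD_lunit, LabeledGraph.labelSum_apply]
    refine Eq.trans ?_ (Fintype.sum_unique (ι := Unit) _).symm
    exact if_congr eq_comm rfl rfl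
  · rw [length_lunit]; omega
  · have : adjForm (LabeledGraph.single i).graph a (fun _ => 1) (fun _ => 1) = -a := by
      have hadj (u v : (LabeledGraph.single i).V) : ¬ (LabeledGraph.single i).graph.Adj u v :=
        fun h => h
      have : Subsingleton (LabeledGraph.single i).V := inferInstanceAs (Subsingleton Unit)
      have hcard : Fintype.card (LabeledGraph.single i).V = 1 := Fintype.card_unit
      simp [adjForm_apply, hadj, eq_iff_true_of_subsingleton, hcard]
    simp [Member.encs, this, encL, Val.ofList]
  · rw [eq_top_iff]
    intro x _
    refine Submodule.mem_sup_left ?_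
    rw [List.map_cons, List.map_nil, lspan_cons]
    refine Submodule.mem_sup_left (Submodule.mem_span_singleton.2 ⟨x (), ?_⟩)
    funext v
    exact mul_one _
  · simp only [Module.finrank_fintype_fun_eq_card]
    rfl
  · simp only [List.length_cons, List.length_nil]; omega
  · constructor <;> simp

/-- An expression for `n` vertices has `n` atoms and `n - 1` joins. If each of them takes at most
the time `A`, then the total time `T` satisfies `T + A ≤ 2 A n`, an inequality that joins
preserve. -/
theorem runs_run (e : SlickExpr k) (a : ℝ) :
    ∃ v T, T + 50000 * (4 * k * (4 * k) * (4 * k)) ≤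
        100000 * (4 * k * (4 * k) * (4 * k)) * Fintype.card e.eval.V ∧
      Runs (m :: procedures) (.call Proc.run) (.ofList [e.encode, .atom k, .atom a]) v T ∧
      IsState (adjForm e.eval.graph a) e.eval.labelSum (4 * k) k (2 * k) v := by
  induction e with
  | vertex i =>
    have hk := i.2
    have hN : 4 * k ≤ 4 * k * (4 * k) := Nat.le_mul_self _
    have hNN : 4 * k * (4 * k) ≤ 4 * k * (4 * k) * (4 * k) :=
      Nat.le_mul_of_pos_right _ (by omega)
    refine ⟨_, 50000 * (4 * k * (4 * k) * (4 * k)), ?_, ?_, isState_vertex i a⟩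
    · have : Fintype.card (SlickExpr.vertex i).eval.V = 1 := Fintype.card_unit
      rw [this]; omega
    · refine Exec.runs (c := .run) rfl (ite_intro_neg (lt_irrefl 0) ?_)
      refine (runs_unit m i).wp fun t ht => ?_
      exact ⟨rfl, by omega⟩
  | join S L R e₁ e₂ ih₁ ih₂ =>
    obtain ⟨v₁, T₁, hT₁, hr₁, hs₁⟩ := ih₁
    obtain ⟨v₂, T₂, hT₂, hr₂, hs₂⟩ := ih₂
    have hk := e₁.one_le
    have hN : 4 * k ≤ 4 * k * (4 * k) := Nat.le_mul_self _
    have hNN : 4 * k * (4 * k) ≤ 4 * k * (4 * k) * (4 * k) :=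
      Nat.le_mul_of_pos_right _ (by omega)
    obtain ⟨v, hr, hs⟩ := IsState.exists_join m hk rfl (LabeledGraph.isFormJoin a) hs₁ hs₂
    refine ⟨v, T₁ + T₂ + 50000 * (4 * k * (4 * k) * (4 * k)), ?_, ?_, hs⟩
    · have : Fintype.card (SlickExpr.join S L R e₁ e₂).eval.V =
          Fintype.card e₁.eval.V + Fintype.card e₂.eval.V := Fintype.card_sum
      rw [this, mul_add]
      omega
    · refine Exec.runs (c := .run) rfl (ite_intro_pos one_pos ?_)
      refine hr₁.wp fun t₁ h₁ => ?_
      refine hr₂.wp fun t₂ h₂ => ?_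
      refine hr.wp fun t₃ h₃ => ?_
      exact ⟨rfl, by omega⟩

open Classical in
/-- At the root, a reduction with respect to no label at all splits off all vectors. -/
theorem runs_inertia (e : SlickExpr k) (a : ℝ) :
    Runs (m :: procedures) (.call Proc.inertia) (.ofList [e.encode, .atom k, .atom a])
      (.cons (.atom ↑((e.eval.graph.adjMatrix ℝ).charpoly.roots.countP (a < ·)))
        (.cons (.atom ↑((e.eval.graph.adjMatrix ℝ).charpoly.roots.countP (· < a)))
          (.atom ↑((e.eval.graph.adjMatrix ℝ).charpoly.roots.countP (· = a)))))
      (100000 * (4 * k * (4 * k) * (4 * k)) * Fintype.card e.eval.V) := by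
  have hk := e.one_le
  have hN : 4 * k ≤ 4 * k * (4 * k) := Nat.le_mul_self _
  have hNN : 4 * k * (4 * k) ≤ 4 * k * (4 * k) * (4 * k) :=
    Nat.le_mul_of_pos_right _ (by omega)
  obtain ⟨v, T, hT, hrun, hs⟩ := runs_run m e a
  obtain ⟨X, us, p, q, z, rfl, -⟩ := id hs
  obtain ⟨_, hr, X', us', p', q', z', rfl, hspan, hlen, hX', hs'⟩ :=
    hs.exists_reduce m (k' := 0) (by omega) (adjForm_symm _ a) (by omega) (by omega) (by omega)
  obtain rfl : X' = [] := List.length_eq_zero_iff.1 (by omega)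
  obtain ⟨hp, hq, hz⟩ := countP_roots_of_splits e.eval.graph a hs'
    (by simpa using hspan) (by simpa using hlen)
  rw [hp, hq, hz]
  refine Exec.runs (c := .inertia) rfl ?_
  refine hrun.wp fun t₁ h₁ => ?_
  refine hr.wp_of_eq (by simp [Val.ofList]) fun t₂ h₂ => ?_
  exact ⟨rfl, by omega⟩

end slick

/-! ### Counting in an interval -/

section counting

open Classical in
theorem countP_add_countP_of_disjoint {α : Type*} (s : Multiset α) {p q r : α → Prop}
    (h : ∀ x, r x ↔ p x ∨ q x) (hd : ∀ x, ¬ (p x ∧ q x)) :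
    s.countP p + s.countP q = s.countP r := by
  rw [Multiset.countP_eq_card_filter, Multiset.countP_eq_card_filter,
    Multiset.countP_eq_card_filter, ← Multiset.card_add, Multiset.filter_add_filter,
    Multiset.filter_congr fun x _ => (h x).symm, Multiset.filter_eq_nil.2 fun x _ => hd x, add_zero]

open Classical in
theorem countP_eq_card_of_forall {α : Type*} (s : Multiset α) {p : α → Prop} (h : ∀ x, p x) :
    s.countP p = s.card :=
  Multiset.countP_eq_card.2 fun x _ => h x

theorem Endpoint.Below.mono {E : Endpoint} {x y : ℝ} (h : E.Below x) (hxy : x ≤ y) : E.Below y := by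
  cases E
  exacts [trivial, le_trans h hxy, lt_of_lt_of_le h hxy]

theorem Endpoint.Above.mono {E : Endpoint} {x y : ℝ} (h : E.Above x) (hxy : y ≤ x) : E.Above y := by
  cases E
  exacts [trivial, le_trans hxy h, lt_of_le_of_lt hxy h]

open Classical in
/-- The numbers that satisfy the one and the other condition of an interval determine how many
satisfy both: if the interval is not empty, then every number satisfies at least one of them. -/
theorem countP_mem_toSet (s : Multiset ℝ) (I : RealInterval) :
    (s.countP (· ∈ I.toSet) : ℝ) =
      if 0 < (s.countP I.lower.Below : ℝ) + s.countP I.upper.Above - s.card then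
        (s.countP I.lower.Below : ℝ) + s.countP I.upper.Above - s.card
      else ((0 : ℚ) : ℝ) := by
  have h : s.countP I.lower.Below + s.countP I.upper.Above =
      s.countP (fun x => I.lower.Below x ∨ I.upper.Above x) + s.countP (· ∈ I.toSet) := by
    simp only [Multiset.countP_eq_card_filter]
    rw [← Multiset.card_add, ← Multiset.card_add, Multiset.filter_add_filter]
    congr
  have h' : (s.countP I.lower.Below : ℝ) + s.countP I.upper.Above =
      s.countP (fun x => I.lower.Below x ∨ I.upper.Above x) + s.countP (· ∈ I.toSet) := by
    exact_mod_cast h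
  rw [h']
  by_cases hI : ∃ x, x ∈ I.toSet
  · obtain ⟨x, hx⟩ := hI
    have : s.countP (fun x => I.lower.Below x ∨ I.upper.Above x) = s.card :=
      Multiset.countP_eq_card.2 fun y _ => (le_total x y).imp hx.1.mono hx.2.mono
    rw [this, add_sub_cancel_left]
    split_ifs with h0
    · rfl
    · rw [Rat.cast_zero]
      exact le_antisymm (not_lt.1 h0) (Nat.cast_nonneg _)
  · have h0 : s.countP (· ∈ I.toSet) = 0 :=
      Multiset.countP_eq_zero.2 fun x _ hx => hI ⟨x, hx⟩
    have hle : (s.countP (fun x => I.lower.Below x ∨ I.upper.Above x) : ℝ) ≤ s.card :=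
      Nat.cast_le.2 (Multiset.countP_le_card _ _)
    rw [h0, if_neg (by push_cast; linarith)]
    simp

variable {k : ℕ} (m : Code) (e : SlickExpr k)

/-- A bound for the time in which a shift is treated. -/
def shiftTime : ℕ := 100000 * (4 * k * (4 * k) * (4 * k)) * Fintype.card e.eval.V

open Classical in
theorem countP_add_countP_add_countP (s : Multiset ℝ) (a : ℝ) :
    s.countP (a < ·) + (s.countP (· < a) + s.countP (· = a)) = s.card := by
  rw [countP_add_countP_of_disjoint s (fun x => le_iff_lt_or_eq (a := x) (b := a))
    fun x h => h.1.ne h.2]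
  rw [countP_add_countP_of_disjoint s (r := fun _ => True)
    (fun x => iff_of_true trivial (lt_or_ge a x)) fun x h => absurd h.1 (not_lt.2 h.2)]
  exact countP_eq_card_of_forall _ fun _ => trivial

open Classical in
theorem runs_lowCount (E : Endpoint) :
    Runs (m :: procedures) (.call Proc.lowCount) (.ofList [E.encode, e.encode, .atom k])
      (.atom ((e.eval.graph.adjMatrix ℝ).charpoly.roots.countP E.Below)) (shiftTime e + 100) := by
  cases E with
  | unbounded =>
    refine Exec.runs (c := .lowCount) rfl ?_
    refine (runs_inertia m e _).wp fun t ht => ?_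
    refine ⟨?_, by rw [shiftTime]; omega⟩
    simp only [← Nat.cast_add]
    rw [countP_add_countP_add_countP]
    rw [countP_eq_card_of_forall _ (p := Endpoint.unbounded.Below) fun _ => trivial]
  | incl a =>
    refine Exec.runs (c := .lowCount) rfl ?_
    refine (runs_inertia m e _).wp fun t ht => ?_
    refine ite_intro_pos one_pos ⟨?_, by rw [shiftTime]; omega⟩
    rw [← Nat.cast_add, countP_add_countP_of_disjoint (r := (Endpoint.incl a).Below)]
    · exact fun x => (le_iff_lt_or_eq (a := a)).trans (or_congr_right eq_comm)
    · exact fun x h => h.1.ne' h.2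
  | excl a =>
    refine Exec.runs (c := .lowCount) rfl ?_
    refine (runs_inertia m e _).wp fun t ht => ?_
    exact ite_intro_neg (lt_irrefl _) ⟨rfl, by rw [shiftTime]; omega⟩

open Classical in
theorem runs_highCount (E : Endpoint) :
    Runs (m :: procedures) (.call Proc.highCount) (.ofList [E.encode, e.encode, .atom k])
      (.atom ((e.eval.graph.adjMatrix ℝ).charpoly.roots.countP E.Above)) (shiftTime e + 100) := by
  cases E with
  | unbounded =>
    refine Exec.runs (c := .highCount) rfl ?_
    refine (runs_inertia m e _).wp fun t ht => ?_
    refine ⟨?_, by rw [shiftTime]; omega⟩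
    simp only [← Nat.cast_add]
    rw [countP_add_countP_add_countP]
    rw [countP_eq_card_of_forall _ (p := Endpoint.unbounded.Above) fun _ => trivial]
  | incl a =>
    refine Exec.runs (c := .highCount) rfl ?_
    refine (runs_inertia m e _).wp fun t ht => ?_
    refine ite_intro_pos one_pos ⟨?_, by rw [shiftTime]; omega⟩
    rw [← Nat.cast_add, countP_add_countP_of_disjoint (r := (Endpoint.incl a).Above)]
    · exact fun x => le_iff_lt_or_eq
    · exact fun x h => h.1.ne h.2
  | excl a =>
    refine Exec.runs (c := .highCount) rfl ?_
    refine (runs_inertia m e _).wp fun t ht => ?_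
    exact ite_intro_neg (lt_irrefl _) ⟨rfl, by rw [shiftTime]; omega⟩

open Classical in
theorem runs_count (I : RealInterval) :
    Runs (m :: procedures) (.call Proc.count) (inputOf k e.encode I)
      (.atom ((e.eval.graph.adjMatrix ℝ).charpoly.roots.countP (· ∈ I.toSet)))
      (3 * shiftTime e + 500) := by
  refine Exec.runs (c := .count) rfl ?_
  refine (runs_lowCount m e I.lower).wp fun t₁ h₁ => ?_
  refine (runs_highCount m e I.upper).wp fun t₂ h₂ => ?_
  refine (runs_lowCount m e .unbounded).wp fun t₃ h₃ => ?_
  have hcard : (e.eval.graph.adjMatrix ℝ).charpoly.roots.countP Endpoint.unbounded.Below =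
      (e.eval.graph.adjMatrix ℝ).charpoly.roots.card :=
    countP_eq_card_of_forall _ fun _ => trivial
  rw [countP_mem_toSet, ← hcard]
  by_cases h : 0 < ((e.eval.graph.adjMatrix ℝ).charpoly.roots.countP I.lower.Below : ℝ) +
      (e.eval.graph.adjMatrix ℝ).charpoly.roots.countP I.upper.Above -
      (e.eval.graph.adjMatrix ℝ).charpoly.roots.countP Endpoint.unbounded.Below
  · exact ite_intro_pos h ⟨by rw [if_pos h], by omega⟩
  · exact ite_intro_neg h ⟨by rw [if_neg h], by omega⟩

/-- The number of eigenvalues does not depend on the names of the vertices. -/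
theorem eigenvalueCount_of_iso {V : Type*} [Fintype V] [DecidableEq V] {G : SimpleGraph V}
    [DecidableRel G.Adj] (f : e.eval.graph ≃g G) (I : Set ℝ) :
    eigenvalueCount G I = (open Classical in
      (e.eval.graph.adjMatrix ℝ).charpoly.roots.countP (· ∈ I)) := by
  classical
  rw [eigenvalueCount]
  have : (e.eval.graph.adjMatrix ℝ).charpoly = (G.adjMatrix ℝ).charpoly := by
    rw [← Matrix.charpoly_reindex f.toEquiv]
    exact congrArg Matrix.charpoly (SimpleGraph.Iso.reindex_adjMatrix ℝ f)
  rw [← this]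

theorem shiftTime_eq {V : Type*} [Fintype V] {G : SimpleGraph V} (f : e.eval.graph ≃g G) :
    shiftTime e = 6400000 * (k ^ 3 * Fintype.card V) := by
  rw [shiftTime, Fintype.card_congr f.toEquiv]
  ring

theorem haltsWithin_slickProgram {V : Type*} [Fintype V] [Nonempty V] [DecidableEq V]
    {G : SimpleGraph V} [DecidableRel G.Adj] (f : e.eval.graph ≃g G) (I : RealInterval) :
    HaltsWithin slickProgram (inputOf k e.encode I) (.atom (eigenvalueCount G I.toSet))
      (20000000 * (k ^ 3 * Fintype.card V)) := by
  refine Runs.haltsWithin (Exec.runs (c := .call Proc.count) rfl ?_)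
  refine (runs_count (.call Proc.count) e I).wp fun t ht => ?_
  refine ⟨by rw [eigenvalueCount_of_iso e f], ?_⟩
  have : 1 ≤ k ^ 3 * Fintype.card V :=
    Nat.mul_pos (Nat.pow_pos e.one_le) Fintype.card_pos
  rw [shiftTime_eq e f] at ht
  omega

end counting

/-! ### From ordinary expressions to slick expressions -/

section convert

variable {k : ℕ} (m : Code)

/-- The map on labels that takes `i` to `j`. -/
def relabelMap (i j l : Fin k) : Fin k := if l = i then j else l

/-- A slick expression for the graph of `e`, in which moreover all pairs of vertices whose labels
are related by `F` are joined, and all labels are changed by `M` at the end. -/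
def CWExpr.toSlick : CWExpr k → Finset (Fin k × Fin k) → (Fin k → Fin k) → SlickExpr k
  | vertex i, _, M => .vertex (M i)
  | addEdges i j _ e, F, M => e.toSlick (insert (j, i) (insert (i, j) F)) M
  | relabel i j e, F, M =>
    e.toSlick {p | (relabelMap i j p.1, relabelMap i j p.2) ∈ F} (M ∘ relabelMap i j)
  | union e₁ e₂, F, M => .join F M M (e₁.toSlick F id) (e₂.toSlick F id)

theorem LabeledGraph.addEdges_adj {G : LabeledGraph k} {i j : Fin k} (u v : G.V) :
    (addEdges i j G).graph.Adj u v ↔ G.graph.Adj u v ∨ u ≠ v ∧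
      (G.label u = i ∧ G.label v = j ∨ G.label v = i ∧ G.label u = j) :=
  Iff.rfl

/-- The relation `F` has to be symmetric, because a join at a union uses it only from the left side
to the right side. -/
theorem CWExpr.exists_equiv_toSlick (e : CWExpr k) (F : Finset (Fin k × Fin k))
    (M : Fin k → Fin k) (hF : ∀ a b, (a, b) ∈ F → (b, a) ∈ F) :
    ∃ f : e.eval.V ≃ (e.toSlick F M).eval.V,
      (∀ v, (e.toSlick F M).eval.label (f v) = M (e.eval.label v)) ∧
      ∀ u v, (e.toSlick F M).eval.graph.Adj (f u) (f v) ↔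
        e.eval.graph.Adj u v ∨ (u ≠ v ∧ (e.eval.label u, e.eval.label v) ∈ F) := by
  induction e generalizing F M with
  | vertex i =>
    exact ⟨Equiv.refl Unit, fun _ => rfl, fun u v => ⟨Or.inl, fun h => h.elim id fun h => h.1 rfl⟩⟩
  | addEdges i j hij e ih =>
    obtain ⟨f, hl, ha⟩ := ih (insert (j, i) (insert (i, j) F)) M fun a b => by
      simp only [Finset.mem_insert, Prod.mk.injEq]
      have := hF a b
      tauto
    refine ⟨f, hl, fun u v => (ha u v).trans ?_⟩
    refine Iff.trans ?_ (or_congr_left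
      (LabeledGraph.addEdges_adj (G := e.eval) (i := i) (j := j) u v).symm)
    simp only [Finset.mem_insert, Prod.mk.injEq]
    show _ ↔ _ ∨ u ≠ v ∧ (e.eval.label u, e.eval.label v) ∈ F
    tauto
  | relabel i j e ih =>
    obtain ⟨f, hl, ha⟩ := ih {p | (relabelMap i j p.1, relabelMap i j p.2) ∈ F}
      (M ∘ relabelMap i j) fun a b => by
        simp only [Finset.mem_filter_univ]
        exact hF _ _
    refine ⟨f, hl, fun u v => (ha u v).trans ?_⟩
    simp only [Finset.mem_filter_univ]
    rfl
  | union e₁ e₂ ih₁ ih₂ =>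
    obtain ⟨f₁, hl₁, ha₁⟩ := ih₁ F id hF
    obtain ⟨f₂, hl₂, ha₂⟩ := ih₂ F id hF
    have hcross (u : e₁.eval.V) (v : e₂.eval.V) :
        ((e₁.toSlick F id).eval.label (f₁ u), (e₂.toSlick F id).eval.label (f₂ v)) ∈ F ↔
        (e₁.eval.label u, e₂.eval.label v) ∈ F := by
      rw [hl₁, hl₂]; rfl
    refine ⟨Equiv.sumCongr f₁ f₂, ?_, ?_⟩
    · rintro (v | v)
      exacts [congrArg M (hl₁ v), congrArg M (hl₂ v)]
    · rintro (u | u) (v | v)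
      · refine (LabeledGraph.slickJoin_adj_inl_inl _ _).trans ((ha₁ u v).trans ?_)
        simp [eval, LabeledGraph.disjUnion]
      · refine (LabeledGraph.slickJoin_adj_inl_inr _ _).trans ((hcross u v).trans ?_)
        simp [eval, LabeledGraph.disjUnion]
      · refine (SimpleGraph.adj_comm _ _ _).trans <|
          (LabeledGraph.slickJoin_adj_inl_inr _ _).trans ((hcross v u).trans ?_)
        have := hF (e₁.eval.label v) (e₂.eval.label u)
        have := hF (e₂.eval.label u) (e₁.eval.label v)
        simp [eval, LabeledGraph.disjUnion]
        tauto
      · refine (LabeledGraph.slickJoin_adj_inr_inr _ _).trans ((ha₂ u v).trans ?_)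
        simp [eval, LabeledGraph.disjUnion]

/-- Without further edges and relabellings, the slick expression produces the same graph. -/
theorem CWExpr.nonempty_iso_toSlick (e : CWExpr k) :
    Nonempty ((e.toSlick ∅ id).eval.graph ≃g e.eval.graph) := by
  obtain ⟨f, -, ha⟩ := e.exists_equiv_toSlick ∅ id (by simp)
  exact ⟨SimpleGraph.Iso.symm ⟨f, fun {u v} => by simp [ha]⟩⟩

/-! ### The time of the conversion -/

/-- The number of vertices that an expression creates. -/
def CWExpr.numVertices : CWExpr k → ℕ
  | vertex _ => 1
  | addEdges _ _ _ e => e.numVertices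
  | relabel _ _ e => e.numVertices
  | union e₁ e₂ => e₁.numVertices + e₂.numVertices

theorem CWExpr.card_toSlick (e : CWExpr k) (F : Finset (Fin k × Fin k)) (M : Fin k → Fin k) :
    Fintype.card (e.toSlick F M).eval.V = e.numVertices := by
  induction e generalizing F M with
  | vertex i => exact Fintype.card_unit
  | addEdges i j hij e ih => exact ih _ _
  | relabel i j e ih => exact ih _ _
  | union e₁ e₂ ih₁ ih₂ => exact Fintype.card_sum.trans (congrArg₂ _ (ih₁ _ _) (ih₂ _ _))

theorem update_relabelMap {α : Type*} (f : Fin k → α) (i j : Fin k) :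
    Function.update f i (f j) = fun a => f (relabelMap i j a) := by
  funext a
  simp only [Function.update_apply, relabelMap]
  split_ifs <;> rfl

theorem runs_nth (f : Fin k → Val) (i : Fin k) :
    Runs (m :: procedures) (.call Proc.nth) (.ofList [.ofList (List.ofFn f), encodeLabel i]) (f i)
      (40 * k) := by
  induction k with
  | zero => exact i.elim0
  | succ k ih =>
    rw [List.ofFn_succ]
    refine Exec.runs (c := .nth) rfl ?_
    cases i using Fin.cases with
    | zero => exact ite_intro_neg zero_cast_not_pos ⟨rfl, by omega⟩
    | succ i =>
      refine ite_intro_pos (succ_cast_pos i) ?_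
      refine (ih (fun i => f i.succ) i).wp_of_eq
        (by simp [Val.ofList, encodeLabel]) fun t ht => ?_
      exact ⟨rfl, by omega⟩

theorem runs_setAt (f : Fin k → Val) (i : Fin k) (a : Val) :
    Runs (m :: procedures) (.call Proc.setAt) (.ofList [.ofList (List.ofFn f), encodeLabel i, a])
      (.ofList (List.ofFn (Function.update f i a))) (60 * k) := by
  induction k with
  | zero => exact i.elim0
  | succ k ih =>
    rw [List.ofFn_succ, List.ofFn_succ]
    refine Exec.runs (c := .setAt) rfl ?_
    cases i using Fin.cases with
    | zero =>
      refine ite_intro_neg zero_cast_not_pos ⟨?_, by omega⟩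
      simp [Val.ofList]
    | succ i =>
      refine ite_intro_pos (succ_cast_pos i) ?_
      refine (ih (fun i => f i.succ) i).wp_of_eq
        (by simp [Val.ofList, encodeLabel]) fun t ht => ?_
      refine ⟨?_, by omega⟩
      have : (fun l : Fin k => Function.update f i.succ a l.succ) =
          Function.update (fun i => f i.succ) i a := by
        funext l
        simp [Function.update_apply]
      rw [this, Function.update_of_ne (Fin.succ_ne_zero i).symm]
      rfl

theorem runs_replicate (i : ℕ) (a : Val) :
    Runs (m :: procedures) (.call Proc.replicate) (.ofList [.atom i, a])
      (.ofList (List.replicate i a)) (30 * i + 30) := by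
  induction i with
  | zero =>
    exact Exec.runs (c := .replicate) rfl (ite_intro_neg zero_cast_not_pos ⟨rfl, by omega⟩)
  | succ i ih =>
    refine Exec.runs (c := .replicate) rfl (ite_intro_pos (succ_cast_pos i) ?_)
    refine ih.wp_of_eq (by rw [sub_const_one]; rfl) fun t ht => ?_
    exact ⟨rfl, by omega⟩

theorem runs_iota (i : ℕ) (l : List Val) :
    Runs (m :: procedures) (.call Proc.iota) (.ofList [.atom i, .ofList l])
      (.ofList (List.ofFn (fun j : Fin i => .atom ((j : ℕ) : ℝ)) ++ l)) (50 * i + 30) := by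
  induction i generalizing l with
  | zero =>
    exact Exec.runs (c := .iota) rfl (ite_intro_neg zero_cast_not_pos ⟨by simp, by omega⟩)
  | succ i ih =>
    refine Exec.runs (c := .iota) rfl (ite_intro_pos (succ_cast_pos i) ?_)
    refine (ih (.atom i :: l)).wp_of_eq (by simp [Val.ofList]) fun t ht => ?_
    refine ⟨?_, by omega⟩
    rw [List.ofFn_succ']
    simp

/-- Replacing the column `i` of a matrix by its column `j` amounts to composing the index of the
columns with `relabelMap i j`. -/
theorem runs_copyColumn (r : Fin k → Fin k → Val) (i j : Fin k) :
    Runs (m :: procedures) (.call Proc.copyColumn)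
      (.ofList [.ofList (List.ofFn fun a => .ofList (List.ofFn (r a))), encodeLabel i,
        encodeLabel j])
      (.ofList (List.ofFn fun a => .ofList (List.ofFn fun b => r a (relabelMap i j b))))
      (250 * (k * k)) := by
  have hk := i.pos
  have hkk : k ≤ k * k := Nat.le_mul_self k
  have := runs_map m (self := Proc.copyColumn) rfl (fun a => .ofList (List.ofFn (r a)))
    (fun a => .ofList (List.ofFn fun b => r a (relabelMap i j b))) (List.ofFn id)
    (.ofList [encodeLabel i, encodeLabel j]) (100 * k + 50) fun a _ => ?_
  · simp only [List.map_ofFn, List.length_ofFn] at this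
    refine Runs.mono this ?_
    have : (100 * k + 50 + 30) * k = 100 * (k * k) + 80 * k := by ring
    omega
  · refine (runs_nth m (r a) j).wp fun t ht => ?_
    refine (runs_setAt m (r a) i (r a j)).wp fun s hs => ?_
    refine ⟨?_, by omega⟩
    rw [update_relabelMap]

theorem encodeRel_insert (i j : Fin k) (F : Finset (Fin k × Fin k)) :
    encodeRel (insert (i, j) F) =
      .ofList (List.ofFn (Function.update
        (fun a => .ofList (List.ofFn fun b => if (a, b) ∈ F then Val.atom 1 else Val.atom 0)) i
        (.ofList (List.ofFn (Function.update
          (fun b => if (i, b) ∈ F then Val.atom 1 else Val.atom 0) j (.atom 1)))))) := by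
  rw [encodeRel]
  congr 2
  funext a
  by_cases ha : a = i
  · subst ha
    rw [Function.update_self]
    congr 2
    funext b
    by_cases hb : b = j
    · subst hb; simp
    · simp [hb]
  · simp [ha]

/-- The part of the conversion that adds the pair `(i, j)` to a relation. -/
theorem exists_runs_insert (i j : Fin k) (F : Finset (Fin k × Fin k)) :
    ∃ row, Runs (m :: procedures) (.call Proc.nth) (.ofList [encodeRel F, encodeLabel i]) row
        (40 * k) ∧
      ∃ row', Runs (m :: procedures) (.call Proc.setAt)
          (.ofList [row, encodeLabel j, .atom ((1 : ℚ) : ℝ)]) row' (60 * k) ∧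
        Runs (m :: procedures) (.call Proc.setAt) (.ofList [encodeRel F, encodeLabel i, row'])
          (encodeRel (insert (i, j) F)) (60 * k) := by
  rw [encodeRel_insert, Rat.cast_one]
  exact ⟨_, runs_nth m _ i, _, runs_setAt m _ j _, runs_setAt m _ i _⟩

/-- The time `1000 k` for a vertex or a union is paid for by the vertices, of which there are more
than unions. -/
theorem runs_convert (e : CWExpr k) (F : Finset (Fin k × Fin k)) (M : Fin k → Fin k) :
    ∃ T, T + 1000 * k ≤ 2000 * k * e.numVertices +
        1000 * (k * k) * e.numRelabel + 1000 * k * e.numAddEdges ∧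
      Runs (m :: procedures) (.call Proc.convert)
        (.ofList [e.encode, encodeRel F, encodeMap M, encodeMap (id : Fin k → Fin k)])
        (e.toSlick F M).encode T := by
  induction e generalizing F M with
  | vertex i =>
    have hk := i.pos
    refine ⟨1000 * k, ?_, ?_⟩
    · simp only [CWExpr.numVertices, CWExpr.numRelabel, CWExpr.numAddEdges]
      omega
    · refine Exec.runs (c := .convert) rfl (ite_intro_neg (lt_irrefl 0) ?_)
      refine (runs_nth m (fun i => encodeLabel (M i)) i).wp fun t ht => ?_
      refine ⟨?_, by omega⟩
      simp [CWExpr.toSlick, SlickExpr.encode, Val.ofList]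
  | addEdges i j hij e ih =>
    have hk := i.pos
    obtain ⟨T, hT, hrun⟩ := ih (insert (j, i) (insert (i, j) F)) M
    refine ⟨T + 1000 * k, ?_, ?_⟩
    · simp only [CWExpr.numVertices, CWExpr.numRelabel, CWExpr.numAddEdges, mul_add]
      omega
    · obtain ⟨_, h₁, _, h₂, h₃⟩ := exists_runs_insert m i j F
      obtain ⟨_, h₄, _, h₅, h₆⟩ := exists_runs_insert m j i (insert (i, j) F)
      refine Exec.runs (c := .convert) rfl (ite_intro_pos one_pos (ite_intro_neg (by simp) ?_))
      refine h₁.wp fun t₁ ht₁ => h₂.wp fun t₂ ht₂ => h₃.wp fun t₃ ht₃ => ?_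
      refine h₄.wp fun t₄ ht₄ => h₅.wp fun t₅ ht₅ => h₆.wp fun t₆ ht₆ => ?_
      refine hrun.wp fun t ht => ?_
      exact ⟨rfl, by omega⟩
  | relabel i j e ih =>
    have hk := i.pos
    have hkk : k ≤ k * k := Nat.le_mul_self k
    obtain ⟨T, hT, hrun⟩ := ih {p | (relabelMap i j p.1, relabelMap i j p.2) ∈ F}
      (M ∘ relabelMap i j)
    refine ⟨T + 1000 * (k * k), ?_, ?_⟩
    · simp only [CWExpr.numVertices, CWExpr.numRelabel, CWExpr.numAddEdges, mul_add]
      omega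
    · refine Exec.runs (c := .convert) rfl (ite_intro_pos two_pos
        (ite_intro_pos (by norm_num) (ite_intro_neg (by norm_num) ?_)))
      refine (runs_nth m _ j).wp fun t₁ ht₁ => (runs_setAt m _ i _).wp fun t₂ ht₂ => ?_
      rw [update_relabelMap]
      refine (runs_copyColumn m (fun a b => if (relabelMap i j a, b) ∈ F then .atom 1 else .atom 0)
        i j).wp fun t₃ ht₃ => ?_
      refine (runs_nth m (fun i => encodeLabel (M i)) j).wp fun t₄ ht₄ => ?_
      refine (runs_setAt m (fun i => encodeLabel (M i)) i _).wp fun t₅ ht₅ => ?_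
      rw [update_relabelMap]
      refine hrun.wp_of_eq (by simp [encodeRel, encodeMap, Val.ofList]) fun t ht => ?_
      exact ⟨rfl, by omega⟩
  | union e₁ e₂ ih₁ ih₂ =>
    obtain ⟨T₁, hT₁, hrun₁⟩ := ih₁ F id
    obtain ⟨T₂, hT₂, hrun₂⟩ := ih₂ F id
    have hk := (e₁.toSlick F id).one_le
    refine ⟨T₁ + T₂ + 1000 * k, ?_, ?_⟩
    · simp only [CWExpr.numVertices, CWExpr.numRelabel, CWExpr.numAddEdges, mul_add]
      omega
    · refine Exec.runs (c := .convert) rfl (ite_intro_pos three_pos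
        (ite_intro_pos (by norm_num) (ite_intro_pos (by norm_num) ?_)))
      refine hrun₁.wp fun t₁ ht₁ => hrun₂.wp fun t₂ ht₂ => ?_
      refine ⟨?_, by omega⟩
      simp [CWExpr.toSlick, SlickExpr.encode, Val.ofList]

theorem haltsWithin_cwProgram (e : CWExpr k) {V : Type*} [Fintype V] [Nonempty V] [DecidableEq V]
    {G : SimpleGraph V} [DecidableRel G.Adj] (f : e.eval.graph ≃g G) (I : RealInterval) :
    HaltsWithin cwProgram (inputOf k e.encode I) (.atom (eigenvalueCount G I.toSet))
      (20000000 * (k ^ 3 * Fintype.card V + k ^ 2 * e.numRelabel + k * e.numAddEdges)) := by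
  obtain ⟨g⟩ := e.nonempty_iso_toSlick
  have hk := (e.toSlick ∅ id).one_le
  refine Runs.haltsWithin (Exec.runs (i := 0) rfl ?_)
  obtain ⟨T, hT, hrun⟩ := runs_convert _ e ∅ id
  refine (runs_replicate _ k _).wp fun t₁ ht₁ => (runs_replicate _ k _).wp fun t₂ ht₂ => ?_
  refine (runs_iota _ k []).wp fun t₃ ht₃ => (runs_iota _ k []).wp fun t₄ ht₄ => ?_
  refine hrun.wp_of_eq (by simp [Val.ofList, encodeRel, encodeMap, encodeLabel]) fun t₅ ht₅ => ?_
  refine (runs_count _ (e.toSlick ∅ id) I).wp fun t ht => ?_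
  refine ⟨by rw [eigenvalueCount_of_iso _ (g.trans f)], ?_⟩
  rw [shiftTime_eq _ (g.trans f)] at ht
  have hn : e.numVertices = Fintype.card V := by
    rw [← e.card_toSlick ∅ id]
    exact Fintype.card_congr (g.trans f).toEquiv
  have hkn : k * Fintype.card V ≤ k ^ 3 * Fintype.card V :=
    Nat.mul_le_mul_right _ (Nat.le_self_pow (by norm_num) k)
  have hkk : k ≤ k * Fintype.card V := Nat.le_mul_of_pos_right _ Fintype.card_pos
  rw [hn, ← sq, mul_assoc, mul_assoc, mul_assoc] at hT
  omega

end convert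

/-! ### Expressions and clique-width -/

section cliqueWidth

variable {k : ℕ}

/-- The same expression with more labels at hand. -/
def CWExpr.castLE {k' : ℕ} (h : k ≤ k') : CWExpr k → CWExpr k'
  | vertex i => vertex (i.castLE h)
  | addEdges i j hij e =>
    addEdges (i.castLE h) (j.castLE h) ((Fin.castLE_injective h).ne hij) (e.castLE h)
  | relabel i j e => relabel (i.castLE h) (j.castLE h) (e.castLE h)
  | union e₁ e₂ => union (e₁.castLE h) (e₂.castLE h)

theorem CWExpr.exists_equiv_castLE {k' : ℕ} (h : k ≤ k') (e : CWExpr k) :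
    ∃ f : e.eval.V ≃ (e.castLE h).eval.V,
      (∀ v, (e.castLE h).eval.label (f v) = (e.eval.label v).castLE h) ∧
      ∀ u v, (e.castLE h).eval.graph.Adj (f u) (f v) ↔ e.eval.graph.Adj u v := by
  induction e with
  | vertex i => exact ⟨Equiv.refl Unit, fun _ => rfl, fun _ _ => Iff.rfl⟩
  | addEdges i j hij e ih =>
    obtain ⟨f, hl, ha⟩ := ih
    refine ⟨f, hl, fun (u v : e.eval.V) => ?_⟩
    refine (LabeledGraph.addEdges_adj (G := (e.castLE h).eval) (f u) (f v)).trans <|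
      Iff.trans ?_ (LabeledGraph.addEdges_adj (G := e.eval) (i := i) (j := j) u v).symm
    simp only [hl, ha, f.injective.ne_iff, (Fin.castLE_injective h).eq_iff]
  | relabel i j e ih =>
    obtain ⟨f, hl, ha⟩ := ih
    refine ⟨f, fun (v : e.eval.V) => ?_, ha⟩
    show (if (e.castLE h).eval.label (f v) = i.castLE h then j.castLE h else _) =
      (if e.eval.label v = i then j else _).castLE h
    simp only [hl, (Fin.castLE_injective h).eq_iff]
    split_ifs
    exacts [rfl, hl v]
  | union e₁ e₂ ih₁ ih₂ =>
    obtain ⟨f₁, hl₁, ha₁⟩ := ih₁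
    obtain ⟨f₂, hl₂, ha₂⟩ := ih₂
    refine ⟨Equiv.sumCongr f₁ f₂, ?_, ?_⟩
    · rintro (v | v)
      exacts [hl₁ v, hl₂ v]
    · rintro (u | u) (v | v)
      exacts [ha₁ u v, Iff.rfl, Iff.rfl, ha₂ u v]

/-- A set of isolated vertices with different labels. -/
theorem exists_cwExpr_edgeless {s : Finset (Fin k)} (hs : s.Nonempty) :
    ∃ e : CWExpr k, Function.Injective e.eval.label ∧ Set.range e.eval.label = s ∧
      ∀ u v, ¬ e.eval.graph.Adj u v := by
  induction hs using Finset.Nonempty.cons_induction with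
  | singleton a =>
    refine ⟨.vertex a, fun _ _ _ => rfl, ?_, fun _ _ h => h⟩
    rw [Finset.coe_singleton]
    exact Set.range_const (ι := Unit)
  | cons a s ha hs ih =>
    obtain ⟨e, hi, hr, hadj⟩ := ih
    refine ⟨.union (.vertex a) e, ?_, ?_, ?_⟩
    · refine Function.Injective.sumElim (fun _ _ _ => rfl) hi fun _ v h => ha ?_
      rw [← Finset.mem_coe, ← hr]
      exact ⟨v, h.symm⟩
    · refine (Set.Sum.elim_range _ _).trans ?_
      rw [hr, Finset.coe_cons]
      exact congrArg (· ∪ (s : Set (Fin k))) (Set.range_const (ι := Unit))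
    · rintro (u | u) (v | v)
      exacts [fun h => h, Bool.false_ne_true, Bool.false_ne_true, hadj u v]

theorem exists_cwExpr_adj [NeZero k] (E : Finset (Fin k × Fin k)) (hE : ∀ p ∈ E, p.1 ≠ p.2) :
    ∃ e : CWExpr k, Function.Bijective e.eval.label ∧ ∀ u v, e.eval.graph.Adj u v ↔
      (e.eval.label u, e.eval.label v) ∈ E ∨ (e.eval.label v, e.eval.label u) ∈ E := by
  induction E using Finset.induction_on with
  | empty =>
    obtain ⟨e, hi, hr, hadj⟩ := exists_cwExpr_edgeless (Finset.univ_nonempty (α := Fin k))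
    refine ⟨e, ⟨hi, ?_⟩, by simp [hadj]⟩
    rw [← Set.range_eq_univ, hr, Finset.coe_univ]
  | insert p E hp ih =>
    obtain ⟨e, hb, hadj⟩ := ih fun p hp => hE p (Finset.mem_insert_of_mem hp)
    have hne := hE p (Finset.mem_insert_self p E)
    refine ⟨.addEdges p.1 p.2 hne e, hb, fun (u v : e.eval.V) => ?_⟩
    refine (LabeledGraph.addEdges_adj (G := e.eval) u v).trans ?_
    rw [hadj]
    show _ ↔ (e.eval.label u, e.eval.label v) ∈ _ ∨ (e.eval.label v, e.eval.label u) ∈ _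
    have : e.eval.label u = p.1 ∧ e.eval.label v = p.2 ∨
        e.eval.label v = p.1 ∧ e.eval.label u = p.2 → u ≠ v := by
      rintro h rfl
      exact hne (h.elim (fun h => h.1.symm.trans h.2) fun h => h.1.symm.trans h.2)
    simp only [Finset.mem_insert, Prod.ext_iff]
    tauto

/-- Every nonempty finite graph has an expression, in which each vertex has a label of its own. -/
theorem exists_cwExpr {V : Type*} [Fintype V] [Nonempty V] (G : SimpleGraph V) :
    ∃ e : CWExpr (Fintype.card V), e.Generates G := by
  classical
  have : NeZero (Fintype.card V) := ⟨Fintype.card_ne_zero⟩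
  let ψ := Fintype.equivFin V
  obtain ⟨e, hb, hadj⟩ := exists_cwExpr_adj
    (Finset.univ.filter fun p : Fin (Fintype.card V) × Fin (Fintype.card V) =>
      G.Adj (ψ.symm p.1) (ψ.symm p.2)) fun p hp h => by
        rw [Finset.mem_filter_univ, h] at hp
        exact G.irrefl hp
  refine ⟨e, ⟨(Equiv.ofBijective _ hb).trans ψ.symm, fun {u v} => ?_⟩⟩
  simp [hadj, G.adj_comm]

theorem exists_slickExpr {V : Type*} [Fintype V] [Nonempty V] {G : SimpleGraph V}
    (h : cliqueWidth G ≤ k) : ∃ e : SlickExpr k, e.Generates G := by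
  obtain ⟨e, ⟨f⟩⟩ : ∃ e : CWExpr (cliqueWidth G), e.Generates G :=
    Nat.sInf_mem (s := {k | ∃ e : CWExpr k, e.Generates G}) ⟨_, exists_cwExpr G⟩
  obtain ⟨g, -, hg⟩ := e.exists_equiv_castLE h
  obtain ⟨g'⟩ := (e.castLE h).nonempty_iso_toSlick
  exact ⟨_, ⟨g'.trans ((SimpleGraph.Iso.symm ⟨g, fun {u v} => hg u v⟩).trans f)⟩⟩

end cliqueWidth

theorem mainTheorem3 :
    ∃ (P Q : List Code) (C : ℕ),
      ∀ (k : ℕ) (V : Type*) [Fintype V] [Nonempty V] [DecidableEq V]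
        (G : SimpleGraph V) [DecidableRel G.Adj],
        (cliqueWidth G ≤ k → ∃ e : SlickExpr k, e.Generates G) ∧
        (∀ e : SlickExpr k, e.Generates G → ∀ I : RealInterval,
          HaltsWithin P (inputOf k e.encode I)
            (Val.atom (eigenvalueCount G I.toSet : ℝ))
            (C * (k ^ 3 * Fintype.card V))) ∧
        (∀ e : CWExpr k, e.Generates G → ∀ I : RealInterval,
          HaltsWithin Q (inputOf k e.encode I)
            (Val.atom (eigenvalueCount G I.toSet : ℝ))
            (C * (k ^ 3 * Fintype.card V + k ^ 2 * e.numRelabel + k * e.numAddEdges))) :=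
  ⟨slickProgram, cwProgram, 20000000, fun _ _ _ _ _ _ _ => ⟨exists_slickExpr,
    fun e ⟨f⟩ I => haltsWithin_slickProgram e f I, fun e ⟨f⟩ I => haltsWithin_cwProgram e f I⟩⟩
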